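/- Let $K$ be a field, $\delta\in K$, $r\ge 0$. For $p,s\ge0$ let $D(p,s)$ be the set of Brauer diagrams, i.e. perfect matchings of $[p]\sqcup[s]$ (with $[p]$ on the top edge and $[s]$ on the bottom edge). Let $KD(p,s)$ be the vector space with basis $D(p,s)$, with the composition $KD(s,t)\times KD(p,s)\to KD(p,t)$, $(y,x)\mapsto yx=\delta^{c(x,y)}\,x\circ y$, where $x\circ y$ is obtained by stacking $x$ on top of $y$ and removing the $c(x,y)$ closed loops that arise. Let $D_r=KD(r,r)$ be the Brauer algebra with parameter $\delta$, regarded as a subalgebra of $D_{r+1}$ by adding a through strand on the right, and let $A_p=K\mathfrak S_p\subseteq D_p$; $A_p$ is embedded in $A_{p+1}$ by fixing the last point. Modules are left modules. The propagating number of $z\in D(p,s)$ is the least $q$ such that $z=x\circ y$ for some $x\in D(p,q)$, $y\in D(q,s)$. Let $KD(p,r;p)$ be the $(D_r,A_p)$-bimodule obtained from $KD(p,r)$ by setting the diagrams with propagating number less than $p$ equal to zero; it is zero if $p>r$. For an $A_p$-module $V$ the inflation is the $D_r$-module $$\mathrm{Inf}_p^r V = KD(p,r;p)\otimes_{A_p}V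 .$$ Assume that $D_r$ is semisimple. Then: 1. For every $p\ge 0$ and every $A_p$-module $V$ there is an isomorphism of $D_r$-modules $$(\mathrm{Inf}_p^{r+1}V)\downarrow^{D_{r+1}}_{D_r}\;\cong\;\mathrm{Inf}_{p+1}^r\bigl(V\uparrow_{A_p}^{A_{p+1}}\bigr)\oplus \mathrm{Inf}_{p-1}^r\bigl(V\downarrow^{A_p}_{A_{p-1}}\bigr),$$ where $V\uparrow_{A_p}^{A_{p+1}}=A_{p+1}\otimes_{A_p}V$ and the second summand is omitted if $p=0$. 2. For a partition $\lambda$ of $p$ let $S^\lambda$ be the Specht module of $\mathfrak S_p$ over $K$ (the left ideal of $A_p$ generated by the Young symmetrizer, column antisymmetrizer times row symmetrizer, of a filling of $\lambda$), and put $U(s,\lambda)=\mathrm{Inf}_p^{s}(S^\lambda)$ for $s\ge0$. Then for every partition $\lambda$ $$U(r+1,\lambda)\downarrow^{D_{r+1}}_{D_r}\;\cong\;\bigoplus_{\mu=\lambda\pm\square}U(r,\mu),$$ the sum being over all partitions $\mu$ obtained from $\lambda$ by adding or removing one cell, each occurring once. -/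

import Mathlib

noncomputable section

namespace Brauer

section Gluing

variable {A B C E : Type}

/-- Stacking an equivalence relation on `A ⊔ B` on top of one on `B ⊔ C`: the equivalence relation
they generate on `A ⊔ B ⊔ C`. -/
def stack (x : Setoid (A ⊕ B)) (y : Setoid (B ⊕ C)) : Setoid (A ⊕ (B ⊕ C)) :=
  x.map (Sum.map id Sum.inl) ⊔ y.map Sum.inr

/-- The inclusion of the points on the top and bottom edges into all points of a stacked pair. -/
def outer : A ⊕ C → A ⊕ (B ⊕ C) := Sum.map id Sum.inr

/-- The relation induced on the points of the top and bottom edges by the stacked pair. -/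
def glue (x : Setoid (A ⊕ B)) (y : Setoid (B ⊕ C)) : Setoid (A ⊕ C) :=
  (stack x y).comap outer

/-- The number of floating components of the stacked pair, that is of those components that
contain no point of the top or of the bottom edge. -/
def floating (x : Setoid (A ⊕ B)) (y : Setoid (B ⊕ C)) : ℕ :=
  Nat.card {q : Quotient (stack x y) // ∀ o : A ⊕ C, Quotient.mk (stack x y) (outer o) ≠ q}

lemma stack_le_iff (x : Setoid (A ⊕ B)) (y : Setoid (B ⊕ C)) (R : Setoid (A ⊕ (B ⊕ C))) :
    stack x y ≤ R ↔ x ≤ R.comap (Sum.map id Sum.inl) ∧ y ≤ R.comap Sum.inr := by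
  rw [stack, sup_le_iff]
  constructor
  · rintro ⟨h1, h2⟩
    exact ⟨fun a b h => h1 (Setoid.le_comap_map h), fun a b h => h2 (Setoid.le_comap_map h)⟩
  · rintro ⟨h1, h2⟩
    constructor
    · apply Setoid.eqvGen_le
      rintro _ _ ⟨a, b, h, rfl, rfl⟩
      exact h1 h
    · apply Setoid.eqvGen_le
      rintro _ _ ⟨a, b, h, rfl, rfl⟩
      exact h2 h

open Classical in
/-- The indicator function of the two-colourings that are constant on all classes. -/
def wt (x : Setoid (A ⊕ B)) (i : A → Bool) (j : B → Bool) : ℕ :=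
  if x ≤ Setoid.ker (Sum.elim i j) then 1 else 0

lemma wt_unique {x y : Setoid (A ⊕ B)} {m n : ℕ}
    (h : ∀ i j, 2 ^ m * wt x i j = 2 ^ n * wt y i j) : m = n ∧ x = y := by
  classical
  have e : m = n := by
    have := h (fun _ => true) (fun _ => true)
    have t : ∀ z : Setoid (A ⊕ B), wt z (fun _ => true) (fun _ => true) = 1 := by
      intro z
      rw [wt, if_pos]
      rintro (a | a) (b | b) _ <;> rfl
    rw [t, t, mul_one, mul_one] at this
    exact Nat.pow_right_injective le_rfl this
  refine ⟨e, ?_⟩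
  subst e
  have h' : ∀ f : A ⊕ B → Bool, x ≤ Setoid.ker f ↔ y ≤ Setoid.ker f := by
    intro f
    have := Nat.eq_of_mul_eq_mul_left (by positivity) (h (f ∘ Sum.inl) (f ∘ Sum.inr))
    simp only [wt, Sum.elim_comp_inl_inr] at this
    by_cases h1 : x ≤ Setoid.ker f <;> by_cases h2 : y ≤ Setoid.ker f <;> simp_all
  have key : ∀ z : Setoid (A ⊕ B), ∀ a, z ≤ Setoid.ker (fun b => decide (z a b)) := by
    intro z a b c hbc
    have : z a b ↔ z a c := ⟨fun h => z.trans h hbc, fun h => z.trans h (z.symm hbc)⟩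
    simp [Setoid.ker_def, this]
  apply le_antisymm
  · intro a b hab
    have := (h' _).2 (key y a) hab
    simpa [Setoid.ker_def, y.refl a] using this
  · intro a b hab
    have := (h' _).1 (key x a) hab
    simpa [Setoid.ker_def, x.refl a] using this

lemma sum_wt [Fintype B] (x : Setoid (A ⊕ B)) (y : Setoid (B ⊕ C)) [Finite A] [Finite C]
    [DecidableEq B] (i : A → Bool) (k : C → Bool) :
    ∑ j : B → Bool, wt x i j * wt y j k = 2 ^ floating x y * wt (glue x y) i k := by
  classical
  have hst : ∀ j : B → Bool, (x ≤ Setoid.ker (Sum.elim i j) ∧ y ≤ Setoid.ker (Sum.elim j k)) ↔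
      stack x y ≤ Setoid.ker (Sum.elim i (Sum.elim j k)) := by
    intro j
    rw [stack_le_iff]
    have e1 : Sum.elim i (Sum.elim j k) ∘ Sum.map id Sum.inl = Sum.elim i j := by
      ext (a | b) <;> rfl
    have e2 : Sum.elim i (Sum.elim j k) ∘ Sum.inr = Sum.elim j k := rfl
    rw [← e1, ← e2]
    rfl
  have hsum : ∑ j : B → Bool, wt x i j * wt y j k =
      Nat.card {j : B → Bool // stack x y ≤ Setoid.ker (Sum.elim i (Sum.elim j k))} := by
    rw [Nat.card_eq_fintype_card, Fintype.card_subtype, Finset.card_filter]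
    apply Finset.sum_congr rfl
    intro j _
    simp only [← hst, wt]
    by_cases h1 : x ≤ Setoid.ker (Sum.elim i j) <;> by_cases h2 : y ≤ Setoid.ker (Sum.elim j k) <;>
      simp [h1, h2]
  have hout : ∀ j : B → Bool, Sum.elim i (Sum.elim j k) ∘ outer = Sum.elim i k := by
    intro j
    ext (a | b) <;> rfl
  rw [hsum, wt]
  split_ifs with hc
  · have hφ : ∀ o o' : A ⊕ C, Quotient.mk (stack x y) (outer o) = Quotient.mk (stack x y) (outer o')
        → Sum.elim i k o = Sum.elim i k o' := fun o o' h =>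
      hc (show (glue x y) o o' from Quotient.exact (s := stack x y) h)
    let φ : ({q : Quotient (stack x y) // ∀ o : A ⊕ C, Quotient.mk (stack x y) (outer o) ≠ q} →
        Bool) → Quotient (stack x y) → Bool := fun g q =>
      if hq : ∃ o : A ⊕ C, Quotient.mk (stack x y) (outer o) = q then Sum.elim i k hq.choose
      else g ⟨q, fun o ho => hq ⟨o, ho⟩⟩
    have φout : ∀ g o, φ g (Quotient.mk (stack x y) (outer o)) = Sum.elim i k o := by
      intro g o
      have hq : ∃ o' : A ⊕ C, Quotient.mk (stack x y) (outer o') =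
          Quotient.mk (stack x y) (outer o) := ⟨o, rfl⟩
      simp only [φ, dif_pos hq]
      exact hφ _ _ hq.choose_spec
    have φin : ∀ g (q : {q : Quotient (stack x y) // ∀ o : A ⊕ C,
        Quotient.mk (stack x y) (outer o) ≠ q}), φ g q.1 = g q := by
      intro g q
      have hq : ¬ ∃ o' : A ⊕ C, Quotient.mk (stack x y) (outer o') = q.1 :=
        fun ⟨o, ho⟩ => q.2 o ho
      simp only [φ, dif_neg hq]
    have φcol : ∀ g, Sum.elim i (Sum.elim
        (fun b => φ g (Quotient.mk (stack x y) (Sum.inr (Sum.inl b)))) k) =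
        fun u => φ g (Quotient.mk (stack x y) u) := by
      intro g
      ext (a | b | c)
      · exact (φout g (Sum.inl a)).symm
      · rfl
      · exact (φout g (Sum.inr c)).symm
    let e : {j : B → Bool // stack x y ≤ Setoid.ker (Sum.elim i (Sum.elim j k))} ≃
        ({q : Quotient (stack x y) // ∀ o : A ⊕ C, Quotient.mk (stack x y) (outer o) ≠ q} →
          Bool) :=
      { toFun := fun j q => Quotient.lift (Sum.elim i (Sum.elim j.1 k)) (fun _ _ h => j.2 h) q.1
        invFun := fun g => ⟨fun b => φ g (Quotient.mk (stack x y) (Sum.inr (Sum.inl b))), by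
          rw [φcol]
          intro u v huv
          exact congrArg (φ g) (Quotient.sound huv)⟩
        left_inv := by
          rintro ⟨j, hj⟩
          apply Subtype.ext
          funext b
          have : ∀ q, φ (fun q => Quotient.lift (Sum.elim i (Sum.elim j k))
              (fun _ _ h => hj h) q.1) q =
              Quotient.lift (Sum.elim i (Sum.elim j k)) (fun _ _ h => hj h) q := by
            intro q
            by_cases hq : ∃ o : A ⊕ C, Quotient.mk (stack x y) (outer o) = q
            · obtain ⟨o, rfl⟩ := hq
              exact (φout (fun q => Quotient.lift (Sum.elim i (Sum.elim j k))
                (fun _ _ h => hj h) q.1) o).trans (congrFun (hout j) o).symm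
            · exact φin (fun q => Quotient.lift (Sum.elim i (Sum.elim j k))
                (fun _ _ h => hj h) q.1) ⟨q, fun o ho => hq ⟨o, ho⟩⟩
          exact this _
        right_inv := by
          intro g
          funext q
          have : ∀ q' : Quotient (stack x y), ∀ h, Quotient.lift (Sum.elim i (Sum.elim
              (fun b => φ g (Quotient.mk (stack x y) (Sum.inr (Sum.inl b)))) k)) h q' = φ g q' := by
            intro q' h
            induction q' using Quotient.inductionOn with
            | h u => exact congrFun (φcol g) u
          exact (this _ _).trans (φin g q) }
    rw [Nat.card_congr e, Nat.card_fun, floating, mul_one]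
    simp
  · rw [mul_zero]
    have : IsEmpty {j : B → Bool // stack x y ≤ Setoid.ker (Sum.elim i (Sum.elim j k))} := by
      refine ⟨fun ⟨j, hj⟩ => hc ?_⟩
      intro o o' h
      have := hj h
      rw [Setoid.ker_def] at this ⊢
      rw [← hout j]
      exact this
    exact Nat.card_of_isEmpty

lemma glue_assoc_aux [Finite A] [Finite B] [Finite C] [Finite E]
    (x : Setoid (A ⊕ B)) (y : Setoid (B ⊕ C)) (z : Setoid (C ⊕ E)) :
    floating x y + floating (glue x y) z = floating y z + floating x (glue y z) ∧
      glue (glue x y) z = glue x (glue y z) := by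
  classical
  have := Fintype.ofFinite B
  have := Fintype.ofFinite C
  apply wt_unique
  intro i l
  rw [pow_add, pow_add, mul_assoc, mul_assoc, ← sum_wt, ← sum_wt, Finset.mul_sum, Finset.mul_sum]
  simp_rw [← mul_assoc, ← sum_wt]
  have e : ∀ j, 2 ^ floating y z * wt x i j * wt (glue y z) j l =
      wt x i j * (2 ^ floating y z * wt (glue y z) j l) := fun j => by ring
  simp_rw [e, ← sum_wt, Finset.mul_sum, Finset.sum_mul]
  rw [Finset.sum_comm]
  simp_rw [mul_assoc]

/-- The relation on `A ⊔ B` whose classes are the graph pairs `a ~ π a` of a bijection. -/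
def graphRel (π : A ≃ B) : Setoid (A ⊕ B) := Setoid.ker (Sum.elim π id)

lemma wt_graphRel (π : A ≃ B) (i : A → Bool) (j : B → Bool) [Decidable (i = j ∘ π)] :
    wt (graphRel π) i j = if i = j ∘ π then 1 else 0 := by
  classical
  rw [wt]
  congr 1
  apply propext
  constructor
  · intro h
    funext a
    exact h (show graphRel π (Sum.inl a) (Sum.inr (π a)) from rfl)
  · rintro rfl
    have : Sum.elim (j ∘ π) j = j ∘ Sum.elim π id := by ext (a | b) <;> rfl
    rw [this]
    intro u v huv
    exact congrArg j huv

lemma graphRel_glue [Finite A] [Finite B] [Finite C] (π : A ≃ B) (x : Setoid (B ⊕ C)) :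
    floating (graphRel π) x = 0 ∧
      glue (graphRel π) x = x.comap (Sum.map π id) := by
  classical
  have := Fintype.ofFinite B
  apply wt_unique
  intro i k
  rw [← sum_wt]
  have : ∀ j : B → Bool, i = j ∘ π ↔ j = i ∘ π.symm := by
    intro j
    constructor
    · rintro rfl; ext; simp
    · rintro rfl; ext; simp
  simp only [wt_graphRel, this, ite_mul, zero_mul, one_mul, Finset.sum_ite_eq',
    Finset.mem_univ, if_true, pow_zero]
  simp only [wt]
  congr 1
  apply propext
  constructor
  · intro h u v huv
    have := h huv
    rcases u with u | u <;> rcases v with v | v <;> simpa [Setoid.ker_def] using this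
  · intro h u v huv
    have := @h (Sum.map π.symm id u) (Sum.map π.symm id v) (by
      show x _ _
      rcases u with u | u <;> rcases v with v | v <;> simpa using huv)
    rcases u with u | u <;> rcases v with v | v <;> simpa [Setoid.ker_def] using this

lemma glue_graphRel [Finite A] [Finite B] [Finite C] (x : Setoid (A ⊕ B)) (π : B ≃ C) :
    floating x (graphRel π) = 0 ∧
      glue x (graphRel π) = x.comap (Sum.map id π.symm) := by
  classical
  have := Fintype.ofFinite B
  apply wt_unique
  intro i k
  rw [← sum_wt]
  simp only [wt_graphRel, mul_ite, mul_zero, mul_one, Finset.sum_ite_eq',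
    Finset.mem_univ, if_true, pow_zero, one_mul]
  simp only [wt]
  congr 1
  apply propext
  constructor
  · intro h u v huv
    have := h huv
    rcases u with u | u <;> rcases v with v | v <;> simpa [Setoid.ker_def] using this
  · intro h u v huv
    have := @h (Sum.map id π u) (Sum.map id π v) (by
      show x _ _
      rcases u with u | u <;> rcases v with v | v <;> simpa using huv)
    rcases u with u | u <;> rcases v with v | v <;> simpa [Setoid.ker_def] using this

/-- All classes have exactly two elements. -/
def IsMatching {X : Type} (x : Setoid X) : Prop := ∀ a, ∃! b, b ≠ a ∧ x a b

lemma IsMatching.exists_partner {X : Type} {x : Setoid X} (hx : IsMatching x) :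
    ∃ f : X → X, (∀ a, f (f a) = a) ∧ (∀ a, f a ≠ a) ∧ ∀ a b, x a b ↔ b = a ∨ b = f a := by
  choose f hf hu using hx
  refine ⟨f, fun a => ?_, fun a => (hf a).1, fun a b => ⟨fun h => ?_, ?_⟩⟩
  · exact (hu (f a) a ⟨(hf a).1.symm, x.symm (hf a).2⟩).symm
  · by_cases hb : b = a
    · exact Or.inl hb
    · exact Or.inr (hu a b ⟨hb, h⟩)
  · rintro (rfl | rfl)
    · exact x.refl _
    · exact (hf a).2

/-- A component of the union of two finite matchings that has an end has exactly two ends. -/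
lemma exists_unique_end {X : Type} [Finite X] (R : Setoid X) (F G : Equiv.Perm X)
    (hF : ∀ a, F (F a) = a) (hG : ∀ a, G (G a) = a)
    (hRF : ∀ a, R a (F a)) (hRG : ∀ a, R a (G a))
    (hmin : ∀ S : Setoid X, (∀ a, S a (F a)) → (∀ a, S a (G a)) → R ≤ S)
    (a : X) (ha : G a = a) (ha' : F a ≠ a) :
    ∃! b, b ≠ a ∧ R a b ∧ (F b = b ∨ G b = b) := by
  set P : Equiv.Perm X := G * F with hP
  have hFF : F * F = 1 := Equiv.ext hF
  have hGG : G * G = 1 := Equiv.ext hG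
  have hPi : P⁻¹ = F * G := by
    rw [inv_eq_iff_mul_eq_one, hP]
    rw [mul_assoc, ← mul_assoc F, hFF, one_mul, hGG]
  have hGP : ∀ k : ℤ, G * P ^ k = P ^ (-k) * G := by
    intro k
    have h1 : G * P * G⁻¹ = P⁻¹ := by
      rw [hPi, hP, ← mul_assoc, hGG, one_mul, inv_eq_of_mul_eq_one_right hGG]
    have h2 := conj_zpow (i := k) (a := G) (b := P)
    rw [h1, inv_zpow'] at h2
    rw [h2, inv_mul_cancel_right]
  have hGk : ∀ k : ℤ, G ((P ^ k) a) = (P ^ (-k)) a := by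
    intro k
    have := congrArg (fun f : Equiv.Perm X => f a) (hGP k)
    simpa [Equiv.Perm.mul_apply, ha] using this
  have hFk : ∀ k : ℤ, F ((P ^ k) a) = (P ^ (-k - 1)) a := by
    intro k
    have h1 : F = P⁻¹ * G := by rw [hPi, mul_assoc, hGG, mul_one]
    conv_lhs => rw [h1]
    rw [Equiv.Perm.mul_apply, hGk, ← Equiv.Perm.mul_apply, ← zpow_neg_one, ← zpow_add]
    congr 2
    ring
  have hRP : ∀ k : ℤ, R a ((P ^ k) a) := by
    have hs : ∀ c, R c (P c) := fun c => R.trans (hRF c) (hRG (F c))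
    intro k
    induction k with
    | zero => exact R.refl a
    | succ n ih =>
      have e : (P ^ ((n : ℤ) + 1)) a = P ((P ^ (n : ℤ)) a) := by
        rw [add_comm, zpow_add, zpow_one]; rfl
      rw [e]; exact R.trans ih (hs _)
    | pred n ih =>
      have e : P ((P ^ (-(n : ℤ) - 1)) a) = (P ^ (-(n : ℤ))) a := by
        conv_lhs => rw [← zpow_one P, ← Equiv.Perm.mul_apply, zpow_one, ← zpow_one_add]
        congr 2
        ring
      have := hs ((P ^ (-(n : ℤ) - 1)) a)
      rw [e] at this
      exact R.trans ih (R.symm this)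
  have hRk : ∀ b, R a b → ∃ k : ℤ, b = (P ^ k) a := by
    intro b hb
    have hF' : ∀ c, (∃ k : ℤ, c = (P ^ k) a) → ∃ k : ℤ, F c = (P ^ k) a := by
      rintro c ⟨k, rfl⟩; exact ⟨_, hFk k⟩
    have hG' : ∀ c, (∃ k : ℤ, c = (P ^ k) a) → ∃ k : ℤ, G c = (P ^ k) a := by
      rintro c ⟨k, rfl⟩; exact ⟨_, hGk k⟩
    have := hmin (Setoid.ker fun c => ∃ k : ℤ, c = (P ^ k) a)
      (fun c => propext ⟨hF' c, fun h => by simpa [hF] using hF' _ h⟩)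
      (fun c => propext ⟨hG' c, fun h => by simpa [hG] using hG' _ h⟩) hb
    rw [Setoid.ker_def] at this
    exact this ▸ ⟨0, by simp⟩
  set n : ℕ := Function.minimalPeriod (P • ·) a with hn
  have hdvd : ∀ k l : ℤ, (P ^ k) a = (P ^ l) a ↔ (n : ℤ) ∣ k - l := by
    intro k l
    rw [hn, ← MulAction.zpow_smul_eq_iff_minimalPeriod_dvd, Equiv.Perm.smul_def, sub_eq_neg_add,
      zpow_add, Equiv.Perm.mul_apply, zpow_neg, Equiv.Perm.inv_eq_iff_eq]
  have hnpos : 0 < n := by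
    apply Function.minimalPeriod_pos_of_mem_periodicPts
    exact Function.Injective.mem_periodicPts (MulAction.injective P) a
  have h0 : ∀ k : ℤ, (P ^ k) a = a ↔ (n : ℤ) ∣ k := by
    intro k; simpa using hdvd k 0
  have hn1 : n ≠ 1 := by
    intro h1
    apply ha'
    have := hFk 0
    simp only [zpow_zero, Equiv.Perm.one_apply] at this
    rw [this, h0, h1]
    simp
  have hend : ∀ k : ℤ, (F ((P ^ k) a) = (P ^ k) a ∨ G ((P ^ k) a) = (P ^ k) a) ↔
      ((n : ℤ) ∣ 2 * k + 1 ∨ (n : ℤ) ∣ 2 * k) := by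
    intro k
    rw [hFk, hGk, hdvd, hdvd]
    have e1 : -k - 1 - k = -(2 * k + 1) := by ring
    have e2 : -k - k = -(2 * k) := by ring
    rw [e1, e2, dvd_neg, dvd_neg]
  obtain ⟨m, hm⟩ := Nat.even_or_odd' n
  have hmpos : 0 < m := by omega
  have hnm : ¬ (n : ℤ) ∣ (m : ℤ) := by
    intro h
    have := Nat.le_of_dvd hmpos (Int.natCast_dvd_natCast.1 h)
    omega
  refine ⟨(P ^ (m : ℤ)) a, ⟨fun h => hnm ((h0 _).1 h), hRP _, (hend _).2 ?_⟩, ?_⟩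
  · rcases hm with hm | hm
    · right; exact ⟨1, by rw [hm]; push_cast; ring⟩
    · left; exact ⟨1, by rw [hm]; push_cast; ring⟩
  · rintro b ⟨hba, hRb, hb⟩
    obtain ⟨k, rfl⟩ := hRk b hRb
    rw [hend] at hb
    rw [Ne, h0] at hba
    rw [hdvd]
    rcases hm with hm | hm
    · rcases hb with ⟨c, hc⟩ | ⟨c, hc⟩
      · exfalso
        rw [hm] at hc; push_cast at hc
        have : 2 * ((m : ℤ) * c - k) = 1 := by linarith
        omega
      · rw [hm] at hc; push_cast at hc
        have hk : k = m * c := by linarith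
        rcases Int.even_or_odd' c with ⟨d, hd | hd⟩
        · exfalso; apply hba; exact ⟨d, by rw [hk, hd, hm]; push_cast; ring⟩
        · exact ⟨d, by rw [hk, hd, hm]; push_cast; ring⟩
    · have hcop : IsCoprime (n : ℤ) 2 := ⟨1, -m, by rw [hm]; push_cast; ring⟩
      rcases hb with hb | hb
      · apply hcop.dvd_of_dvd_mul_left
        have : 2 * (k - (m : ℤ)) = (2 * k + 1) - n := by rw [hm]; push_cast; ring
        rw [this]
        exact dvd_sub hb dvd_rfl
      · exact absurd (hcop.dvd_of_dvd_mul_left hb) hba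

lemma IsMatching.glue [Finite A] [Finite B] [Finite C] {x : Setoid (A ⊕ B)} {y : Setoid (B ⊕ C)}
    (hx : IsMatching x) (hy : IsMatching y) : IsMatching (glue x y) := by
  obtain ⟨f, hf, hf', hxf⟩ := hx.exists_partner
  obtain ⟨g, hg, hg', hyg⟩ := hy.exists_partner
  let F : A ⊕ (B ⊕ C) → A ⊕ (B ⊕ C) := Sum.elim (fun a => Sum.map id Sum.inl (f (Sum.inl a)))
    (Sum.elim (fun b => Sum.map id Sum.inl (f (Sum.inr b))) (fun c => Sum.inr (Sum.inr c)))
  let G : A ⊕ (B ⊕ C) → A ⊕ (B ⊕ C) := Sum.elim Sum.inl (fun u => Sum.inr (g u))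
  have hFu : ∀ u : A ⊕ B, F (Sum.map id Sum.inl u) = Sum.map id Sum.inl (f u) := by
    rintro (a | b) <;> rfl
  have hFF : Function.Involutive F := by
    rintro (a | b | c)
    · have := hFu (f (Sum.inl a)); rw [hf] at this; exact this
    · have := hFu (f (Sum.inr b)); rw [hf] at this; exact this
    · rfl
  have hGG : Function.Involutive G := by
    rintro (a | u)
    · rfl
    · exact congrArg Sum.inr (hg u)
  have hinj : Function.Injective (Sum.map id Sum.inl : A ⊕ B → A ⊕ (B ⊕ C)) :=
    Sum.map_injective.2 ⟨Function.injective_id, Sum.inl_injective⟩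
  have hFfix : ∀ u, F u = u ↔ ∃ c, u = Sum.inr (Sum.inr c) := by
    rintro (a | b | c)
    · refine ⟨fun h => absurd (hinj (a₁ := f (Sum.inl a)) (a₂ := Sum.inl a) h)
        (hf' _), by simp⟩
    · refine ⟨fun h => absurd (hinj (a₁ := f (Sum.inr b)) (a₂ := Sum.inr b) h)
        (hf' _), by simp⟩
    · exact ⟨fun _ => ⟨c, rfl⟩, fun _ => rfl⟩
  have hGfix : ∀ u, G u = u ↔ ∃ a, u = Sum.inl a := by
    rintro (a | u)
    · exact ⟨fun _ => ⟨a, rfl⟩, fun _ => rfl⟩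
    · exact ⟨fun h => absurd (Sum.inr_injective h) (hg' u), by simp⟩
  have hends : ∀ u, (F u = u ∨ G u = u) ↔ ∃ o : A ⊕ C, u = outer o := by
    intro u
    rw [hFfix, hGfix]
    constructor
    · rintro (⟨c, rfl⟩ | ⟨a, rfl⟩)
      · exact ⟨Sum.inr c, rfl⟩
      · exact ⟨Sum.inl a, rfl⟩
    · rintro ⟨a | c, rfl⟩
      · exact Or.inr ⟨a, rfl⟩
      · exact Or.inl ⟨c, rfl⟩
  have hle := (stack_le_iff x y (stack x y)).1 le_rfl
  have hRF : ∀ u, stack x y u (F u) := by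
    rintro (a | b | c)
    · exact hle.1 ((hxf (Sum.inl a) _).2 (Or.inr rfl))
    · exact hle.1 ((hxf (Sum.inr b) _).2 (Or.inr rfl))
    · exact (stack x y).refl _
  have hRG : ∀ u, stack x y u (G u) := by
    rintro (a | u)
    · exact (stack x y).refl _
    · exact hle.2 ((hyg _ _).2 (Or.inr rfl))
  have hmin : ∀ S : Setoid (A ⊕ (B ⊕ C)), (∀ a, S a (F a)) → (∀ a, S a (G a)) →
      stack x y ≤ S := by
    intro S h1 h2
    rw [stack_le_iff]
    constructor
    · intro u v huv
      rcases (hxf _ _).1 huv with rfl | rfl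
      · exact S.refl _
      · have := h1 (Sum.map id Sum.inl u)
        rw [hFu] at this
        exact this
    · intro u v huv
      rcases (hyg _ _).1 huv with rfl | rfl
      · exact S.refl _
      · exact h2 (Sum.inr u)
  have hout : Function.Injective (outer : A ⊕ C → A ⊕ (B ⊕ C)) :=
    Sum.map_injective.2 ⟨Function.injective_id, Sum.inr_injective⟩
  have main : ∀ o : A ⊕ C, ∃! b, b ≠ outer o ∧ stack x y (outer o) b ∧ (F b = b ∨ G b = b) := by
    rintro (a | c)
    · exact exists_unique_end (stack x y) hFF.toPerm hGG.toPerm hFF hGG hRF hRG hmin _ rfl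
        (fun h => by obtain ⟨c, hc⟩ := (hFfix (Sum.inl a)).1 h; cases hc)
    · have := exists_unique_end (stack x y) hGG.toPerm hFF.toPerm hGG hFF hRG hRF
        (fun S h1 h2 => hmin S h2 h1) (outer (Sum.inr c)) rfl
        (fun h => by obtain ⟨b, hb⟩ := (hGfix (Sum.inr (Sum.inr c))).1 h; cases hb)
      have e : ∀ b, (G b = b ∨ F b = b) ↔ (F b = b ∨ G b = b) := fun b => or_comm
      simp only [← e]
      exact this
  intro o
  obtain ⟨b, ⟨hb1, hb2, hb3⟩, hbu⟩ := main o
  obtain ⟨o', rfl⟩ := (hends b).1 hb3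
  refine ⟨o', ⟨fun h => hb1 (h ▸ rfl), hb2⟩, ?_⟩
  rintro o'' ⟨h1, h2⟩
  exact hout (hbu _ ⟨fun h => h1 (hout h), h2, (hends _).2 ⟨o'', rfl⟩⟩)

end Gluing

section Diagrams

/-- A Brauer diagram from `r` to `s` points: a perfect matching of `[r] ⊔ [s]`, given as the
partition of `[r] ⊔ [s]` into its strands, which are sets of size two. The summand `Fin r` is the
top edge, the summand `Fin s` the bottom edge. -/
@[ext]
structure Diagram (r s : ℕ) where
  rel : Setoid (Fin r ⊕ Fin s)
  isMatching : IsMatching rel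

/-- The diagram obtained by stacking `x` on top of `y` and removing all loops. -/
def Diagram.comp {r s t : ℕ} (x : Diagram r s) (y : Diagram s t) : Diagram r t :=
  ⟨glue x.rel y.rel, x.isMatching.glue y.isMatching⟩

/-- The number of loops that arise when `x` is stacked on top of `y`. -/
def Diagram.loops {r s t : ℕ} (x : Diagram r s) (y : Diagram s t) : ℕ :=
  floating x.rel y.rel

lemma Diagram.comp_assoc {r s t u : ℕ} (x : Diagram r s) (y : Diagram s t) (z : Diagram t u) :
    (x.comp y).comp z = x.comp (y.comp z) :=
  Diagram.ext (glue_assoc_aux x.rel y.rel z.rel).2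

lemma Diagram.loops_assoc {r s t u : ℕ} (x : Diagram r s) (y : Diagram s t) (z : Diagram t u) :
    x.loops y + (x.comp y).loops z = y.loops z + x.loops (y.comp z) :=
  (glue_assoc_aux x.rel y.rel z.rel).1

lemma isMatching_graphRel {A B : Type} (π : A ≃ B) : IsMatching (graphRel π) := by
  rintro (a | b)
  · refine ⟨Sum.inr (π a), ⟨by simp, rfl⟩, ?_⟩
    rintro (a' | b) ⟨h1, h2⟩
    · exact absurd (congrArg Sum.inl (π.injective h2)).symm h1
    · exact congrArg Sum.inr (h2 : π a = b).symm
  · refine ⟨Sum.inl (π.symm b), ⟨by simp, ?_⟩, ?_⟩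
    · exact (π.apply_symm_apply b).symm
    · rintro (a | b') ⟨h1, h2⟩
      · exact congrArg Sum.inl ((Equiv.symm_apply_eq π).2 (h2 : b = π a)).symm
      · exact absurd (congrArg Sum.inr (h2 : b = b').symm) h1

/-- The diagram of a permutation: the top point `i` is joined to the bottom point `π i`. -/
def permDiagram {r : ℕ} (π : Equiv.Perm (Fin r)) : Diagram r r :=
  ⟨graphRel π, isMatching_graphRel π⟩

lemma permDiagram_loops {r s : ℕ} (π : Equiv.Perm (Fin r)) (x : Diagram r s) :
    (permDiagram π).loops x = 0 := (graphRel_glue π x.rel).1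

lemma loops_permDiagram {r s : ℕ} (x : Diagram r s) (π : Equiv.Perm (Fin s)) :
    x.loops (permDiagram π) = 0 := (glue_graphRel x.rel π).1

lemma permDiagram_one_comp {r s : ℕ} (x : Diagram r s) : (permDiagram 1).comp x = x := by
  apply Diagram.ext
  refine (graphRel_glue (1 : Equiv.Perm (Fin r)) x.rel).2.trans ?_
  have : Sum.map (1 : Equiv.Perm (Fin r)) id = (id : Fin r ⊕ Fin s → _) := by
    ext (a | a) <;> rfl
  rw [this]
  rfl

lemma comp_permDiagram_one {r s : ℕ} (x : Diagram r s) : x.comp (permDiagram 1) = x := by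
  apply Diagram.ext
  refine (glue_graphRel x.rel (1 : Equiv.Perm (Fin s))).2.trans ?_
  have : Sum.map id (1 : Equiv.Perm (Fin s)).symm = (id : Fin r ⊕ Fin s → _) := by
    ext (a | a) <;> rfl
  rw [this]
  rfl

lemma permDiagram_comp {r : ℕ} (π σ : Equiv.Perm (Fin r)) :
    (permDiagram π).comp (permDiagram σ) = permDiagram (σ * π) := by
  apply Diagram.ext
  refine (graphRel_glue π (permDiagram σ).rel).2.trans ?_
  show (Setoid.ker _).comap _ = Setoid.ker _
  ext (a | a) (b | b) <;> rfl

/-- The relation underlying `x ⊗ id₁`: the diagram `x` with one more through strand to its right. -/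
def addStrandRel {r s : ℕ} (x : Setoid (Fin r ⊕ Fin s)) : Setoid (Fin (r + 1) ⊕ Fin (s + 1)) :=
  Setoid.ker (Sum.elim
    (Fin.snoc (α := fun _ => Option (Quotient x))
      (fun i => some (Quotient.mk x (Sum.inl i))) none)
    (Fin.snoc (α := fun _ => Option (Quotient x))
      (fun j => some (Quotient.mk x (Sum.inr j))) none))

/-- All points but the last ones. -/
def castPt {r s : ℕ} : Fin r ⊕ Fin s → Fin (r + 1) ⊕ Fin (s + 1) :=
  Sum.map Fin.castSucc Fin.castSucc

lemma castPt_injective {r s : ℕ} : Function.Injective (castPt : Fin r ⊕ Fin s → _) :=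
  Sum.map_injective.2 ⟨Fin.castSucc_injective _, Fin.castSucc_injective _⟩

lemma castPt_cases {r s : ℕ} (u : Fin (r + 1) ⊕ Fin (s + 1)) :
    (∃ v, u = castPt v) ∨ u = Sum.inl (Fin.last r) ∨ u = Sum.inr (Fin.last s) := by
  rcases u with u | u
  · induction u using Fin.lastCases with
    | last => exact Or.inr (Or.inl rfl)
    | cast i => exact Or.inl ⟨Sum.inl i, rfl⟩
  · induction u using Fin.lastCases with
    | last => exact Or.inr (Or.inr rfl)
    | cast i => exact Or.inl ⟨Sum.inr i, rfl⟩

section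
variable {r s : ℕ} (x : Setoid (Fin r ⊕ Fin s))

lemma addStrandRel_cast (u v : Fin r ⊕ Fin s) : addStrandRel x (castPt u) (castPt v) ↔ x u v := by
  rw [addStrandRel, Setoid.ker_def]
  rcases u with u | u <;> rcases v with v | v <;>
    simp only [castPt, Sum.map_inl, Sum.map_inr, Sum.elim_inl, Sum.elim_inr, Fin.snoc_castSucc,
      Option.some.injEq] <;> exact Quotient.eq

lemma addStrandRel_inl (u : Fin r ⊕ Fin s) :
    ¬ addStrandRel x (castPt u) (Sum.inl (Fin.last r)) := by
  rw [addStrandRel, Setoid.ker_def]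
  rcases u with u | u <;> simp [castPt]

lemma addStrandRel_inr (u : Fin r ⊕ Fin s) :
    ¬ addStrandRel x (castPt u) (Sum.inr (Fin.last s)) := by
  rw [addStrandRel, Setoid.ker_def]
  rcases u with u | u <;> simp [castPt]

lemma addStrandRel_last : addStrandRel x (Sum.inl (Fin.last r)) (Sum.inr (Fin.last s)) := by
  rw [addStrandRel, Setoid.ker_def]
  simp

end

/-- The diagram `x ⊗ id₁`. -/
def Diagram.addStrand {r s : ℕ} (x : Diagram r s) : Diagram (r + 1) (s + 1) where
  rel := addStrandRel x.rel
  isMatching := by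
    intro u
    rcases castPt_cases u with ⟨v, rfl⟩ | rfl | rfl
    · obtain ⟨w, ⟨h1, h2⟩, h3⟩ := x.isMatching v
      refine ⟨castPt w, ⟨fun h => h1 (castPt_injective h), (addStrandRel_cast _ _ _).2 h2⟩, ?_⟩
      rintro w' ⟨h4, h5⟩
      rcases castPt_cases w' with ⟨w', rfl⟩ | rfl | rfl
      · exact congrArg castPt
          (h3 w' ⟨fun h => h4 (congrArg castPt h), (addStrandRel_cast _ _ _).1 h5⟩)
      · exact absurd h5 (addStrandRel_inl _ _)
      · exact absurd h5 (addStrandRel_inr _ _)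
    · refine ⟨_, ⟨by simp, addStrandRel_last _⟩, ?_⟩
      rintro w' ⟨h4, h5⟩
      rcases castPt_cases w' with ⟨w', rfl⟩ | rfl | rfl
      · exact absurd ((addStrandRel x.rel).symm h5) (addStrandRel_inl _ _)
      · exact absurd rfl h4
      · rfl
    · refine ⟨_, ⟨by simp, (addStrandRel x.rel).symm (addStrandRel_last _)⟩, ?_⟩
      rintro w' ⟨h4, h5⟩
      rcases castPt_cases w' with ⟨w', rfl⟩ | rfl | rfl
      · exact absurd ((addStrandRel x.rel).symm h5) (addStrandRel_inr _ _)
      · rfl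
      · exact absurd rfl h4

lemma wt_addStrandRel {r s : ℕ} (x : Setoid (Fin r ⊕ Fin s)) (i : Fin (r + 1) → Bool)
    (j : Fin (s + 1) → Bool) :
    wt (addStrandRel x) i j =
      if i (Fin.last r) = j (Fin.last s) then wt x (i ∘ Fin.castSucc) (j ∘ Fin.castSucc) else 0 := by
  classical
  have e : ∀ u, Sum.elim i j (castPt u) =
      Sum.elim (i ∘ Fin.castSucc) (j ∘ Fin.castSucc) u := by
    rintro (u | u) <;> rfl
  rw [wt, wt, ← ite_and]
  congr 1
  apply propext
  constructor
  · intro h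
    refine ⟨h (addStrandRel_last x), fun u v huv => ?_⟩
    have := h ((addStrandRel_cast x u v).2 huv)
    rw [Setoid.ker_def, e, e] at this
    exact this
  · rintro ⟨h1, h2⟩ u v huv
    rw [Setoid.ker_def]
    rcases castPt_cases u with ⟨u, rfl⟩ | rfl | rfl <;>
      rcases castPt_cases v with ⟨v, rfl⟩ | rfl | rfl
    · rw [e, e]
      exact h2 ((addStrandRel_cast x u v).1 huv)
    · exact absurd huv (addStrandRel_inl _ _)
    · exact absurd huv (addStrandRel_inr _ _)
    · exact absurd ((addStrandRel x).symm huv) (addStrandRel_inl _ _)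
    · rfl
    · exact h1
    · exact absurd ((addStrandRel x).symm huv) (addStrandRel_inr _ _)
    · exact h1.symm
    · rfl

lemma addStrandRel_glue {r s t : ℕ} (x : Setoid (Fin r ⊕ Fin s)) (y : Setoid (Fin s ⊕ Fin t)) :
    floating (addStrandRel x) (addStrandRel y) = floating x y ∧
      glue (addStrandRel x) (addStrandRel y) = addStrandRel (glue x y) := by
  classical
  apply wt_unique
  intro i k
  rw [← sum_wt, ← (Fin.snocEquiv (fun _ : Fin (s + 1) => Bool)).sum_comp, Fintype.sum_prod_type]
  have e : ∀ (b : Bool) (j : Fin s → Bool),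
      (Fin.snocEquiv (fun _ : Fin (s + 1) => Bool) (b, j)) ∘ Fin.castSucc = j := by
    intro b j
    funext a
    simp [Fin.snocEquiv]
  have e' : ∀ (b : Bool) (j : Fin s → Bool),
      (Fin.snocEquiv (fun _ : Fin (s + 1) => Bool) (b, j)) (Fin.last s) = b := by
    intro b j
    simp [Fin.snocEquiv]
  simp only [wt_addStrandRel, e, e']
  by_cases h : i (Fin.last r) = k (Fin.last t)
  · rw [if_pos h, ← sum_wt, Fintype.sum_eq_single (i (Fin.last r))]
    · simp [h]
    · intro b hb
      simp [hb.symm]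
  · rw [if_neg h, mul_zero]
    apply Finset.sum_eq_zero
    intro b _
    apply Finset.sum_eq_zero
    intro j _
    by_cases hb : i (Fin.last r) = b
    · subst hb
      simp [h]
    · simp [hb]

lemma Diagram.addStrand_comp {r s t : ℕ} (x : Diagram r s) (y : Diagram s t) :
    x.addStrand.comp y.addStrand = (x.comp y).addStrand :=
  Diagram.ext (addStrandRel_glue x.rel y.rel).2

lemma Diagram.addStrand_loops {r s t : ℕ} (x : Diagram r s) (y : Diagram s t) :
    x.addStrand.loops y.addStrand = x.loops y :=
  (addStrandRel_glue x.rel y.rel).1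

lemma addStrand_one (r : ℕ) : (permDiagram (1 : Equiv.Perm (Fin r))).addStrand = permDiagram 1 := by
  apply Diagram.ext
  have h : ∀ n (a b : Fin n ⊕ Fin n), graphRel (1 : Equiv.Perm (Fin n)) a b ↔
      Sum.elim id id a = Sum.elim id id b := fun n a b => by
    rcases a with a | a <;> rcases b with b | b <;> exact Iff.rfl
  show addStrandRel (graphRel _) = graphRel _
  ext u v
  rw [h]
  rcases castPt_cases u with ⟨u, rfl⟩ | rfl | rfl <;>
    rcases castPt_cases v with ⟨v, rfl⟩ | rfl | rfl
  · rw [addStrandRel_cast, h]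
    rcases u with u | u <;> rcases v with v | v <;> simp [castPt]
  · refine iff_of_false (addStrandRel_inl _ _) ?_
    rcases u with u | u <;> simp [castPt, Fin.castSucc_ne_last]
  · refine iff_of_false (addStrandRel_inr _ _) ?_
    rcases u with u | u <;> simp [castPt, Fin.castSucc_ne_last]
  · refine iff_of_false (fun h => addStrandRel_inl _ _ ((addStrandRel _).symm h)) ?_
    rcases v with u | u <;> simp [castPt, (Fin.castSucc_ne_last _).symm]
  · exact iff_of_true ((addStrandRel _).refl _) rfl
  · exact iff_of_true (addStrandRel_last _) rfl
  · refine iff_of_false (fun h => addStrandRel_inr _ _ ((addStrandRel _).symm h)) ?_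
    rcases v with u | u <;> simp [castPt, (Fin.castSucc_ne_last _).symm]
  · exact iff_of_true ((addStrandRel _).symm (addStrandRel_last _)) rfl
  · exact iff_of_true ((addStrandRel _).refl _) rfl

/-- The propagating number: the least `p` such that `z` factors through `p` points. -/
def Diagram.pr {r s : ℕ} (z : Diagram r s) : ℕ :=
  sInf {p : ℕ | ∃ (x : Diagram r p) (y : Diagram p s), z = x.comp y}

lemma Diagram.pr_comp_le {r s t : ℕ} (x : Diagram r s) (y : Diagram s t) :
    (x.comp y).pr ≤ y.pr := by
  have hne : {p : ℕ | ∃ (a : Diagram s p) (b : Diagram p t), y = a.comp b}.Nonempty :=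
    ⟨s, permDiagram 1, y, (permDiagram_one_comp y).symm⟩
  obtain ⟨a, b, hab⟩ := Nat.sInf_mem hne
  exact Nat.sInf_le ⟨x.comp a, b,
    (congrArg x.comp hab).trans (Diagram.comp_assoc x a b).symm⟩

end Diagrams

section Algebras

universe u v w

variable {K : Type u} [Field K]

/-- The morphisms from `r` to `s` in the Brauer category with parameter `δ`: the `K`-vector space
with basis the Brauer diagrams from `r` to `s`. -/
def DiagHom (_δ : K) (r s : ℕ) : Type u := Diagram r s →₀ K

instance (δ : K) (r s : ℕ) : AddCommGroup (DiagHom δ r s) :=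
  inferInstanceAs (AddCommGroup (Diagram r s →₀ K))

instance (δ : K) (r s : ℕ) : Module K (DiagHom δ r s) :=
  inferInstanceAs (Module K (Diagram r s →₀ K))

/-- A diagram as a basis element of the space of morphisms. -/
def DiagHom.of (δ : K) {r s : ℕ} (x : Diagram r s) : DiagHom δ r s := Finsupp.single x (1 : K)

/-- Composition of morphisms, written from right to left: for diagrams `x : r → s` and `y : s → t`
the composite `y x` is `δ ^ c` times the diagram of `x` stacked on top of `y`, where `c` is the
number of loops removed. -/
def DiagHom.mul (δ : K) (r s t : ℕ) : DiagHom δ s t →ₗ[K] DiagHom δ r s →ₗ[K] DiagHom δ r t :=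
  Finsupp.linearCombination K (fun y : Diagram s t =>
    (Finsupp.linearCombination K (fun x : Diagram r s =>
      δ ^ x.loops y • DiagHom.of δ (x.comp y)) : DiagHom δ r s →ₗ[K] DiagHom δ r t))

lemma DiagHom.mul_of (δ : K) {r s t : ℕ} (y : Diagram s t) (x : Diagram r s) :
    DiagHom.mul δ r s t (DiagHom.of δ y) (DiagHom.of δ x) =
      δ ^ x.loops y • DiagHom.of δ (x.comp y) := by
  have h1 : DiagHom.mul δ r s t (DiagHom.of δ y) = _ :=
    (Finsupp.linearCombination_single K (1 : K) y).trans (one_smul K _)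
  rw [h1]
  exact (Finsupp.linearCombination_single K (1 : K) x).trans (one_smul K _)

lemma DiagHom.hom_ext {δ : K} {r s : ℕ} {M : Type*} [AddCommGroup M] [Module K M]
    {f g : DiagHom δ r s →ₗ[K] M} (h : ∀ x, f (DiagHom.of δ x) = g (DiagHom.of δ x)) : f = g :=
  Finsupp.lhom_ext' fun x => LinearMap.ext_ring (h x)

lemma DiagHom.mul_assoc (δ : K) {r s t u : ℕ} (z : DiagHom δ t u) (y : DiagHom δ s t)
    (x : DiagHom δ r s) :
    DiagHom.mul δ r s u (DiagHom.mul δ s t u z y) x =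
      DiagHom.mul δ r t u z (DiagHom.mul δ r s t y x) := by
  let L : DiagHom δ t u →ₗ[K] DiagHom δ s t →ₗ[K] DiagHom δ r s →ₗ[K] DiagHom δ r u :=
    (DiagHom.mul δ s t u).compr₂ (DiagHom.mul δ r s u)
  let R : DiagHom δ t u →ₗ[K] DiagHom δ s t →ₗ[K] DiagHom δ r s →ₗ[K] DiagHom δ r u :=
    ((LinearMap.llcomp K (DiagHom δ r s) (DiagHom δ r t) (DiagHom δ r u)).comp
      (DiagHom.mul δ r t u)).compl₂ (DiagHom.mul δ r s t)
  have hLR : L = R := by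
    apply DiagHom.hom_ext; intro z
    apply DiagHom.hom_ext; intro y
    apply DiagHom.hom_ext; intro x
    show DiagHom.mul δ r s u (DiagHom.mul δ s t u (DiagHom.of δ z) (DiagHom.of δ y))
        (DiagHom.of δ x) = DiagHom.mul δ r t u (DiagHom.of δ z)
          (DiagHom.mul δ r s t (DiagHom.of δ y) (DiagHom.of δ x))
    simp only [DiagHom.mul_of, map_smul, LinearMap.smul_apply, smul_smul, ← pow_add,
      Diagram.comp_assoc]
    rw [← Diagram.loops_assoc]
  exact congrArg (fun f => f z y x) hLR

/-- The identity morphism. -/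
def DiagHom.id (δ : K) (r : ℕ) : DiagHom δ r r := DiagHom.of δ (permDiagram 1)

lemma DiagHom.id_mul (δ : K) {r s : ℕ} (x : DiagHom δ r s) :
    DiagHom.mul δ r s s (DiagHom.id δ s) x = x := by
  have : DiagHom.mul δ r s s (DiagHom.id δ s) = LinearMap.id := by
    apply DiagHom.hom_ext; intro x
    rw [DiagHom.id, DiagHom.mul_of, loops_permDiagram, comp_permDiagram_one, pow_zero, one_smul]
    rfl
  exact congrArg (fun f => f x) this

lemma DiagHom.mul_id (δ : K) {r s : ℕ} (x : DiagHom δ r s) :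
    DiagHom.mul δ r r s x (DiagHom.id δ r) = x := by
  have : (DiagHom.mul δ r r s).flip (DiagHom.id δ r) = LinearMap.id := by
    apply DiagHom.hom_ext; intro x
    rw [LinearMap.flip_apply, DiagHom.id, DiagHom.mul_of, permDiagram_loops, permDiagram_one_comp,
      pow_zero, one_smul]
    rfl
  exact congrArg (fun f => f x) this

/-- The Brauer algebra `D_r` with parameter `δ`: the endomorphism algebra of the object `r` of the
Brauer category. -/
def BrauerAlgebra (δ : K) (r : ℕ) : Type u := DiagHom δ r r

instance (δ : K) (r : ℕ) : AddCommGroup (BrauerAlgebra δ r) :=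
  inferInstanceAs (AddCommGroup (DiagHom δ r r))

instance (δ : K) (r : ℕ) : Module K (BrauerAlgebra δ r) :=
  inferInstanceAs (Module K (DiagHom δ r r))

instance (δ : K) (r : ℕ) : Ring (BrauerAlgebra δ r) :=
  { (inferInstance : AddCommGroup (BrauerAlgebra δ r)) with
    mul := fun y x => DiagHom.mul δ r r r y x
    one := DiagHom.id δ r
    mul_assoc := DiagHom.mul_assoc δ
    one_mul := DiagHom.id_mul δ
    mul_one := DiagHom.mul_id δ
    left_distrib := fun y x x' => map_add (DiagHom.mul δ r r r y) x x'
    right_distrib := fun y y' x => LinearMap.map_add₂ (DiagHom.mul δ r r r) y y' x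
    zero_mul := fun x => LinearMap.map_zero₂ (DiagHom.mul δ r r r) x
    mul_zero := fun y => map_zero (DiagHom.mul δ r r r y) }

instance (δ : K) (r : ℕ) : Algebra K (BrauerAlgebra δ r) :=
  Algebra.ofModule (fun c y x => LinearMap.map_smul₂ (DiagHom.mul δ r r r) c y x)
    (fun c y x => map_smul (DiagHom.mul δ r r r y) c x)

/-- The space of morphisms from `p` to `r` is a left module over the endomorphisms of `r`. -/
instance (δ : K) (p r : ℕ) : Module (BrauerAlgebra δ r) (DiagHom δ p r) where
  smul y x := DiagHom.mul δ p r r y x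
  one_smul := DiagHom.id_mul δ
  mul_smul := DiagHom.mul_assoc δ
  smul_zero y := map_zero (DiagHom.mul δ p r r y)
  smul_add y x x' := map_add (DiagHom.mul δ p r r y) x x'
  add_smul y y' x := LinearMap.map_add₂ (DiagHom.mul δ p r r) y y' x
  zero_smul x := LinearMap.map_zero₂ (DiagHom.mul δ p r r) x

instance (δ : K) (p r : ℕ) : IsScalarTower K (BrauerAlgebra δ r) (DiagHom δ p r) :=
  ⟨fun c y x => LinearMap.map_smul₂ (DiagHom.mul δ p r r) c y x⟩

/-- The ideal of the diagrams with propagating number less than `p`. -/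
def lowerIdeal (δ : K) (p r : ℕ) : Submodule (BrauerAlgebra δ r) (DiagHom δ p r) :=
  Submodule.span _ {m | ∃ x : Diagram p r, x.pr < p ∧ m = DiagHom.of δ x}

/-- The module `K D(p, r; p)`: morphisms from `p` to `r`, where diagrams with propagating number
less than `p` are set to zero. Its basis is the set of diagrams with propagating number `p`. -/
abbrev TopHom (δ : K) (p r : ℕ) : Type u := DiagHom δ p r ⧸ lowerIdeal δ p r

/-- Right multiplication by an endomorphism of `p`. -/
def rightMul (δ : K) (p r : ℕ) (a : BrauerAlgebra δ p) :
    DiagHom δ p r →ₗ[BrauerAlgebra δ r] DiagHom δ p r where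
  toFun x := DiagHom.mul δ p p r x a
  map_add' x x' := LinearMap.map_add₂ (DiagHom.mul δ p p r) x x' a
  map_smul' y x := DiagHom.mul_assoc δ y x a

lemma lowerIdeal_le_comap (δ : K) (p r : ℕ) (a : BrauerAlgebra δ p) :
    lowerIdeal δ p r ≤ (lowerIdeal δ p r).comap (rightMul δ p r a) := by
  rw [lowerIdeal, Submodule.span_le]
  rintro _ ⟨x, hx, rfl⟩
  show DiagHom.mul δ p p r (DiagHom.of δ x) a ∈ lowerIdeal δ p r
  have : ⊤ ≤ ((lowerIdeal δ p r).restrictScalars K).comap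
      (DiagHom.mul δ p p r (DiagHom.of δ x)) := by
    have htop : (⊤ : Submodule K (DiagHom δ p p)) =
        Submodule.span K (Set.range (DiagHom.of δ)) := by
      refine Eq.symm (eq_top_iff.2 fun m _ => ?_)
      have := Finsupp.mem_span_range_iff_exists_finsupp (R := K)
        (v := (DiagHom.of δ : Diagram p p → DiagHom δ p p)) (x := m)
      refine this.2 ⟨m, ?_⟩
      have e := Finsupp.sum_single (m : Diagram p p →₀ K)
      refine Eq.trans ?_ e
      apply Finsupp.sum_congr
      intro d _
      exact Finsupp.smul_single_one d _
    rw [htop, Submodule.span_le]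
    rintro _ ⟨d, rfl⟩
    show DiagHom.mul δ p p r (DiagHom.of δ x) (DiagHom.of δ d) ∈
      (lowerIdeal δ p r).restrictScalars K
    rw [DiagHom.mul_of]
    apply Submodule.smul_mem
    exact Submodule.subset_span ⟨d.comp x, (d.pr_comp_le x).trans_lt hx, rfl⟩
  exact this Submodule.mem_top

/-- The right action of the endomorphisms of `p` on `K D(p, r; p)`. -/
def rightAction (δ : K) (p r : ℕ) :
    (BrauerAlgebra δ p)ᵐᵒᵖ →ₐ[K] Module.End (BrauerAlgebra δ r) (TopHom δ p r) where
  toFun a := Submodule.mapQ _ _ (rightMul δ p r a.unop) (lowerIdeal_le_comap δ p r a.unop)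
  map_one' := by
    apply Submodule.linearMap_qext
    ext x
    exact congrArg (Submodule.Quotient.mk) (DiagHom.mul_id δ x)
  map_mul' a b := by
    apply Submodule.linearMap_qext
    ext x
    exact congrArg (Submodule.Quotient.mk) (DiagHom.mul_assoc δ x b.unop a.unop).symm
  map_zero' := by
    apply Submodule.linearMap_qext
    ext x
    exact congrArg (Submodule.Quotient.mk) (map_zero (DiagHom.mul δ p p r x))
  map_add' a b := by
    apply Submodule.linearMap_qext
    ext x
    exact congrArg (Submodule.Quotient.mk) (map_add (DiagHom.mul δ p p r x) a.unop b.unop)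
  commutes' c := by
    apply Submodule.linearMap_qext
    ext x
    refine congrArg (Submodule.Quotient.mk)
      ((map_smul (DiagHom.mul δ p p r x) c (DiagHom.id δ p)).trans ?_)
    rw [DiagHom.mul_id]

/-- The group algebra `A_p = K 𝔖_p`. -/
abbrev SymAlgebra (K : Type u) [Field K] (p : ℕ) : Type u :=
  MonoidAlgebra K (Equiv.Perm (Fin p))

/-- The inclusion of `K 𝔖_p` in `D_p`. -/
def permHom (δ : K) (p : ℕ) : SymAlgebra K p →ₐ[K] BrauerAlgebra δ p :=
  MonoidAlgebra.lift K (BrauerAlgebra δ p) (Equiv.Perm (Fin p))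
    { toFun := fun π => DiagHom.of δ (permDiagram π)
      map_one' := rfl
      map_mul' := fun σ π => by
        refine Eq.trans ?_ (DiagHom.mul_of δ (permDiagram σ) (permDiagram π)).symm
        rw [permDiagram_loops, pow_zero, one_smul, permDiagram_comp] }

/-- The inclusion of `D_r` in `D_{r+1}`, which adds a through strand. -/
def addStrandHom (δ : K) (r : ℕ) : BrauerAlgebra δ r →ₐ[K] BrauerAlgebra δ (r + 1) :=
  let f : BrauerAlgebra δ r →ₗ[K] BrauerAlgebra δ (r + 1) :=
    Finsupp.linearCombination K (fun x : Diagram r r => DiagHom.of δ x.addStrand)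
  have hf : ∀ x, f (DiagHom.of δ x) = DiagHom.of δ x.addStrand := fun x =>
    (Finsupp.linearCombination_single K (1 : K) x).trans (one_smul K _)
  AlgHom.ofLinearMap f
    ((hf _).trans (congrArg (DiagHom.of δ) (addStrand_one r)))
    (by
      intro y x
      let L : BrauerAlgebra δ r →ₗ[K] BrauerAlgebra δ r →ₗ[K] BrauerAlgebra δ (r + 1) :=
        (LinearMap.mul K (BrauerAlgebra δ r)).compr₂ f
      let R : BrauerAlgebra δ r →ₗ[K] BrauerAlgebra δ r →ₗ[K] BrauerAlgebra δ (r + 1) :=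
        (LinearMap.mul K (BrauerAlgebra δ (r + 1))).compl₁₂ f f
      have : L = R := by
        refine DiagHom.hom_ext (δ := δ) (r := r) (s := r) ?_; intro y
        refine DiagHom.hom_ext (δ := δ) (r := r) (s := r) ?_; intro x
        show f (DiagHom.mul δ r r r (DiagHom.of δ y) (DiagHom.of δ x)) =
          DiagHom.mul δ (r + 1) (r + 1) (r + 1) (f (DiagHom.of δ y)) (f (DiagHom.of δ x))
        rw [hf, hf, DiagHom.mul_of, DiagHom.mul_of, Diagram.addStrand_loops, Diagram.addStrand_comp]
        exact (map_smul f _ _).trans (congrArg _ (hf _))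
      exact congrArg (fun g => g y x) this)

/-- The inclusion of `K 𝔖_p` in `K 𝔖_{p+1}`, where `𝔖_p` fixes the last point. -/
def symIncl (K : Type u) [Field K] (p : ℕ) : SymAlgebra K p →ₐ[K] SymAlgebra K (p + 1) :=
  MonoidAlgebra.mapDomainAlgHom K K (Equiv.Perm.viaEmbeddingHom (Fin.castSuccEmb (n := p)))

section Bimodules

variable {A : Type u} [Ring A] [Algebra K A] {B : Type w} [Ring B] [Algebra K B]

/-- The tensor product `P ⊗_A V` of a `(B, A)`-bimodule `P` and a left `A`-module `V`, as a left
`B`-module. The right action of `A` on the left `B`-module `P` is the homomorphism `ρ`.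
As the set of relations `p a ⊗ v - p ⊗ a v` is stable under the action of `B` on the left factor
up to sums, the `B`-submodule spanned by them is the subgroup that they generate. -/
abbrev BalancedTensor {P : Type u} [AddCommGroup P] [Module K P] [Module B P] [IsScalarTower K B P]
    (ρ : Aᵐᵒᵖ →ₐ[K] Module.End B P) (V : Type v) [AddCommGroup V] [Module K V] [Module A V] :
    Type (max u v) :=
  TensorProduct K P V ⧸ (Submodule.span B {z : TensorProduct K P V |
    ∃ (p : P) (a : A) (v : V),
      z = (ρ (MulOpposite.op a) p) ⊗ₜ[K] v - p ⊗ₜ[K] (a • v)})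

/-- The restriction of the left `B`-module `V` along `φ : A → B`. -/
def Restrict (_φ : A →ₐ[K] B) (V : Type v) : Type v := V

variable (φ : A →ₐ[K] B) (V : Type v) [AddCommGroup V]

instance : AddCommGroup (Restrict φ V) := inferInstanceAs (AddCommGroup V)

instance [Module K V] : Module K (Restrict φ V) := inferInstanceAs (Module K V)

instance [Module B V] : Module A (Restrict φ V) := Module.compHom V (φ : A →+* B)

instance [Module K V] [Module B V] [IsScalarTower K B V] : IsScalarTower K A (Restrict φ V) :=
  ⟨fun c a v => by
    let v' : V := v
    show φ (c • a) • v' = c • (φ a • v')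
    rw [map_smul, smul_assoc]⟩

/-- The left `B`-module `B` with the right action of `A` along `φ : A → B`. -/
def rightRegular : Aᵐᵒᵖ →ₐ[K] Module.End B B where
  toFun a := LinearMap.toSpanSingleton B B (φ a.unop)
  map_one' := by ext; simp
  map_mul' a b := by ext; simp
  map_zero' := by ext; simp
  map_add' a b := by ext; simp
  commutes' c := by ext; simp [Algebra.smul_def]

end Bimodules

/-- The inflation `Inf_p^r V = K D(p, r; p) ⊗_{K 𝔖_p} V`, a module over `D_r`. -/
abbrev Inflation (δ : K) (p r : ℕ) (V : Type v) [AddCommGroup V] [Module K V]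
    [Module (SymAlgebra K p) V] : Type (max u v) :=
  BalancedTensor ((rightAction δ p r).comp (AlgHom.op (permHom δ p))) V

/-- The induced module `K 𝔖_{p+1} ⊗_{K 𝔖_p} V`. -/
abbrev Induced (K : Type u) [Field K] (p : ℕ) (V : Type v) [AddCommGroup V] [Module K V]
    [Module (SymAlgebra K p) V] : Type (max u v) :=
  BalancedTensor (rightRegular (symIncl K p)) V

end Algebras

section Specht

universe u

/-- The filling of the Young diagram `lam` that is used to define the Specht module. -/
def filling (lam : YoungDiagram) : Fin lam.card ≃ lam.cells := lam.cells.equivFin.symm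

open Classical in
/-- The Young symmetrizer `∑ sgn(σ) σ τ`, where `σ` runs over the column stabilizer and `τ` over
the row stabilizer of the filling. -/
def youngSymmetrizer (K : Type u) [Field K] (lam : YoungDiagram) : SymAlgebra K lam.card :=
  (∑ σ : Equiv.Perm (Fin lam.card) with
      ∀ i, (filling lam (σ i)).1.2 = (filling lam i).1.2,
    MonoidAlgebra.single σ ((Equiv.Perm.sign σ : ℤ) : K)) *
  (∑ τ : Equiv.Perm (Fin lam.card) with
      ∀ i, (filling lam (τ i)).1.1 = (filling lam i).1.1,
    MonoidAlgebra.single τ (1 : K))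

/-- The Specht module `S^lam`: the left ideal generated by the Young symmetrizer. -/
abbrev Specht (K : Type u) [Field K] (lam : YoungDiagram) :
    Submodule (SymAlgebra K lam.card) (SymAlgebra K lam.card) :=
  Submodule.span (SymAlgebra K lam.card) {youngSymmetrizer K lam}

/-- `mu` is obtained from `lam` by adding one cell. -/
def AddCell (lam mu : YoungDiagram) : Prop :=
  ∃ c, c ∉ lam.cells ∧ mu.cells = insert c lam.cells

/-- The module `U(r, lam) = Inf_p^r S^lam` over `D_r`, where `p` is the size of `lam`. -/
abbrev UMod {K : Type u} [Field K] (δ : K) (r : ℕ) (lam : YoungDiagram) : Type u :=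
  Inflation δ lam.card r (Specht K lam)

end Specht

end Brauer

end

/-!
Bending the last point of the bottom edge up to the top edge turns a diagram in `D(p, r + 1)` into
one in `D(p + 1, r)`, and this is compatible with the action of `D_r`. A diagram has propagating
number less than the number of points of its top edge if and only if two points of the top edge are
joined (`Diagram.topArc_of_pr_lt`, `Diagram.TopArc.pr_lt`), so bending makes those diagrams vanish
in which the last point of the bottom edge lies on a through strand. It induces a surjection from
the restriction of `Inf_p^{r+1} V` onto `Inf_{p+1}^r (V↑)`, whose kernel `Inflation.lastThrough` is
spanned by these diagrams (`Inflation.ker_bendMap`). If `p > 0`, each of them is, up to a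
permutation of the top edge, of the form `z` plus a through strand on the right, and the kernel is
`Inf_{p-1}^r (V↓)` (`Inflation.lastThroughEquiv`). As `D_r` is semisimple the extension splits,
which gives the first isomorphism (`Inflation.restrict_zero`, `Inflation.restrict_succ`).

For the second isomorphism the branching rules for the symmetric groups are needed over `K`. The
diagrams without arcs on the top edge are the permutations, so the span of all others is an ideal
of `D_r` with quotient `K 𝔖_r`; its trivial representation splits off `D_r` only if `r!` is
invertible in `K` (`factorial_ne_zero_of_isSemisimpleRing`). Inflations from `𝔖_p` with `p > r`
vanish, hence only branching between `𝔖_n` and `𝔖_{n+1}` with `n! ≠ 0` (restriction) or `(n + 1)! ≠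
0` (induction) in `K` matters.

Under these hypotheses Specht modules are simple and pairwise non-isomorphic
(`isSimpleModule_fillingSpecht`, `eq_of_equiv`), by the combinatorics of row and column
stabilizers. The projection `K 𝔖_{n+1} → K 𝔖_n` maps the Young symmetrizer of a filling to that of
the filling without its last entry (`contract_symmetrizer`). So the restriction of `S^lam` maps
onto each `S^mu` for which `mu` is `lam` with a cell removed, hence onto their sum, and by
Frobenius reciprocity the induced module of `S^lam` maps onto the sum of the `S^mu` for which `mu`
is `lam` with a cell added. That these surjections are isomorphisms follows by counting dimensions.
They give inequalities `∑_{mu = lam - □} d mu ≤ d lam` and `∑_{mu = lam + □} d mu ≤ (n + 1) d lam`,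
where `n` is the size of `lam`, and as the up and down operators of Young's lattice satisfy `DU -
UD = 1`, all of them are equalities (`sum_up_eq_of_le`). If `n! ≠ 0` but `(n + 1)! = 0`, the
restriction of `S^lam` for `lam` of size `n + 1` is not covered by this count; it is enough that
the dimension of `S^lam` does not exceed the dimension in characteristic zero (`spechtDim_le_rat`).
-/

noncomputable section

namespace Brauer

open Equiv (Perm)
open TensorProduct

universe u v w v'

/-! ### Diagrams: arcs on the top edge, and bending the last strand -/

section Permutations

variable {p : ℕ}

/-- The inclusion of `𝔖_p` in `𝔖_{p+1}` as the stabilizer of the last point. -/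
abbrev permIncl (p : ℕ) : Perm (Fin p) →* Perm (Fin (p + 1)) :=
  Equiv.Perm.viaEmbeddingHom (Fin.castSuccEmb (n := p))

lemma permIncl_castSucc (π : Perm (Fin p)) (i : Fin p) :
    permIncl p π i.castSucc = (π i).castSucc :=
  Equiv.Perm.viaEmbedding_apply π (Fin.castSuccEmb (n := p)) i

lemma permIncl_last (π : Perm (Fin p)) : permIncl p π (Fin.last p) = Fin.last p := by
  apply Equiv.Perm.viaEmbedding_apply_of_notMem
  rintro ⟨i, hi⟩
  exact Fin.castSucc_ne_last i hi

lemma permIncl_injective : Function.Injective (permIncl p) :=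
  Equiv.Perm.viaEmbeddingHom_injective _

lemma exists_permIncl_eq (g : Perm (Fin (p + 1))) (h : g (Fin.last p) = Fin.last p) :
    ∃ π, permIncl p π = g := by
  have h1 : ∀ i : Fin p, g i.castSucc ≠ Fin.last p := fun i hi =>
    Fin.castSucc_ne_last i (g.injective (hi.trans h.symm))
  have hinj : Function.Injective fun i : Fin p => (g i.castSucc).castPred (h1 i) := by
    intro i j hij
    have := congrArg Fin.castSucc hij
    simp only [Fin.castSucc_castPred] at this
    exact Fin.castSucc_injective _ (g.injective this)
  refine ⟨Equiv.ofBijective _ (Finite.injective_iff_bijective.1 hinj), ?_⟩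
  ext u : 1
  induction u using Fin.lastCases with
  | last => rw [permIncl_last, h]
  | cast i => rw [permIncl_castSucc]; simp

end Permutations

section Matchings

variable {X Y : Type}

lemma IsMatching.comap {y : Setoid Y} (hy : IsMatching y) (e : X ≃ Y) :
    IsMatching (y.comap e) := by
  intro a
  obtain ⟨b, ⟨h1, h2⟩, h3⟩ := hy (e a)
  refine ⟨e.symm b, ⟨fun h => h1 ?_, ?_⟩, fun c hc => ?_⟩
  · rw [← h, e.apply_symm_apply]
  · show y (e a) (e (e.symm b))
    rwa [e.apply_symm_apply]
  · rw [← h3 (e c) ⟨fun h => hc.1 (e.injective h), hc.2⟩, e.symm_apply_apply]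

lemma IsMatching.eq_of_le {x y : Setoid X} (hx : IsMatching x) (hy : IsMatching y) (h : x ≤ y) :
    x = y := by
  refine le_antisymm h fun a b hab => ?_
  by_cases e : b = a
  · exact e ▸ x.refl _
  · obtain ⟨c, ⟨h1, h2⟩, -⟩ := hx a
    exact (hy a).unique ⟨h1, h h2⟩ ⟨e, hab⟩ ▸ h2

lemma IsMatching.eq_or_eq {x : Setoid X} (hx : IsMatching x) {a b c : X} (hb : x a b)
    (hc : x a c) : b = a ∨ c = a ∨ b = c := by
  by_cases h1 : b = a
  · exact Or.inl h1
  · by_cases h2 : c = a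
    · exact Or.inr (Or.inl h2)
    · exact Or.inr (Or.inr ((hx a).unique ⟨h1, hb⟩ ⟨h2, hc⟩))

end Matchings

namespace Diagram

variable {p q r s t : ℕ}

/-- Some strand of the diagram joins two points of the top edge. -/
def TopArc (x : Diagram p r) : Prop := ∃ i j, i ≠ j ∧ x.rel (Sum.inl i) (Sum.inl j)

lemma rel_comp_inl {x : Diagram r s} (y : Diagram s t) {i j : Fin r}
    (h : x.rel (Sum.inl i) (Sum.inl j)) : (x.comp y).rel (Sum.inl i) (Sum.inl j) :=
  ((stack_le_iff x.rel y.rel _).1 le_rfl).1 h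

lemma TopArc.comp {x : Diagram r s} (h : x.TopArc) (y : Diagram s t) : (x.comp y).TopArc := by
  obtain ⟨i, j, hij, h⟩ := h
  exact ⟨i, j, hij, rel_comp_inl y h⟩

lemma exists_rel_inr {x : Diagram p r} (h : ¬ x.TopArc) (i : Fin p) :
    ∃ j, x.rel (Sum.inl i) (Sum.inr j) := by
  obtain ⟨b, ⟨h1, h2⟩, -⟩ := x.isMatching (Sum.inl i)
  rcases b with j | j
  · exact absurd ⟨i, j, fun e => h1 (e ▸ rfl), h2⟩ h
  · exact ⟨j, h2⟩

/-- A strand from the top edge to the bottom edge of a stacked pair passes through the middle. -/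
lemma exists_mid (x : Diagram r s) (y : Diagram s t) {i : Fin r} {k : Fin t}
    (h : (x.comp y).rel (Sum.inl i) (Sum.inr k)) :
    ∃ j : Fin s, stack x.rel y.rel (Sum.inl i) (Sum.inr (Sum.inl j)) := by
  classical
  by_contra! hj
  let f : Fin r ⊕ (Fin s ⊕ Fin t) → Prop :=
    Sum.elim (fun a => stack x.rel y.rel (Sum.inl i) (Sum.inl a)) (fun _ => False)
  have hle := ((stack_le_iff x.rel y.rel _).1 le_rfl).1
  have hf : stack x.rel y.rel ≤ Setoid.ker f := by
    rw [stack_le_iff]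
    constructor
    · have key : ∀ u : Fin r ⊕ Fin s, f (Sum.map id Sum.inl u) ↔
          stack x.rel y.rel (Sum.inl i) (Sum.map id Sum.inl u) := by
        rintro (a | b)
        · exact Iff.rfl
        · exact iff_of_false (fun h => h) (hj b)
      intro u v huv
      refine propext ((key u).trans (Iff.trans ?_ (key v).symm))
      exact ⟨fun h => (stack x.rel y.rel).trans h (hle huv),
        fun h => (stack x.rel y.rel).trans h ((stack x.rel y.rel).symm (hle huv))⟩
    · rintro u v -
      rfl
  have : f (Sum.inl i) = f (Sum.inr (Sum.inr k)) := hf h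
  exact this.mp ((stack x.rel y.rel).refl _)

/-- If no two points of the top edge are joined in a stacked pair, then the strands that start there
pass through different points of the middle. -/
lemma le_of_not_topArc_comp (x : Diagram p q) (y : Diagram q r) (h : ¬ (x.comp y).TopArc) :
    p ≤ q := by
  have : ∀ i : Fin p, ∃ j : Fin q, stack x.rel y.rel (Sum.inl i) (Sum.inr (Sum.inl j)) := by
    intro i
    obtain ⟨k, hk⟩ := exists_rel_inr h i
    exact exists_mid x y hk
  choose f hf using this
  have hinj : Function.Injective f := by
    intro a b hab
    by_contra hne
    refine h ⟨a, b, hne, ?_⟩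
    refine (stack x.rel y.rel).trans (hf a) ((stack x.rel y.rel).symm ?_)
    rw [hab]
    exact hf b
  simpa using Fintype.card_le_of_injective f hinj

lemma pr_nonempty (x : Diagram p r) :
    {q : ℕ | ∃ (a : Diagram p q) (b : Diagram q r), x = a.comp b}.Nonempty :=
  ⟨p, permDiagram 1, x, (permDiagram_one_comp x).symm⟩

lemma exists_eq_comp_pr (x : Diagram p r) :
    ∃ (a : Diagram p x.pr) (b : Diagram x.pr r), x = a.comp b :=
  Nat.sInf_mem x.pr_nonempty

lemma pr_le (a : Diagram p q) (b : Diagram q r) : (a.comp b).pr ≤ q :=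
  Nat.sInf_le ⟨a, b, rfl⟩

lemma pr_le_bot (x : Diagram p r) : x.pr ≤ r :=
  Nat.sInf_le ⟨x, permDiagram 1, (comp_permDiagram_one x).symm⟩

lemma topArc_of_pr_lt {x : Diagram p r} (h : x.pr < p) : x.TopArc := by
  by_contra hx
  obtain ⟨a, b, hab⟩ := x.exists_eq_comp_pr
  rw [hab] at hx
  exact absurd (le_of_not_topArc_comp a b hx) (not_le.2 h)

/-- A diagram with an arc on the top edge factors through the remaining points of that edge. -/
lemma TopArc.pr_lt {x : Diagram p r} (h : x.TopArc) : x.pr < p := by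
  classical
  obtain ⟨i, j, hij, h⟩ := h
  let S := {u : Fin p // u ≠ i ∧ u ≠ j}
  have hS : Fintype.card S < p := by
    have := Fintype.card_subtype_lt (p := fun u : Fin p => u ≠ i ∧ u ≠ j) (x := i) (by simp)
    simpa using this
  let e : Fin (Fintype.card S) ≃ S := (Fintype.equivFin S).symm
  let emb : Fin (Fintype.card S) ⊕ Fin r → Fin p ⊕ Fin r := Sum.map (fun d => (e d).1) id
  have hemb : Function.Injective emb :=
    Sum.map_injective.2 ⟨Subtype.val_injective.comp e.injective, Function.injective_id⟩
  have hcase : ∀ u, (∃ v, u = emb v) ∨ u = Sum.inl i ∨ u = Sum.inl j := by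
    rintro (u | u)
    · by_cases h1 : u = i
      · exact Or.inr (Or.inl (h1 ▸ rfl))
      · by_cases h2 : u = j
        · exact Or.inr (Or.inr (h2 ▸ rfl))
        · exact Or.inl ⟨Sum.inl (e.symm ⟨u, h1, h2⟩), by simp [emb]⟩
    · exact Or.inl ⟨Sum.inr u, rfl⟩
  have hembi : ∀ v, emb v ≠ Sum.inl i := by
    rintro (v | v) hv
    · exact (e v).2.1 (Sum.inl_injective hv)
    · cases hv
  have hembj : ∀ v, emb v ≠ Sum.inl j := by
    rintro (v | v) hv
    · exact (e v).2.2 (Sum.inl_injective hv)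
    · cases hv
  -- `b` is `x` without the arc from `i` to `j`; `a` consists of this arc and of through strands.
  let b : Diagram (Fintype.card S) r := ⟨x.rel.comap emb, by
    intro v
    obtain ⟨w, ⟨h1, h2⟩, h3⟩ := x.isMatching (emb v)
    rcases hcase w with ⟨w, rfl⟩ | rfl | rfl
    · exact ⟨w, ⟨fun h => h1 (h ▸ rfl), h2⟩, fun w' hw' => hemb
        (h3 _ ⟨fun h => hw'.1 (hemb h), hw'.2⟩)⟩
    · rcases x.isMatching.eq_or_eq (x.rel.symm h2) h with h | h | h
      · exact absurd h (hembi v)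
      · exact absurd (Sum.inl_injective h) hij.symm
      · exact absurd h (hembj v)
    · rcases x.isMatching.eq_or_eq (x.rel.symm h2) (x.rel.symm h) with h | h | h
      · exact absurd h (hembj v)
      · exact absurd (Sum.inl_injective h) hij
      · exact absurd h (hembi v)⟩
  let f : Fin p ⊕ Fin (Fintype.card S) → Option (Fin (Fintype.card S)) :=
    Sum.elim (fun u => if hu : u ≠ i ∧ u ≠ j then some (e.symm ⟨u, hu⟩) else none) some
  have fe : ∀ d, f (Sum.inl (e d).1) = some d := by
    intro d
    show dite _ _ _ = _
    rw [dif_pos (e d).2]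
    simp
  have fi : f (Sum.inl i) = none := dif_neg (by simp)
  have fj : f (Sum.inl j) = none := dif_neg (by simp)
  have hcase' : ∀ u : Fin p, (∃ d, u = (e d).1) ∨ u = i ∨ u = j := by
    intro u
    rcases hcase (Sum.inl u) with ⟨v | v, hv⟩ | h | h
    · exact Or.inl ⟨v, Sum.inl_injective hv⟩
    · cases hv
    · exact Or.inr (Or.inl (Sum.inl_injective h))
    · exact Or.inr (Or.inr (Sum.inl_injective h))
  let a : Diagram p (Fintype.card S) := ⟨Setoid.ker f, by
    have key : ∀ d, ∀ w, Setoid.ker f (Sum.inl (e d).1) w →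
        w = Sum.inl (e d).1 ∨ w = Sum.inr d := by
      intro d w hw
      rw [Setoid.ker_def, fe] at hw
      rcases w with w | w
      · rcases hcase' w with ⟨d', rfl⟩ | rfl | rfl
        · rw [fe] at hw; rw [Option.some_injective _ hw]; exact Or.inl rfl
        · rw [fi] at hw; cases hw
        · rw [fj] at hw; cases hw
      · exact Or.inr (congrArg Sum.inr (Option.some_injective _ hw).symm)
    have key' : ∀ w, Setoid.ker f (Sum.inl i) w → w = Sum.inl i ∨ w = Sum.inl j := by
      intro w hw
      rw [Setoid.ker_def, fi] at hw
      rcases w with w | w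
      · rcases hcase' w with ⟨d', rfl⟩ | rfl | rfl
        · rw [fe] at hw; cases hw
        · exact Or.inl rfl
        · exact Or.inr rfl
      · cases hw
    have hd : ∀ d, Setoid.ker f (Sum.inl (e d).1) (Sum.inr d) := fun d => fe d
    have hij' : Setoid.ker f (Sum.inl i) (Sum.inl j) := fi.trans fj.symm
    rintro (u | d)
    · rcases hcase' u with ⟨d, rfl⟩ | rfl | rfl
      · exact ⟨Sum.inr d, ⟨by simp, hd d⟩, fun w hw => (key d w hw.2).resolve_left hw.1⟩
      · exact ⟨Sum.inl j, ⟨fun h => hij (Sum.inl_injective h).symm, hij'⟩,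
          fun w hw => (key' w hw.2).resolve_left hw.1⟩
      · exact ⟨Sum.inl i, ⟨fun h => hij (Sum.inl_injective h), hij'.symm⟩,
          fun w hw => (key' w (hij'.trans hw.2)).resolve_right hw.1⟩
    · exact ⟨Sum.inl (e d).1, ⟨by simp, (hd d).symm⟩,
        fun w hw => (key d w ((hd d).trans hw.2)).resolve_right hw.1⟩⟩
  have hab : x = a.comp b := by
    apply Diagram.ext
    refine (wt_unique (m := floating a.rel b.rel) (n := 0) ?_).2.symm
    intro c k
    show 2 ^ _ * wt (glue a.rel b.rel) c k = _
    rw [← sum_wt, pow_zero, one_mul]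
    -- The colours of the top edge determine those of the middle, so only one summand survives.
    have ha : ∀ d, wt a.rel c d = if c i = c j ∧ d = fun m => c (e m).1 then 1 else 0 := by
      intro d
      rw [wt]
      congr 1
      apply propext
      constructor
      · intro h
        exact ⟨h (show f _ = f _ from fi.trans fj.symm),
          funext fun m => (h (show f (Sum.inl (e m).1) = f (Sum.inr m) from fe m)).symm⟩
      · rintro ⟨h1, rfl⟩
        let g : Option (Fin (Fintype.card S)) → Bool := fun o => o.elim (c i) fun m => c (e m).1
        have : Sum.elim c (fun m => c (e m).1) = g ∘ f := by
          funext u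
          rcases u with u | u
          · rcases hcase' u with ⟨d, rfl⟩ | rfl | rfl
            · simp [fe, g]
            · simp [fi, g]
            · simp [fj, g, h1]
          · rfl
        rw [this]
        intro u v huv
        exact congrArg g huv
    have hb : wt x.rel c k = if c i = c j then wt b.rel (fun m => c (e m).1) k else 0 := by
      rw [wt, wt, ← ite_and]
      congr 1
      apply propext
      have ee : ∀ v, Sum.elim c k (emb v) = Sum.elim (fun m => c (e m).1) k v := by
        rintro (v | v) <;> rfl
      constructor
      · intro hx
        refine ⟨hx h, fun u v huv => ?_⟩
        have := hx huv
        rwa [Setoid.ker_def, ee, ee] at this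
      · rintro ⟨h1, h2⟩ u v huv
        by_cases huv' : v = u
        · rw [huv']
        have hpair : ∀ w, x.rel (Sum.inl i) w → w = Sum.inl i ∨ w = Sum.inl j := by
          intro w hw
          rcases x.isMatching.eq_or_eq hw h with h | h | h
          · exact Or.inl h
          · exact absurd (Sum.inl_injective h).symm hij
          · exact Or.inr h
        rw [Setoid.ker_def]
        rcases hcase u with ⟨u, rfl⟩ | rfl | rfl
        · rcases hcase v with ⟨v, rfl⟩ | rfl | rfl
          · rw [ee, ee]; exact h2 huv
          · rcases hpair _ (x.rel.symm huv) with h | h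
            · exact absurd h (hembi u)
            · exact absurd h (hembj u)
          · rcases hpair _ (x.rel.trans h (x.rel.symm huv)) with h | h
            · exact absurd h (hembi u)
            · exact absurd h (hembj u)
        · rcases hpair _ huv with rfl | rfl
          · rfl
          · exact h1
        · rcases hpair _ (x.rel.trans h huv) with rfl | rfl
          · exact h1.symm
          · rfl
    simp only [ha, hb, ite_and, ite_mul, one_mul, zero_mul]
    by_cases hc : c i = c j <;> simp [hc]
  exact (hab ▸ pr_le a b : x.pr ≤ _).trans_lt hS

lemma exists_eq_permDiagram {x : Diagram r r} (h : ¬ x.TopArc) : ∃ π, x = permDiagram π := by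
  choose f hf using exists_rel_inr h
  have hinj : Function.Injective f := by
    intro a b hab
    by_contra hne
    exact h ⟨a, b, hne, x.rel.trans (hf a) (x.rel.symm (hab ▸ hf b))⟩
  refine ⟨Equiv.ofBijective f (Finite.injective_iff_bijective.1 hinj), ?_⟩
  apply Diagram.ext
  refine ((permDiagram _).isMatching.eq_of_le x.isMatching ?_).symm
  have key : ∀ u : Fin r ⊕ Fin r, x.rel u (Sum.inr (Sum.elim f id u)) := by
    rintro (u | u)
    · exact hf u
    · exact x.rel.refl _
  intro u v huv
  have huv' : Sum.elim f id u = Sum.elim f id v := huv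
  exact x.rel.trans (key u) (huv' ▸ x.rel.symm (key v))

lemma permDiagram_comp_rel (π : Perm (Fin p)) (x : Diagram p r) :
    ((permDiagram π).comp x).rel = x.rel.comap (Sum.map π id) := (graphRel_glue π x.rel).2

lemma not_topArc_permDiagram (π : Perm (Fin r)) : ¬ (permDiagram π).TopArc := by
  rintro ⟨i, j, hij, h⟩
  exact hij (π.injective h)

lemma topArc_permDiagram_comp (π : Perm (Fin p)) (x : Diagram p r) :
    ((permDiagram π).comp x).TopArc ↔ x.TopArc := by
  unfold TopArc
  rw [permDiagram_comp_rel]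
  constructor
  · rintro ⟨i, j, hij, h⟩
    exact ⟨π i, π j, fun e => hij (π.injective e), h⟩
  · rintro ⟨i, j, hij, h⟩
    refine ⟨π.symm i, π.symm j, fun e => hij (π.symm.injective e), ?_⟩
    show x.rel (Sum.inl (π (π.symm i))) (Sum.inl (π (π.symm j)))
    simpa using h

lemma addStrand_permDiagram (π : Perm (Fin p)) :
    (permDiagram π).addStrand = permDiagram (permIncl p π) := by
  classical
  apply Diagram.ext
  refine (wt_unique (m := 0) (n := 0) fun i j => ?_).2
  show 2 ^ 0 * wt (addStrandRel (graphRel π)) i j = 2 ^ 0 * wt (graphRel _) i j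
  rw [wt_addStrandRel, wt_graphRel, wt_graphRel, ← ite_and]
  congr 2
  apply propext
  constructor
  · rintro ⟨h1, h2⟩
    funext u
    induction u using Fin.lastCases with
    | last => rw [Function.comp_apply, permIncl_last, h1]
    | cast u => rw [Function.comp_apply, permIncl_castSucc]; exact congrFun h2 u
  · rintro rfl
    refine ⟨by rw [Function.comp_apply, permIncl_last], ?_⟩
    funext u
    simp only [Function.comp_apply, permIncl_castSucc]

lemma addStrand_injective : Function.Injective (addStrand : Diagram r s → _) := by
  intro x y h
  apply Diagram.ext
  ext u v
  rw [← addStrandRel_cast x.rel, ← addStrandRel_cast y.rel]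
  have : addStrandRel x.rel = addStrandRel y.rel := congrArg Diagram.rel h
  rw [this]

/-- A diagram in which the last points of both edges are joined arises by adding a strand. -/
lemma exists_eq_addStrand {x : Diagram (p + 1) (r + 1)}
    (h : x.rel (Sum.inl (Fin.last p)) (Sum.inr (Fin.last r))) :
    ∃ z : Diagram p r, x = z.addStrand := by
  have h1 : ∀ u : Fin p ⊕ Fin r, ¬ x.rel (castPt u) (Sum.inl (Fin.last p)) := by
    intro u hu
    rcases x.isMatching.eq_or_eq (x.rel.symm hu) h with h | h | h
    · rcases u with u | u
      · exact Fin.castSucc_ne_last u (Sum.inl_injective h)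
      · cases h
    · cases h
    · rcases u with u | u
      · cases h
      · exact Fin.castSucc_ne_last u (Sum.inr_injective h)
  have h2 : ∀ u : Fin p ⊕ Fin r, ¬ x.rel (castPt u) (Sum.inr (Fin.last r)) := fun u hu =>
    h1 u (x.rel.trans hu (x.rel.symm h))
  let z : Diagram p r := ⟨x.rel.comap castPt, by
    intro v
    obtain ⟨w, ⟨h3, h4⟩, h5⟩ := x.isMatching (castPt v)
    rcases castPt_cases w with ⟨w, rfl⟩ | rfl | rfl
    · exact ⟨w, ⟨fun h => h3 (h ▸ rfl), h4⟩, fun w' hw' => castPt_injective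
        (h5 _ ⟨fun h => hw'.1 (castPt_injective h), hw'.2⟩)⟩
    · exact absurd h4 (h1 v)
    · exact absurd h4 (h2 v)⟩
  refine ⟨z, Diagram.ext (z.addStrand.isMatching.eq_of_le x.isMatching ?_).symm⟩
  intro u v huv
  change addStrandRel _ _ _ at huv
  rcases castPt_cases u with ⟨u, rfl⟩ | rfl | rfl <;>
    rcases castPt_cases v with ⟨v, rfl⟩ | rfl | rfl
  · exact (addStrandRel_cast z.rel u v).1 huv
  · exact absurd huv (addStrandRel_inl _ _)
  · exact absurd huv (addStrandRel_inr _ _)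
  · exact absurd ((addStrandRel _).symm huv) (addStrandRel_inl _ _)
  · exact x.rel.refl _
  · exact h
  · exact absurd ((addStrandRel _).symm huv) (addStrandRel_inr _ _)
  · exact x.rel.symm h
  · exact x.rel.refl _

/-- The last point of the bottom edge is joined to the top edge. -/
def LastThrough (x : Diagram p (r + 1)) : Prop := ∃ i, x.rel (Sum.inl i) (Sum.inr (Fin.last r))

lemma LastThrough.exists_eq {x : Diagram (p + 1) (r + 1)} (h : x.LastThrough) :
    ∃ (π : Perm (Fin (p + 1))) (z : Diagram p r), x = (permDiagram π).comp z.addStrand := by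
  obtain ⟨i, hi⟩ := h
  let π := Equiv.swap i (Fin.last p)
  obtain ⟨z, hz⟩ := exists_eq_addStrand (x := (permDiagram π).comp x) (by
    rw [permDiagram_comp_rel]
    show x.rel (Sum.inl (π (Fin.last p))) (Sum.inr (Fin.last r))
    rwa [Equiv.swap_apply_right])
  refine ⟨π, z, ?_⟩
  rw [← hz, ← comp_assoc, permDiagram_comp, Equiv.swap_mul_self, permDiagram_one_comp]

lemma rel_permDiagram_comp_addStrand_iff (π : Perm (Fin (p + 1))) (z : Diagram p r)
    (i : Fin (p + 1)) :
    ((permDiagram π).comp z.addStrand).rel (Sum.inl i) (Sum.inr (Fin.last r)) ↔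
      π i = Fin.last p := by
  rw [permDiagram_comp_rel]
  change addStrandRel z.rel (Sum.inl (π i)) (Sum.inr (Fin.last r)) ↔ _
  constructor
  · intro h
    by_contra hne
    obtain ⟨j, hj⟩ := Fin.exists_castSucc_eq.2 hne
    rw [← hj] at h
    exact addStrandRel_inr z.rel (Sum.inl j) h
  · intro h
    rw [h]
    exact addStrandRel_last _

lemma lastThrough_permDiagram_comp (π : Perm (Fin p)) (x : Diagram p (r + 1)) :
    ((permDiagram π).comp x).LastThrough ↔ x.LastThrough := by
  unfold LastThrough
  rw [permDiagram_comp_rel]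
  exact ⟨fun ⟨i, hi⟩ => ⟨π i, hi⟩, fun ⟨i, hi⟩ => ⟨π.symm i, by
    show x.rel (Sum.inl (π (π.symm i))) _
    simpa using hi⟩⟩

/-- Moving the last point of the top edge to the end of the bottom edge. -/
def bendPt (p r : ℕ) : Fin (p + 1) ⊕ Fin r ≃ Fin p ⊕ Fin (r + 1) where
  toFun := Sum.elim (Fin.snoc (α := fun _ => Fin p ⊕ Fin (r + 1)) Sum.inl (Sum.inr (Fin.last r)))
    (fun j => Sum.inr j.castSucc)
  invFun := Sum.elim (fun i => Sum.inl i.castSucc)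
    (Fin.snoc (α := fun _ => Fin (p + 1) ⊕ Fin r) Sum.inr (Sum.inl (Fin.last p)))
  left_inv := by
    rintro (i | j)
    · induction i using Fin.lastCases <;> simp
    · simp
  right_inv := by
    rintro (i | j)
    · simp
    · induction j using Fin.lastCases <;> simp

@[simp] lemma bendPt_castSucc (i : Fin p) :
    bendPt p r (Sum.inl i.castSucc) = Sum.inl i := by simp [bendPt]

@[simp] lemma bendPt_last : bendPt p r (Sum.inl (Fin.last p)) = Sum.inr (Fin.last r) := by
  simp [bendPt]

@[simp] lemma bendPt_inr (j : Fin r) : bendPt p r (Sum.inr j) = Sum.inr j.castSucc := rfl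

/-- Bending the last strand of the bottom edge up to the top edge. -/
def bend : Diagram p (r + 1) ≃ Diagram (p + 1) r where
  toFun x := ⟨x.rel.comap (bendPt p r), x.isMatching.comap _⟩
  invFun x := ⟨x.rel.comap (bendPt p r).symm, x.isMatching.comap _⟩
  left_inv x := by
    apply Diagram.ext
    ext u v
    show x.rel (bendPt p r ((bendPt p r).symm u)) (bendPt p r ((bendPt p r).symm v)) ↔ _
    simp
  right_inv x := by
    apply Diagram.ext
    ext u v
    show x.rel ((bendPt p r).symm (bendPt p r u)) ((bendPt p r).symm (bendPt p r v)) ↔ _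
    simp

lemma bend_rel (x : Diagram p (r + 1)) (u v : Fin (p + 1) ⊕ Fin r) :
    x.bend.rel u v ↔ x.rel (bendPt p r u) (bendPt p r v) := Iff.rfl

lemma wt_bend (x : Diagram p (r + 1)) (i : Fin (p + 1) → Bool) (j : Fin r → Bool) :
    wt x.bend.rel i j =
      wt x.rel (i ∘ Fin.castSucc) (Fin.snoc (α := fun _ => Bool) j (i (Fin.last p))) := by
  classical
  have e : ∀ u, Sum.elim i j u =
      Sum.elim (i ∘ Fin.castSucc) (Fin.snoc (α := fun _ => Bool) j (i (Fin.last p)))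
        (bendPt p r u) := by
    rintro (u | u)
    · induction u using Fin.lastCases <;> simp
    · simp
  rw [wt, wt]
  congr 1
  apply propext
  constructor
  · intro h u v huv
    have := @h ((bendPt p r).symm u) ((bendPt p r).symm v) (by
      rw [bend_rel]; simpa using huv)
    rw [Setoid.ker_def, e, e] at this
    simpa using this
  · intro h u v huv
    rw [Setoid.ker_def, e, e]
    exact h ((bend_rel x u v).1 huv)

lemma sum_snoc {n : ℕ} (f : (Fin (n + 1) → Bool) → ℕ) :
    ∑ j, f j = ∑ b : Bool, ∑ j : Fin n → Bool, f (Fin.snoc (α := fun _ => Bool) j b) := by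
  rw [← (Fin.snocEquiv (fun _ : Fin (n + 1) => Bool)).sum_comp, Fintype.sum_prod_type]
  rfl

lemma snoc_comp_castSucc {n : ℕ} (j : Fin n → Bool) (b : Bool) :
    Fin.snoc (α := fun _ => Bool) j b ∘ Fin.castSucc = j := by
  funext a
  simp

/-- Two-colourings determine a diagram together with a number of loops. The colour of the strand
that is added to `y` has to be the colour of the point that is bent to the top edge. -/
lemma bend_comp_aux (x : Diagram p (s + 1)) (y : Diagram s t) :
    x.loops y.addStrand = x.bend.loops y ∧ (x.comp y.addStrand).bend = x.bend.comp y := by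
  classical
  have := wt_unique (m := x.loops y.addStrand) (n := x.bend.loops y)
    (x := ((x.comp y.addStrand).bend).rel) (y := (x.bend.comp y).rel) (by
    intro i k
    rw [wt_bend]
    change 2 ^ floating x.rel (addStrandRel y.rel) * wt (glue x.rel (addStrandRel y.rel)) _ _ =
      2 ^ floating x.bend.rel y.rel * wt (glue x.bend.rel y.rel) i k
    rw [← sum_wt, ← sum_wt, sum_snoc]
    simp only [wt_addStrandRel, wt_bend, snoc_comp_castSucc, Fin.snoc_last]
    rw [Fintype.sum_eq_single (i (Fin.last p))]
    · simp
    · intro b hb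
      simp [hb])
  exact ⟨this.1, Diagram.ext this.2⟩

lemma loops_bend (x : Diagram p (s + 1)) (y : Diagram s t) :
    x.bend.loops y = x.loops y.addStrand := (bend_comp_aux x y).1.symm

lemma bend_comp_addStrand (x : Diagram p (s + 1)) (y : Diagram s t) :
    (x.comp y.addStrand).bend = x.bend.comp y := (bend_comp_aux x y).2

lemma bend_comp (a : Diagram p q) (b : Diagram q (r + 1)) :
    (a.comp b).bend = a.addStrand.comp b.bend := by
  classical
  apply Diagram.ext
  refine (wt_unique (m := floating a.rel b.rel) (n := floating a.addStrand.rel b.bend.rel) ?_).2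
  intro i k
  rw [wt_bend]
  change 2 ^ floating a.rel b.rel * wt (glue a.rel b.rel) _ _ =
    2 ^ floating (addStrandRel a.rel) b.bend.rel * wt (glue (addStrandRel a.rel) b.bend.rel) i k
  rw [← sum_wt, ← sum_wt, sum_snoc]
  simp only [wt_addStrandRel, wt_bend, snoc_comp_castSucc, Fin.snoc_last]
  rw [Fintype.sum_eq_single (i (Fin.last p))]
  · simp
  · intro b hb
    simp [hb.symm]

lemma bend_permDiagram_comp (π : Perm (Fin p)) (x : Diagram p (r + 1)) :
    ((permDiagram π).comp x).bend = (permDiagram (permIncl p π)).comp x.bend := by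
  rw [bend_comp, addStrand_permDiagram]

lemma bend_symm_permDiagram_comp (π : Perm (Fin p)) (w : Diagram (p + 1) r) :
    bend.symm ((permDiagram (permIncl p π)).comp w) = (permDiagram π).comp (bend.symm w) := by
  rw [Equiv.symm_apply_eq, bend_permDiagram_comp, Equiv.apply_symm_apply]

lemma TopArc.bend {x : Diagram p (r + 1)} (h : x.TopArc) : (Diagram.bend x).TopArc := by
  obtain ⟨i, j, hij, h⟩ := h
  refine ⟨i.castSucc, j.castSucc, fun e => hij (Fin.castSucc_injective _ e), ?_⟩
  rw [bend_rel]
  simpa using h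

lemma LastThrough.topArc_bend {x : Diagram p (r + 1)} (h : x.LastThrough) :
    (Diagram.bend x).TopArc := by
  obtain ⟨i, h⟩ := h
  refine ⟨i.castSucc, Fin.last p, Fin.castSucc_ne_last i, ?_⟩
  rw [bend_rel]
  simpa using h

lemma topArc_or_lastThrough_of_bend {x : Diagram p (r + 1)} (h : (Diagram.bend x).TopArc) :
    x.TopArc ∨ x.LastThrough := by
  obtain ⟨i, j, hij, h⟩ := h
  rw [bend_rel] at h
  induction i using Fin.lastCases with
  | last =>
    induction j using Fin.lastCases with
    | last => exact absurd rfl hij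
    | cast j => right; exact ⟨j, x.rel.symm (by simpa using h)⟩
  | cast i =>
    induction j using Fin.lastCases with
    | last => right; exact ⟨i, by simpa using h⟩
    | cast j => left; exact ⟨i, j, fun e => hij (e ▸ rfl), by simpa using h⟩

lemma TopArc.addStrand {z : Diagram p r} (h : z.TopArc) : (Diagram.addStrand z).TopArc := by
  obtain ⟨i, j, hij, h⟩ := h
  exact ⟨i.castSucc, j.castSucc, fun e => hij (Fin.castSucc_injective _ e),
    (addStrandRel_cast z.rel (Sum.inl i) (Sum.inl j)).2 h⟩

lemma topArc_of_addStrand {z : Diagram p r} (h : (Diagram.addStrand z).TopArc) : z.TopArc := by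
  obtain ⟨i, j, hij, h⟩ := h
  change addStrandRel z.rel _ _ at h
  induction i using Fin.lastCases with
  | last =>
    induction j using Fin.lastCases with
    | last => exact absurd rfl hij
    | cast j => exact absurd ((addStrandRel z.rel).symm h) (addStrandRel_inl z.rel (Sum.inl j))
  | cast i =>
    induction j using Fin.lastCases with
    | last => exact absurd h (addStrandRel_inl z.rel (Sum.inl i))
    | cast j =>
      exact ⟨i, j, fun e => hij (e ▸ rfl), (addStrandRel_cast z.rel (Sum.inl i) (Sum.inl j)).1 h⟩

end Diagram

/-! ### Balanced tensor products -/

section SpanLift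

variable {K : Type u} [Field K] {B : Type w} [Ring B] [Algebra K B] {N : Type v} [AddCommGroup N]
  [Module K N] [Module B N] [IsScalarTower K B N] {M : Type v'} [AddCommGroup M] [Module K M]

/-- A `K`-linear map out of the quotient of a `B`-module by the `B`-submodule spanned by a set. The
kernel of a `K`-linear map need not be a `B`-submodule, so all `B`-multiples of the relations have
to be killed. -/
def spanLift (R : Set N) (f : N →ₗ[K] M) (h : ∀ (b : B), ∀ z ∈ R, f (b • z) = 0) :
    (N ⧸ Submodule.span B R) →ₗ[K] M :=
  (Submodule.liftQ (Submodule.restrictScalars K (Submodule.span B R)) f (by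
    intro z hz
    rw [Submodule.restrictScalars_mem] at hz
    rw [LinearMap.mem_ker]
    have : ∀ b : B, f (b • z) = 0 := by
      induction hz using Submodule.span_induction with
      | mem z hz => exact fun b => h b z hz
      | zero => intro b; simp
      | add x y _ _ hx hy => intro b; rw [smul_add, map_add, hx, hy, add_zero]
      | smul c x _ hx => intro b; rw [smul_smul, hx]
    simpa using this 1)).comp
  (Submodule.Quotient.restrictScalarsEquiv K _).symm.toLinearMap

end SpanLift

namespace BalancedTensor

variable {K : Type u} [Field K] {A : Type u} [Ring A] [Algebra K A] {B : Type w} [Ring B]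
  [Algebra K B] {P : Type u} [AddCommGroup P] [Module K P] [Module B P] [IsScalarTower K B P]
  (ρ : Aᵐᵒᵖ →ₐ[K] Module.End B P) {V : Type v} [AddCommGroup V] [Module K V] [Module A V]
  {M : Type v'} [AddCommGroup M] [Module K M]

/-- The class of the pure tensor `p ⊗ v`. -/
def mk : P →ₗ[K] V →ₗ[K] BalancedTensor ρ V :=
  (TensorProduct.mk K P V).compr₂ ((Submodule.mkQ _).restrictScalars K)

lemma mk_balanced (p : P) (a : A) (v : V) :
    mk ρ (ρ (MulOpposite.op a) p) v = mk ρ p (a • v) := by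
  refine (Submodule.Quotient.eq _).2 (Submodule.subset_span ⟨p, a, v, rfl⟩)

lemma smul_mk (b : B) (p : P) (v : V) : b • mk ρ p v = mk ρ (b • p) v := rfl

lemma induction_on {motive : BalancedTensor ρ V → Prop} (z : BalancedTensor ρ V)
    (zero : motive 0) (mk : ∀ p v, motive (mk ρ p v))
    (add : ∀ x y, motive x → motive y → motive (x + y)) : motive z := by
  induction z using Submodule.Quotient.induction_on with
  | H t =>
    induction t using TensorProduct.induction_on with
    | zero => exact zero
    | tmul p v => exact mk p v
    | add x y hx hy => exact add _ _ hx hy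

/-- The `K`-linear map out of `P ⊗_A V` given by a balanced bilinear map. -/
def lift (f : P →ₗ[K] V →ₗ[K] M)
    (hf : ∀ p a v, f (ρ (MulOpposite.op a) p) v = f p (a • v)) : BalancedTensor ρ V →ₗ[K] M :=
  spanLift (B := B) {z : TensorProduct K P V | ∃ (p : P) (a : A) (v : V),
      z = (ρ (MulOpposite.op a) p) ⊗ₜ[K] v - p ⊗ₜ[K] (a • v)} (TensorProduct.lift f) (by
    rintro b _ ⟨p, a, v, rfl⟩
    rw [smul_sub, TensorProduct.smul_tmul', TensorProduct.smul_tmul', map_sub,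
      TensorProduct.lift.tmul, TensorProduct.lift.tmul, ← map_smul, hf, sub_self])

end BalancedTensor

/-! ### Inflations and induced modules by generators and relations -/

section SymAlgebra

variable {K : Type u} [Field K] {p : ℕ}

/-- A permutation as an element of the group algebra. -/
abbrev ofPerm (K : Type u) [Field K] {p : ℕ} (π : Perm (Fin p)) : SymAlgebra K p :=
  MonoidAlgebra.single π 1

lemma ofPerm_mul (π σ : Perm (Fin p)) : ofPerm K π * ofPerm K σ = ofPerm K (π * σ) := by
  simp [ofPerm, MonoidAlgebra.single_mul_single]

lemma ofPerm_one : ofPerm K (1 : Perm (Fin p)) = 1 := rfl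

lemma SymAlgebra.induction {motive : SymAlgebra K p → Prop} (a : SymAlgebra K p)
    (zero : motive 0) (ofPerm : ∀ π, motive (ofPerm K π))
    (add : ∀ x y, motive x → motive y → motive (x + y))
    (smul : ∀ (c : K) x, motive x → motive (c • x)) : motive a := by
  induction a using MonoidAlgebra.induction_linear with
  | zero => exact zero
  | add x y hx hy => exact add x y hx hy
  | single π c =>
    have : MonoidAlgebra.single π c = c • Brauer.ofPerm K π := by simp [Brauer.ofPerm]
    rw [this]
    exact smul _ _ (ofPerm π)

lemma symIncl_ofPerm (π : Perm (Fin p)) : symIncl K p (ofPerm K π) = ofPerm K (permIncl p π) := by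
  simp [symIncl, ofPerm]

lemma permHom_ofPerm (δ : K) (π : Perm (Fin p)) :
    permHom δ p (ofPerm K π) = DiagHom.of δ (permDiagram π) := by
  rw [permHom, ofPerm, MonoidAlgebra.lift_single, one_smul]
  rfl

end SymAlgebra

section BrauerAlgebra

variable {K : Type u} [Field K] {δ : K} {p r : ℕ}

lemma DiagHom.induction {motive : DiagHom δ p r → Prop} (a : DiagHom δ p r)
    (zero : motive 0) (of : ∀ x, motive (DiagHom.of δ x))
    (add : ∀ x y, motive x → motive y → motive (x + y))
    (smul : ∀ (c : K) x, motive x → motive (c • x)) : motive a := by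
  induction a using Finsupp.induction_linear with
  | zero => exact zero
  | add x y hx hy => exact add x y hx hy
  | single x c =>
    have : (Finsupp.single x c : Diagram p r →₀ K) = c • Finsupp.single x 1 := by simp
    rw [this]
    exact smul _ _ (of x)

lemma BrauerAlgebra.induction {motive : BrauerAlgebra δ r → Prop} (a : BrauerAlgebra δ r)
    (zero : motive 0) (of : ∀ x : Diagram r r, motive (DiagHom.of δ x))
    (add : ∀ x y, motive x → motive y → motive (x + y))
    (smul : ∀ (c : K) x, motive x → motive (c • x)) : motive a :=
  DiagHom.induction (p := r) (r := r) (motive := motive) a zero of add smul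

/-- The linear map on morphisms given by a function on diagrams. -/
def DiagHom.lift (δ : K) {M : Type v} [AddCommGroup M] [Module K M] (F : Diagram p r → M) :
    DiagHom δ p r →ₗ[K] M := Finsupp.linearCombination K F

lemma DiagHom.lift_of {M : Type v} [AddCommGroup M] [Module K M] (F : Diagram p r → M)
    (x : Diagram p r) : DiagHom.lift δ F (DiagHom.of δ x) = F x :=
  (Finsupp.linearCombination_single K (1 : K) x).trans (one_smul K _)

/-- The basis element of `D_r` that belongs to a diagram. -/
def ofDiag (δ : K) (y : Diagram r r) : BrauerAlgebra δ r := DiagHom.of δ y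

lemma ofDiag_smul_of (y : Diagram r r) (x : Diagram p r) :
    ofDiag δ y • DiagHom.of δ x = δ ^ x.loops y • DiagHom.of δ (x.comp y) :=
  DiagHom.mul_of δ y x

lemma ofDiag_mul_ofDiag (y x : Diagram r r) :
    ofDiag δ y * ofDiag δ x = δ ^ x.loops y • ofDiag δ (x.comp y) :=
  DiagHom.mul_of δ y x

lemma addStrandHom_ofDiag (y : Diagram r r) :
    addStrandHom δ r (ofDiag δ y) = ofDiag δ y.addStrand :=
  (Finsupp.linearCombination_single K (1 : K) y).trans (one_smul K _)

variable {M : Type v} [AddCommGroup M] [Module K M] [Module (BrauerAlgebra δ r) M]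
  {N : Type w} [AddCommGroup N] [Module K N] [Module (BrauerAlgebra δ r) N]

/-- If generators of `M` and their images in `N` are multiplied by diagrams according to the same
rule, then the linear map is compatible with the action of diagrams. -/
lemma commutes_of_generators {X : Type*} {m : X → M} {n : X → N}
    (hspan : AddSubgroup.closure (Set.range m) = ⊤) (c : Diagram r r → X → K)
    (act : Diagram r r → X → X) (hm : ∀ y x, ofDiag δ y • m x = c y x • m (act y x))
    (hn : ∀ y x, ofDiag δ y • n x = c y x • n (act y x)) (f : M →ₗ[K] N) (hf : ∀ x, f (m x) = n x)
    (y : Diagram r r) (z : M) : f (ofDiag δ y • z) = ofDiag δ y • f z := by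
  have hz : z ∈ AddSubgroup.closure (Set.range m) := hspan ▸ AddSubgroup.mem_top z
  induction hz using AddSubgroup.closure_induction with
  | mem z hz =>
    obtain ⟨x, rfl⟩ := hz
    rw [hm, map_smul, hf, hf, hn]
  | zero => simp
  | add a b _ _ ha hb => simp only [smul_add, map_add, ha, hb]
  | neg a _ ha => simp only [smul_neg, map_neg, ha]

variable [IsScalarTower K (BrauerAlgebra δ r) M] [IsScalarTower K (BrauerAlgebra δ r) N]

/-- A `K`-linear map that commutes with all diagrams is `D_r`-linear. -/
def brauerLinear (f : M →ₗ[K] N)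
    (hf : ∀ (y : Diagram r r) m, f (ofDiag δ y • m) = ofDiag δ y • f m) :
    M →ₗ[BrauerAlgebra δ r] N :=
  { f with
    map_smul' := by
      intro y m
      induction y using BrauerAlgebra.induction with
      | zero => simp
      | of y => exact hf y m
      | add x y hx hy => simpa [add_smul] using congrArg₂ (· + ·) hx hy
      | smul c x hx => simpa [smul_assoc] using congrArg (c • ·) hx }

end BrauerAlgebra

section Generators

lemma map_eq_of_generators {M : Type v} [AddCommGroup M] {N : Type w} [AddCommGroup N]
    {X : Type*} {m : X → M} (hspan : AddSubgroup.closure (Set.range m) = ⊤) (f g : M →+ N)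
    (h : ∀ x, f (m x) = g (m x)) (z : M) : f z = g z := by
  have : f = g := by
    refine AddMonoidHom.eq_of_eqOn_dense hspan ?_
    rintro _ ⟨x, rfl⟩
    exact h x
  rw [this]

lemma mem_of_generators {M : Type v} [AddCommGroup M] {N : Type w} [AddCommGroup N]
    {X : Type*} {m : X → M} (hspan : AddSubgroup.closure (Set.range m) = ⊤) (f : M →+ N)
    (S : AddSubgroup N) (h : ∀ x, f (m x) ∈ S) (z : M) : f z ∈ S := by
  have : AddSubgroup.closure (Set.range m) ≤ S.comap f := by
    rw [AddSubgroup.closure_le]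
    rintro _ ⟨x, rfl⟩
    exact h x
  rw [hspan] at this
  exact this (AddSubgroup.mem_top z)

lemma surjective_of_generators {M : Type v} [AddCommGroup M] {N : Type w} [AddCommGroup N]
    {X : Type*} {n : X → N} (hspan : AddSubgroup.closure (Set.range n) = ⊤) (f : M →+ N)
    (h : ∀ x, ∃ m, f m = n x) : Function.Surjective f := by
  rw [← AddMonoidHom.range_eq_top, eq_top_iff, ← hspan, AddSubgroup.closure_le]
  rintro _ ⟨x, rfl⟩
  exact h x

end Generators

namespace Inflation

variable {K : Type u} [Field K] {δ : K} {p r : ℕ} {V : Type v} [AddCommGroup V] [Module K V]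
  [Module (SymAlgebra K p) V]

/-- The class of `x ⊗ v` for a diagram `x`. -/
def mk (δ : K) (x : Diagram p r) : V →ₗ[K] Inflation δ p r V :=
  BalancedTensor.mk _ (Submodule.Quotient.mk (DiagHom.of δ x))

lemma mk_topArc {x : Diagram p r} (h : x.TopArc) (v : V) : mk δ x v = 0 := by
  have : (Submodule.Quotient.mk (DiagHom.of δ x) : TopHom δ p r) = 0 :=
    (Submodule.Quotient.mk_eq_zero _).2 (Submodule.subset_span ⟨x, h.pr_lt, rfl⟩)
  rw [mk, this, map_zero, LinearMap.zero_apply]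

lemma mk_permDiagram_comp (π : Perm (Fin p)) (x : Diagram p r) (v : V) :
    mk δ ((permDiagram π).comp x) v = mk δ x (ofPerm K π • v) := by
  rw [mk, mk, ← BalancedTensor.mk_balanced]
  congr 1
  show _ = BalancedTensor.mk _ (Submodule.Quotient.mk
    (DiagHom.mul δ p p r (DiagHom.of δ x) (permHom δ p (ofPerm K π))))
  have : DiagHom.mul δ p p r (DiagHom.of δ x) (permHom δ p (ofPerm K π)) =
      DiagHom.of δ ((permDiagram π).comp x) := by
    rw [permHom_ofPerm]
    refine (DiagHom.mul_of δ x (permDiagram π)).trans ?_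
    rw [permDiagram_loops, pow_zero, one_smul]
  rw [this]

lemma ofDiag_smul_mk (y : Diagram r r) (x : Diagram p r) (v : V) :
    ofDiag δ y • mk δ x v = δ ^ x.loops y • mk δ (x.comp y) v := by
  rw [mk, BalancedTensor.smul_mk, ← Submodule.Quotient.mk_smul, ofDiag_smul_of,
    Submodule.Quotient.mk_smul, map_smul]
  rfl

lemma induction_on {motive : Inflation δ p r V → Prop} (z : Inflation δ p r V)
    (zero : motive 0) (mk : ∀ (x : Diagram p r) v, motive (mk δ x v))
    (add : ∀ x y, motive x → motive y → motive (x + y)) : motive z := by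
  induction z using BalancedTensor.induction_on with
  | zero => exact zero
  | mk x v =>
    induction x using Submodule.Quotient.induction_on with
    | H x =>
      have : ∀ v, motive (BalancedTensor.mk _ (Submodule.Quotient.mk x) v) := by
        induction x using DiagHom.induction with
        | zero => intro v; simpa using zero
        | of x => exact mk x
        | add x y hx hy =>
          intro v
          rw [Submodule.Quotient.mk_add, map_add, LinearMap.add_apply]
          exact add _ _ (hx v) (hy v)
        | smul c x hx =>
          intro v
          rw [Submodule.Quotient.mk_smul, map_smul, LinearMap.smul_apply, ← map_smul]
          exact hx _
      exact this v
  | add x y hx hy => exact add x y hx hy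

lemma closure_range_mk :
    AddSubgroup.closure (Set.range fun t : Diagram p r × V => mk δ t.1 t.2) = ⊤ := by
  rw [eq_top_iff]
  rintro z -
  induction z using induction_on with
  | zero => exact AddSubgroup.zero_mem _
  | mk x v => exact AddSubgroup.subset_closure ⟨(x, v), rfl⟩
  | add x y hx hy => exact AddSubgroup.add_mem _ hx hy

variable {M : Type v'} [AddCommGroup M] [Module K M]

/-- The linear map on `K D(p, r; p)` given by a function on diagrams that vanishes on the diagrams
of smaller propagating number. -/
def topLift (F : Diagram p r → M) (h0 : ∀ x, x.TopArc → F x = 0) : TopHom δ p r →ₗ[K] M :=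
  spanLift (B := BrauerAlgebra δ r) {m : DiagHom δ p r | ∃ x : Diagram p r, x.pr < p ∧
      m = DiagHom.of δ x} (DiagHom.lift δ F) (by
    rintro y _ ⟨x, hx, rfl⟩
    induction y using BrauerAlgebra.induction with
    | zero => rw [zero_smul, map_zero]
    | of y =>
      change DiagHom.lift δ F (ofDiag δ y • DiagHom.of δ x) = 0
      rw [ofDiag_smul_of, map_smul, DiagHom.lift_of, h0 _ ((Diagram.topArc_of_pr_lt hx).comp y),
        smul_zero]
    | add a b ha hb => rw [add_smul, map_add, ha, hb, add_zero]
    | smul c a ha => rw [smul_assoc, map_smul, ha, smul_zero])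

lemma topLift_of (F : Diagram p r → M) (h0 : ∀ x, x.TopArc → F x = 0) (x : Diagram p r) :
    topLift (δ := δ) F h0 (Submodule.Quotient.mk (DiagHom.of δ x)) = F x :=
  DiagHom.lift_of (δ := δ) F x

lemma topHom_induction {motive : TopHom δ p r → Prop} (a : TopHom δ p r)
    (zero : motive 0) (of : ∀ x, motive (Submodule.Quotient.mk (DiagHom.of δ x)))
    (add : ∀ x y, motive x → motive y → motive (x + y))
    (smul : ∀ (c : K) x, motive x → motive (c • x)) : motive a := by
  induction a using Submodule.Quotient.induction_on with
  | H x =>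
    induction x using DiagHom.induction with
    | zero => exact zero
    | of x => exact of x
    | add x y hx hy => exact add _ _ hx hy
    | smul c x hx => exact smul c _ hx

lemma rightAction_ofPerm (x : Diagram p r) (π : Perm (Fin p)) :
    ((rightAction δ p r).comp (AlgHom.op (permHom δ p))) (MulOpposite.op (ofPerm K π))
      (Submodule.Quotient.mk (DiagHom.of δ x)) =
      Submodule.Quotient.mk (DiagHom.of δ ((permDiagram π).comp x)) := by
  refine congrArg Submodule.Quotient.mk (?_ : DiagHom.mul δ p p r (DiagHom.of δ x)
    (permHom δ p (ofPerm K π)) = _)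
  rw [permHom_ofPerm]
  refine (DiagHom.mul_of δ x (permDiagram π)).trans ?_
  rw [permDiagram_loops, pow_zero, one_smul]

variable [IsScalarTower K (SymAlgebra K p) V]

/-- The `K`-linear map out of the inflation given by linear maps `F x : V → M`, for diagrams `x`,
that are balanced under permutations and vanish if `x` has propagating number less than `p`. -/
def lift (F : Diagram p r → V →ₗ[K] M) (h0 : ∀ x, x.TopArc → F x = 0)
    (hF : ∀ π x v, F ((permDiagram π).comp x) v = F x (ofPerm K π • v)) :
    Inflation δ p r V →ₗ[K] M :=
  BalancedTensor.lift _ (topLift F h0) (by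
    intro x a v
    induction a using SymAlgebra.induction generalizing v with
    | zero => simp
    | ofPerm π =>
      induction x using topHom_induction with
      | zero => simp
      | of x => rw [rightAction_ofPerm, topLift_of, topLift_of, hF]
      | add x y hx hy => simp only [map_add, LinearMap.add_apply, hx, hy]
      | smul c x hx =>
        rw [LinearMap.map_smul_of_tower, (topLift F h0).map_smul, LinearMap.smul_apply, hx,
          (topLift F h0).map_smul, LinearMap.smul_apply]
    | add a b ha hb =>
      simp only [MulOpposite.op_add, map_add, LinearMap.add_apply, ha, hb, add_smul]
    | smul c a ha =>
      simp only [MulOpposite.op_smul, map_smul, LinearMap.smul_apply, ha, smul_assoc])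

@[simp] lemma lift_mk (F : Diagram p r → V →ₗ[K] M) (h0 : ∀ x, x.TopArc → F x = 0)
    (hF : ∀ π x v, F ((permDiagram π).comp x) v = F x (ofPerm K π • v)) (x : Diagram p r) (v : V) :
    lift (δ := δ) F h0 hF (mk δ x v) = F x v :=
  congrArg (fun f : V →ₗ[K] M => f v) (topLift_of F h0 x)

end Inflation

namespace Induced

variable {K : Type u} [Field K] {p : ℕ} {V : Type v} [AddCommGroup V] [Module K V]
  [Module (SymAlgebra K p) V]

/-- The class of `g ⊗ v` for a permutation `g`. -/
def mk (g : Perm (Fin (p + 1))) : V →ₗ[K] Induced K p V :=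
  BalancedTensor.mk _ (ofPerm K g)

lemma ofPerm_smul_mk (h g : Perm (Fin (p + 1))) (v : V) :
    ofPerm K h • mk g v = mk (K := K) (h * g) v := by
  rw [mk, BalancedTensor.smul_mk, smul_eq_mul, ofPerm_mul]
  rfl

lemma mk_mul_permIncl (g : Perm (Fin (p + 1))) (π : Perm (Fin p)) (v : V) :
    mk (K := K) (g * permIncl p π) v = mk g (ofPerm K π • v) := by
  rw [mk, mk, ← BalancedTensor.mk_balanced]
  congr 2
  show _ = ofPerm K g * symIncl K p (ofPerm K π)
  rw [symIncl_ofPerm, ofPerm_mul]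

lemma induction_on {motive : Induced K p V → Prop} (z : Induced K p V)
    (zero : motive 0) (mk : ∀ g v, motive (mk g v))
    (add : ∀ x y, motive x → motive y → motive (x + y)) : motive z := by
  induction z using BalancedTensor.induction_on with
  | zero => exact zero
  | mk a v =>
    induction a using SymAlgebra.induction generalizing v with
    | zero => simpa using zero
    | ofPerm g => exact mk g v
    | add x y hx hy => rw [map_add, LinearMap.add_apply]; exact add _ _ (hx v) (hy v)
    | smul c x hx => rw [map_smul, LinearMap.smul_apply, ← map_smul]; exact hx _
  | add x y hx hy => exact add x y hx hy

lemma eq_apply_smul {M : Type v'} [AddCommGroup M] [Module K M]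
    {f g : Induced K p V →ₗ[K] M} {π : Perm (Fin (p + 1))}
    (h : ∀ x v, f (mk x v) = g (mk (π * x) v)) (z : Induced K p V) :
    f z = g (ofPerm K π • z) := by
  induction z using induction_on with
  | zero => rw [smul_zero, map_zero, map_zero]
  | mk x v => rw [ofPerm_smul_mk, h]
  | add x y hx hy => rw [smul_add, map_add, map_add, hx, hy]

lemma closure_range_mk :
    AddSubgroup.closure (Set.range fun t : Perm (Fin (p + 1)) × V => mk (K := K) t.1 t.2) = ⊤ := by
  rw [eq_top_iff]
  rintro z -
  induction z using induction_on with
  | zero => exact AddSubgroup.zero_mem _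
  | mk x v => exact AddSubgroup.subset_closure ⟨(x, v), rfl⟩
  | add x y hx hy => exact AddSubgroup.add_mem _ hx hy

variable {M : Type v'} [AddCommGroup M] [Module K M]

lemma hom_ext {f g : Induced K p V →ₗ[K] M} (h : ∀ x v, f (mk x v) = g (mk x v)) :
    f = g := by
  refine LinearMap.ext fun z => ?_
  induction z using induction_on with
  | zero => simp
  | mk x v => exact h x v
  | add x y hx hy => rw [map_add, map_add, hx, hy]

variable [IsScalarTower K (SymAlgebra K p) V]

/-- The linear map on the group algebra given by a function on permutations. -/
def _root_.Brauer.SymAlgebra.lift (F : Perm (Fin p) → M) : SymAlgebra K p →ₗ[K] M :=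
  (Finsupp.linearCombination K F).comp (MonoidAlgebra.coeffLinearEquiv K).toLinearMap

lemma _root_.Brauer.SymAlgebra.lift_ofPerm (F : Perm (Fin p) → M) (g : Perm (Fin p)) :
    SymAlgebra.lift (K := K) F (ofPerm K g) = F g :=
  (Finsupp.linearCombination_single K (1 : K) g).trans (one_smul K _)

lemma rightRegular_ofPerm (π : Perm (Fin p)) (g : Perm (Fin (p + 1))) :
    rightRegular (symIncl K p) (MulOpposite.op (ofPerm K π)) (ofPerm K g) =
      ofPerm K (g * permIncl p π) := by
  show ofPerm K g * symIncl K p (ofPerm K π) = _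
  rw [symIncl_ofPerm, ofPerm_mul]

/-- The `K`-linear map out of the induced module given by linear maps `F g : V → M`, for
permutations `g`, that are balanced under `𝔖_p`. -/
def lift (F : Perm (Fin (p + 1)) → V →ₗ[K] M)
    (hF : ∀ g π v, F (g * permIncl p π) v = F g (ofPerm K π • v)) : Induced K p V →ₗ[K] M :=
  BalancedTensor.lift _ (SymAlgebra.lift F) (by
    intro x a v
    induction a using SymAlgebra.induction generalizing v with
    | zero => simp
    | ofPerm π =>
      induction x using SymAlgebra.induction with
      | zero => simp
      | ofPerm g => rw [rightRegular_ofPerm, SymAlgebra.lift_ofPerm, SymAlgebra.lift_ofPerm, hF]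
      | add x y hx hy => simp only [map_add, LinearMap.add_apply, hx, hy]
      | smul c x hx =>
        rw [LinearMap.map_smul_of_tower, (SymAlgebra.lift F).map_smul, LinearMap.smul_apply, hx,
          (SymAlgebra.lift F).map_smul, LinearMap.smul_apply]
    | add a b ha hb =>
      simp only [MulOpposite.op_add, map_add, LinearMap.add_apply, ha, hb, add_smul]
    | smul c a ha =>
      simp only [MulOpposite.op_smul, map_smul, LinearMap.smul_apply, ha, smul_assoc])

@[simp] lemma lift_mk (F : Perm (Fin (p + 1)) → V →ₗ[K] M)
    (hF : ∀ g π v, F (g * permIncl p π) v = F g (ofPerm K π • v)) (g : Perm (Fin (p + 1))) (v : V) :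
    lift F hF (mk g v) = F g v :=
  congrArg (fun f : V →ₗ[K] M => f v) (SymAlgebra.lift_ofPerm F g)

end Induced

/-! ### The restriction of an inflation -/

section RestrictEquiv

variable {K : Type u} [Field K] {A : Type u} [Ring A] [Algebra K A] {B : Type w} [Ring B]
  [Algebra K B] (φ : A →ₐ[K] B) (V : Type v) [AddCommGroup V] [Module K V]

/-- The restriction of a module along a homomorphism has the same underlying vector space. -/
def restrictEquiv : Restrict φ V ≃ₗ[K] V := LinearEquiv.refl K V

lemma smul_restrictEquiv_symm [Module B V] (a : A) (v : V) :
    a • (restrictEquiv φ V).symm v = (restrictEquiv φ V).symm (φ a • v) := rfl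

lemma restrictEquiv_smul [Module B V] (a : A) (v : Restrict φ V) :
    restrictEquiv φ V (a • v) = φ a • restrictEquiv φ V v := rfl

end RestrictEquiv

namespace Inflation

section Restriction

variable {K : Type u} [Field K] {δ : K} {p r : ℕ} {V : Type v} [AddCommGroup V] [Module K V]
  [Module (SymAlgebra K p) V]

/-- The class of `x ⊗ v` in the restriction of an inflation. -/
def rmk (δ : K) (x : Diagram p (r + 1)) :
    V →ₗ[K] Restrict (addStrandHom δ r) (Inflation δ p (r + 1) V) :=
  (restrictEquiv _ _).symm.toLinearMap.comp (mk δ x)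

lemma ofDiag_smul_rmk (y : Diagram r r) (x : Diagram p (r + 1)) (v : V) :
    ofDiag δ y • rmk δ x v = δ ^ x.loops y.addStrand • rmk δ (x.comp y.addStrand) v := by
  show (restrictEquiv _ _).symm (addStrandHom δ r (ofDiag δ y) • mk δ x v) = _
  rw [addStrandHom_ofDiag, ofDiag_smul_mk, LinearEquiv.map_smul]
  rfl

lemma rmk_topArc {x : Diagram p (r + 1)} (h : x.TopArc) (v : V) : rmk δ x v = 0 :=
  mk_topArc h v

lemma rmk_permDiagram_comp (π : Perm (Fin p)) (x : Diagram p (r + 1)) (v : V) :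
    rmk δ ((permDiagram π).comp x) v = rmk δ x (ofPerm K π • v) :=
  mk_permDiagram_comp π x v

lemma closure_range_rmk :
    AddSubgroup.closure (Set.range fun t : Diagram p (r + 1) × V => rmk δ t.1 t.2) = ⊤ :=
  closure_range_mk

variable {M : Type v'} [AddCommGroup M] [Module K M]

section
variable [IsScalarTower K (SymAlgebra K p) V]

/-- `Inflation.lift`, with source regarded as a restricted module. -/
def rlift (F : Diagram p (r + 1) → V →ₗ[K] M) (h0 : ∀ x, x.TopArc → F x = 0)
    (hF : ∀ π x v, F ((permDiagram π).comp x) v = F x (ofPerm K π • v)) :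
    Restrict (addStrandHom δ r) (Inflation δ p (r + 1) V) →ₗ[K] M :=
  (lift (δ := δ) F h0 hF).comp (restrictEquiv _ _).toLinearMap

lemma rlift_rmk (F : Diagram p (r + 1) → V →ₗ[K] M) (h0 : ∀ x, x.TopArc → F x = 0)
    (hF : ∀ π x v, F ((permDiagram π).comp x) v = F x (ofPerm K π • v)) (x : Diagram p (r + 1))
    (v : V) : rlift (δ := δ) F h0 hF (rmk δ x v) = F x v := lift_mk F h0 hF x v

end

/-- The submodule spanned by the `x ⊗ v` in which the last point of the bottom edge of `x` is joined
to the top edge. -/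
def lastThrough (δ : K) (p r : ℕ) (V : Type v) [AddCommGroup V] [Module K V]
    [Module (SymAlgebra K p) V] :
    Submodule (BrauerAlgebra δ r) (Restrict (addStrandHom δ r) (Inflation δ p (r + 1) V)) :=
  Submodule.span _ {z | ∃ (x : Diagram p (r + 1)) (v : V), x.LastThrough ∧ z = rmk δ x v}

lemma rmk_mem_lastThrough {x : Diagram p (r + 1)} (h : x.LastThrough) (v : V) :
    rmk δ x v ∈ lastThrough δ p r V := Submodule.subset_span ⟨x, v, h, rfl⟩

lemma closure_range_mk_mk_one : AddSubgroup.closure (Set.range fun t : Diagram (p + 1) r × V =>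
    mk δ t.1 (Induced.mk (K := K) (1 : Perm (Fin (p + 1))) t.2)) = ⊤ := by
  rw [eq_top_iff, ← closure_range_mk, AddSubgroup.closure_le]
  rintro _ ⟨⟨w, z⟩, rfl⟩
  refine mem_of_generators Induced.closure_range_mk (mk δ w).toAddMonoidHom _ (fun t => ?_) z
  refine AddSubgroup.subset_closure ⟨((permDiagram t.1).comp w, t.2), ?_⟩
  show mk δ ((permDiagram t.1).comp w) (Induced.mk 1 t.2) = _
  rw [mk_permDiagram_comp, Induced.ofPerm_smul_mk, mul_one]
  rfl

variable [IsScalarTower K (SymAlgebra K p) V]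

/-- Bending the last strand of the bottom edge, `x ⊗ v ↦ bend x ⊗ (1 ⊗ v)`, as a linear map over
the field. -/
def bendLinear (δ : K) (p r : ℕ) (V : Type v) [AddCommGroup V] [Module K V]
    [Module (SymAlgebra K p) V] [IsScalarTower K (SymAlgebra K p) V] :
    Restrict (addStrandHom δ r) (Inflation δ p (r + 1) V) →ₗ[K]
      Inflation δ (p + 1) r (Induced K p V) :=
  rlift (fun x => (mk δ x.bend).comp (Induced.mk 1))
    (fun x hx => LinearMap.ext fun v => mk_topArc hx.bend _)
    (by
      intro π x v
      simp only [LinearMap.comp_apply]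
      rw [Diagram.bend_permDiagram_comp, mk_permDiagram_comp, Induced.ofPerm_smul_mk,
        ← Induced.mk_mul_permIncl, mul_one, one_mul])

lemma bendLinear_rmk (x : Diagram p (r + 1)) (v : V) :
    bendLinear δ p r V (rmk δ x v) = mk δ x.bend (Induced.mk 1 v) :=
  rlift_rmk _ _ _ x v

/-- `bendLinear` as a homomorphism of modules over the Brauer algebra. -/
def bendMap (δ : K) (p r : ℕ) (V : Type v) [AddCommGroup V] [Module K V]
    [Module (SymAlgebra K p) V] [IsScalarTower K (SymAlgebra K p) V] :
    Restrict (addStrandHom δ r) (Inflation δ p (r + 1) V) →ₗ[BrauerAlgebra δ r]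
      Inflation δ (p + 1) r (Induced K p V) :=
  brauerLinear (bendLinear δ p r V)
    (commutes_of_generators (closure_range_rmk (δ := δ) (p := p) (r := r) (V := V))
      (fun y t => δ ^ t.1.loops y.addStrand) (fun y t => (t.1.comp y.addStrand, t.2))
      (fun y t => ofDiag_smul_rmk y t.1 t.2)
      (n := fun t => mk δ t.1.bend (Induced.mk 1 t.2))
      (by
        intro y t
        rw [ofDiag_smul_mk, Diagram.bend_comp_addStrand, Diagram.loops_bend])
      (bendLinear δ p r V) (fun t => bendLinear_rmk t.1 t.2))

lemma bendMap_rmk (x : Diagram p (r + 1)) (v : V) :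
    bendMap δ p r V (rmk δ x v) = mk δ x.bend (Induced.mk 1 v) :=
  bendLinear_rmk x v

lemma lastThrough_le_ker : lastThrough δ p r V ≤ LinearMap.ker (bendMap δ p r V) := by
  rw [lastThrough, Submodule.span_le]
  rintro _ ⟨x, v, hx, rfl⟩
  show bendMap δ p r V (rmk δ x v) = 0
  rw [bendMap_rmk, mk_topArc hx.topArc_bend]

/-- Unbending, `w ⊗ (g ⊗ v) ↦ bend⁻¹ (w g) ⊗ v`, which is well defined modulo the diagrams whose
last strand reaches the top edge, that is, after a linear map `q` that kills them. -/
def unbendLift (q : Restrict (addStrandHom δ r) (Inflation δ p (r + 1) V) →ₗ[K] M)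
    (hq : ∀ x : Diagram p (r + 1), x.LastThrough → ∀ v, q (rmk δ x v) = 0) :
    Inflation δ (p + 1) r (Induced K p V) →ₗ[K] M :=
  lift
    (fun w => Induced.lift
      (fun g => q.comp (rmk δ (Diagram.bend.symm ((permDiagram g).comp w))))
      (by
        intro g π v
        simp only [LinearMap.comp_apply]
        rw [← rmk_permDiagram_comp, ← Diagram.bend_symm_permDiagram_comp, ← Diagram.comp_assoc,
          permDiagram_comp]))
    (by
      intro w hw
      refine Induced.hom_ext fun g v => ?_
      rw [Induced.lift_mk, LinearMap.zero_apply]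
      have : (Diagram.bend (Diagram.bend.symm ((permDiagram g).comp w))).TopArc := by
        rw [Equiv.apply_symm_apply, Diagram.topArc_permDiagram_comp]
        exact hw
      rcases Diagram.topArc_or_lastThrough_of_bend this with h | h
      · rw [LinearMap.comp_apply, rmk_topArc h, map_zero]
      · exact hq _ h v)
    (by
      intro π w z
      refine Induced.eq_apply_smul (fun g v => ?_) z
      rw [Induced.lift_mk, Induced.lift_mk, ← Diagram.comp_assoc, permDiagram_comp])

lemma unbendLift_mk (q : Restrict (addStrandHom δ r) (Inflation δ p (r + 1) V) →ₗ[K] M)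
    (hq : ∀ x : Diagram p (r + 1), x.LastThrough → ∀ v, q (rmk δ x v) = 0)
    (w : Diagram (p + 1) r) (g : Perm (Fin (p + 1))) (v : V) :
    unbendLift q hq (mk δ w (Induced.mk g v)) =
      q (rmk δ (Diagram.bend.symm ((permDiagram g).comp w)) v) := by
  rw [unbendLift, lift_mk, Induced.lift_mk]
  rfl

/-- Unbending, with values in the quotient by the diagrams whose last strand reaches the top
edge. -/
def unbendMap (δ : K) (p r : ℕ) (V : Type v) [AddCommGroup V] [Module K V]
    [Module (SymAlgebra K p) V] [IsScalarTower K (SymAlgebra K p) V] :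
    Inflation δ (p + 1) r (Induced K p V) →ₗ[K]
      (Restrict (addStrandHom δ r) (Inflation δ p (r + 1) V) ⧸ lastThrough δ p r V) :=
  unbendLift ((lastThrough δ p r V).mkQ.restrictScalars K)
    (fun _ h v => (Submodule.Quotient.mk_eq_zero _).2 (rmk_mem_lastThrough h v))

lemma unbendMap_mk (w : Diagram (p + 1) r) (g : Perm (Fin (p + 1))) (v : V) :
    unbendMap δ p r V (mk δ w (Induced.mk g v)) =
      Submodule.Quotient.mk (rmk δ (Diagram.bend.symm ((permDiagram g).comp w)) v) :=
  unbendLift_mk _ _ w g v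

lemma bendMap_surjective : Function.Surjective (bendMap δ p r V) :=
  surjective_of_generators closure_range_mk_mk_one (bendMap δ p r V).toAddMonoidHom
    (fun t => ⟨rmk δ (Diagram.bend.symm t.1) t.2, (bendMap_rmk _ _).trans (by
      rw [Equiv.apply_symm_apply])⟩)

lemma unbendMap_bendMap (z : Restrict (addStrandHom δ r) (Inflation δ p (r + 1) V)) :
    unbendMap δ p r V (bendMap δ p r V z) = Submodule.Quotient.mk z :=
  map_eq_of_generators closure_range_rmk
    ((unbendMap δ p r V).toAddMonoidHom.comp (bendMap δ p r V).toAddMonoidHom)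
    (lastThrough δ p r V).mkQ.toAddMonoidHom (fun t => by
      show unbendMap δ p r V (bendMap δ p r V (rmk δ t.1 t.2)) = Submodule.Quotient.mk _
      rw [bendMap_rmk, unbendMap_mk, permDiagram_one_comp, Equiv.symm_apply_apply]) z

lemma ker_bendMap : LinearMap.ker (bendMap δ p r V) = lastThrough δ p r V := by
  refine le_antisymm (fun z hz => ?_) lastThrough_le_ker
  rw [← Submodule.Quotient.mk_eq_zero, ← unbendMap_bendMap, LinearMap.mem_ker.1 hz,
    LinearMap.map_zero]

/-- The restriction of an inflation, modulo the diagrams whose last strand reaches the top edge, is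
the inflation of the induced module. -/
def quotientLastThroughEquiv (δ : K) (p r : ℕ) (V : Type v) [AddCommGroup V] [Module K V]
    [Module (SymAlgebra K p) V] [IsScalarTower K (SymAlgebra K p) V] :
    (Restrict (addStrandHom δ r) (Inflation δ p (r + 1) V) ⧸ lastThrough δ p r V)
      ≃ₗ[BrauerAlgebra δ r] Inflation δ (p + 1) r (Induced K p V) :=
  (Submodule.quotEquivOfEq _ _ ker_bendMap.symm).trans
    ((bendMap δ p r V).quotKerEquivOfSurjective bendMap_surjective)

lemma lastThrough_zero (V : Type v) [AddCommGroup V] [Module K V] [Module (SymAlgebra K 0) V] :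
    lastThrough δ 0 r V = ⊥ := by
  rw [lastThrough, Submodule.span_eq_bot]
  rintro _ ⟨x, v, ⟨i, -⟩, rfl⟩
  exact i.elim0

end Restriction

section Strand

variable {K : Type u} [Field K] {δ : K} {p r : ℕ} {V : Type v} [AddCommGroup V] [Module K V]
  [Module (SymAlgebra K (p + 1)) V]

lemma ofPerm_smul_restrict (π : Perm (Fin p)) (v : V) :
    ofPerm K π • (restrictEquiv (symIncl K p) V).symm v =
      (restrictEquiv (symIncl K p) V).symm (ofPerm K (permIncl p π) • v) := by
  rw [smul_restrictEquiv_symm, symIncl_ofPerm]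

lemma closure_range_mk_restrict : AddSubgroup.closure (Set.range fun t : Diagram p r × V =>
    mk δ t.1 ((restrictEquiv (symIncl K p) V).symm t.2)) = ⊤ :=
  closure_range_mk (V := Restrict (symIncl K p) V)

/-- The decomposition of a diagram as `(z ⊗ id₁) π` is unique up to `𝔖_p`, which does not affect the
class of `z ⊗ π v`. -/
lemma mk_eq_of_addStrand {π π' : Perm (Fin (p + 1))} {z z' : Diagram p r}
    (h : (permDiagram π).comp z.addStrand = (permDiagram π').comp z'.addStrand) (v : V) :
    mk δ z ((restrictEquiv (symIncl K p) V).symm (ofPerm K π • v)) =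
      mk δ z' ((restrictEquiv (symIncl K p) V).symm (ofPerm K π' • v)) := by
  have hlast : (π * π'⁻¹) (Fin.last p) = Fin.last p := by
    rw [Equiv.Perm.mul_apply, ← Diagram.rel_permDiagram_comp_addStrand_iff π z, h,
      Diagram.rel_permDiagram_comp_addStrand_iff, ← Equiv.Perm.mul_apply, mul_inv_cancel,
      Equiv.Perm.one_apply]
  obtain ⟨σ, hσ⟩ := exists_permIncl_eq _ hlast
  have h2 : z' = (permDiagram σ).comp z := by
    apply Diagram.addStrand_injective
    rw [← Diagram.addStrand_comp, Diagram.addStrand_permDiagram, hσ, ← permDiagram_comp,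
      Diagram.comp_assoc, h, ← Diagram.comp_assoc, permDiagram_comp, mul_inv_cancel,
      permDiagram_one_comp]
  rw [h2, mk_permDiagram_comp, ofPerm_smul_restrict, hσ, smul_smul, ofPerm_mul,
    inv_mul_cancel_right]

variable [IsScalarTower K (SymAlgebra K (p + 1)) V]

/-- Adding a through strand, `z ⊗ v ↦ (z ⊗ id₁) ⊗ v`, as a linear map over the field. -/
def addStrandLinear (δ : K) (p r : ℕ) (V : Type v) [AddCommGroup V] [Module K V]
    [Module (SymAlgebra K (p + 1)) V] [IsScalarTower K (SymAlgebra K (p + 1)) V] :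
    Inflation δ p r (Restrict (symIncl K p) V) →ₗ[K]
      Restrict (addStrandHom δ r) (Inflation δ (p + 1) (r + 1) V) :=
  lift (V := Restrict (symIncl K p) V)
    (fun z => (rmk (V := V) δ z.addStrand).comp (restrictEquiv (symIncl K p) V).toLinearMap)
    (fun z hz => LinearMap.ext fun v => rmk_topArc (V := V) hz.addStrand _)
    (by
      intro π z v
      obtain ⟨v, rfl⟩ := (restrictEquiv (symIncl K p) V).symm.surjective v
      rw [ofPerm_smul_restrict]
      simp only [LinearMap.comp_apply, LinearEquiv.coe_coe, LinearEquiv.apply_symm_apply]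
      rw [← Diagram.addStrand_comp, Diagram.addStrand_permDiagram, rmk_permDiagram_comp])

lemma addStrandLinear_mk (z : Diagram p r) (v : V) :
    addStrandLinear δ p r V (mk δ z ((restrictEquiv (symIncl K p) V).symm v)) =
      rmk δ z.addStrand v := by
  rw [addStrandLinear, lift_mk]
  simp only [LinearMap.comp_apply, LinearEquiv.coe_coe, LinearEquiv.apply_symm_apply]

/-- `addStrandLinear` as a homomorphism of modules over the Brauer algebra. -/
def addStrandMap (δ : K) (p r : ℕ) (V : Type v) [AddCommGroup V] [Module K V]
    [Module (SymAlgebra K (p + 1)) V] [IsScalarTower K (SymAlgebra K (p + 1)) V] :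
    Inflation δ p r (Restrict (symIncl K p) V) →ₗ[BrauerAlgebra δ r]
      Restrict (addStrandHom δ r) (Inflation δ (p + 1) (r + 1) V) :=
  brauerLinear (addStrandLinear δ p r V)
    (commutes_of_generators (closure_range_mk_restrict (δ := δ) (p := p) (r := r) (V := V))
      (fun y t => δ ^ t.1.loops y) (fun y t => (t.1.comp y, t.2))
      (fun y t => ofDiag_smul_mk y t.1 _)
      (n := fun t => rmk δ t.1.addStrand t.2)
      (by
        intro y t
        rw [ofDiag_smul_rmk, Diagram.addStrand_comp, Diagram.addStrand_loops])
      (addStrandLinear δ p r V) (fun t => addStrandLinear_mk t.1 t.2))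

lemma addStrandMap_mk (z : Diagram p r) (v : V) :
    addStrandMap δ p r V (mk δ z ((restrictEquiv (symIncl K p) V).symm v)) =
      rmk δ z.addStrand v := addStrandLinear_mk z v

lemma range_addStrandMap : LinearMap.range (addStrandMap δ p r V) = lastThrough δ (p + 1) r V := by
  apply le_antisymm
  · rintro _ ⟨z, rfl⟩
    have hz : z ∈ AddSubgroup.closure (Set.range fun t : Diagram p r × V =>
        mk δ t.1 ((restrictEquiv (symIncl K p) V).symm t.2)) := by
      rw [closure_range_mk_restrict]
      trivial
    induction hz using AddSubgroup.closure_induction with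
    | mem z hz =>
      obtain ⟨t, rfl⟩ := hz
      rw [addStrandMap_mk]
      exact rmk_mem_lastThrough ⟨Fin.last p, addStrandRel_last t.1.rel⟩ _
    | zero => rw [LinearMap.map_zero]; exact Submodule.zero_mem _
    | add x y _ _ hx hy => rw [LinearMap.map_add]; exact Submodule.add_mem _ hx hy
    | neg x _ hx => rw [LinearMap.map_neg]; exact Submodule.neg_mem _ hx
  · rw [lastThrough, Submodule.span_le]
    rintro _ ⟨x, v, hx, rfl⟩
    obtain ⟨π, z, rfl⟩ := hx.exists_eq
    rw [rmk_permDiagram_comp]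
    exact ⟨_, addStrandMap_mk z _⟩

open Classical in
/-- A `K`-linear retraction of `addStrandMap`: if the last strand of the bottom edge of `x` reaches
the top edge, then `x = (z ⊗ id₁) π` for a permutation `π`, and `x ⊗ v` is sent to `z ⊗ π v`. -/
def removeStrandMap (δ : K) (p r : ℕ) (V : Type v) [AddCommGroup V] [Module K V]
    [Module (SymAlgebra K (p + 1)) V] [IsScalarTower K (SymAlgebra K (p + 1)) V] :
    Restrict (addStrandHom δ r) (Inflation δ (p + 1) (r + 1) V) →ₗ[K]
      Inflation δ p r (Restrict (symIncl K p) V) :=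
  rlift
    (fun x => if h : x.LastThrough then
      ((mk δ h.exists_eq.choose_spec.choose).comp
        (restrictEquiv (symIncl K p) V).symm.toLinearMap).comp
          (Algebra.lsmul K K V (ofPerm K h.exists_eq.choose)) else 0)
    (by
      intro x hx
      split_ifs with h
      · refine LinearMap.ext fun v => mk_topArc ?_ _
        rw [h.exists_eq.choose_spec.choose_spec, Diagram.topArc_permDiagram_comp] at hx
        exact Diagram.topArc_of_addStrand hx
      · rfl)
    (by
      intro π x v
      by_cases h : x.LastThrough
      · have h' := (Diagram.lastThrough_permDiagram_comp π x).2 h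
        rw [dif_pos h, dif_pos h']
        simp only [LinearMap.comp_apply, LinearEquiv.coe_coe, Algebra.lsmul_coe]
        rw [smul_smul, ofPerm_mul]
        apply mk_eq_of_addStrand
        rw [← h'.exists_eq.choose_spec.choose_spec, ← permDiagram_comp, Diagram.comp_assoc,
          ← h.exists_eq.choose_spec.choose_spec]
      · rw [dif_neg h, dif_neg (fun h' => h ((Diagram.lastThrough_permDiagram_comp π x).1 h'))]
        rfl)

lemma addStrandMap_injective : Function.Injective (addStrandMap δ p r V) := by
  apply Function.LeftInverse.injective (g := removeStrandMap δ p r V)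
  intro z
  refine map_eq_of_generators closure_range_mk_restrict
    ((removeStrandMap δ p r V).toAddMonoidHom.comp (addStrandMap δ p r V).toAddMonoidHom)
    (AddMonoidHom.id _) (fun t => ?_) z
  obtain ⟨z, v⟩ := t
  show removeStrandMap δ p r V
    (addStrandMap δ p r V (mk δ z ((restrictEquiv (symIncl K p) V).symm v))) =
      mk δ z ((restrictEquiv (symIncl K p) V).symm v)
  have h : z.addStrand.LastThrough := ⟨Fin.last p, addStrandRel_last z.rel⟩
  rw [addStrandMap_mk, removeStrandMap, rlift_rmk, dif_pos h]
  simp only [LinearMap.comp_apply, LinearEquiv.coe_coe, Algebra.lsmul_coe]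
  refine (mk_eq_of_addStrand (π' := 1) (z' := z) (v := v) ?_).trans ?_
  · rw [← h.exists_eq.choose_spec.choose_spec, permDiagram_one_comp]
  · rw [ofPerm_one, one_smul]

/-- The diagrams whose last strand reaches the top edge form a copy of the inflation of the
restricted module. -/
def lastThroughEquiv (δ : K) (p r : ℕ) (V : Type v) [AddCommGroup V] [Module K V]
    [Module (SymAlgebra K (p + 1)) V] [IsScalarTower K (SymAlgebra K (p + 1)) V] :
    Inflation δ p r (Restrict (symIncl K p) V) ≃ₗ[BrauerAlgebra δ r]
      lastThrough δ (p + 1) r V :=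
  (LinearEquiv.ofInjective _ addStrandMap_injective).trans
    (LinearEquiv.ofEq _ _ range_addStrandMap)

end Strand

section Splitting

variable {K : Type u} [Field K] {δ : K} {r : ℕ}

lemma nonempty_equiv_quotient_prod {R : Type u} [Ring R] [IsSemisimpleRing R] {M : Type v}
    [AddCommGroup M] [Module R M] (J : Submodule R M) : Nonempty (M ≃ₗ[R] (M ⧸ J) × J) := by
  obtain ⟨J', hJ⟩ := exists_isCompl J
  exact ⟨(Submodule.prodEquivOfIsCompl _ _ hJ.symm).symm.trans
    ((Submodule.quotientEquivOfIsCompl _ _ hJ).symm.prodCongr (LinearEquiv.refl _ _))⟩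

/-- Without points on the top edge, no strand reaches it, so the kernel of bending vanishes. -/
theorem restrict_zero (V : Type v) [AddCommGroup V] [Module K V] [Module (SymAlgebra K 0) V]
    [IsScalarTower K (SymAlgebra K 0) V] :
    Nonempty (Restrict (addStrandHom δ r) (Inflation δ 0 (r + 1) V)
      ≃ₗ[BrauerAlgebra δ r] Inflation δ 1 r (Induced K 0 V)) :=
  ⟨(Submodule.quotEquivOfEqBot _ (lastThrough_zero V)).symm.trans
    (quotientLastThroughEquiv δ 0 r V)⟩

/-- The restriction of an inflation is an extension of the inflation of the induced module by that
of the restricted module, and it splits by semisimplicity. -/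
theorem restrict_succ [IsSemisimpleRing (BrauerAlgebra δ r)] (p : ℕ) (V : Type v)
    [AddCommGroup V] [Module K V] [Module (SymAlgebra K (p + 1)) V]
    [IsScalarTower K (SymAlgebra K (p + 1)) V] :
    Nonempty (Restrict (addStrandHom δ r) (Inflation δ (p + 1) (r + 1) V)
      ≃ₗ[BrauerAlgebra δ r] (Inflation δ (p + 2) r (Induced K (p + 1) V) ×
        Inflation δ p r (Restrict (symIncl K p) V))) := by
  obtain ⟨e⟩ := nonempty_equiv_quotient_prod (lastThrough δ (p + 1) r V)
  exact ⟨e.trans ((quotientLastThroughEquiv δ (p + 1) r V).prodCongr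
    (lastThroughEquiv δ p r V).symm)⟩

end Splitting

end Inflation

/-! ### Young's lattice -/

section YoungLattice

variable {lam mu nu : YoungDiagram}

lemma addCell_iff : AddCell lam mu ↔ lam ≤ mu ∧ mu.card = lam.card + 1 := by
  constructor
  · rintro ⟨c, hc, h⟩
    refine ⟨YoungDiagram.cells_subset_iff.1 (h ▸ Finset.subset_insert _ _), ?_⟩
    show mu.cells.card = lam.cells.card + 1
    rw [h, Finset.card_insert_of_notMem hc]
  · rintro ⟨h1, h2⟩
    have hs := YoungDiagram.cells_subset_iff.2 h1
    have : (mu.cells \ lam.cells).card = 1 := by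
      rw [Finset.card_sdiff_of_subset hs]
      change mu.cells.card = lam.cells.card + 1 at h2
      omega
    obtain ⟨c, hc⟩ := Finset.card_eq_one.1 this
    refine ⟨c, fun h => ?_, ?_⟩
    · have : c ∈ mu.cells \ lam.cells := hc ▸ Finset.mem_singleton_self c
      exact (Finset.mem_sdiff.1 this).2 h
    · rw [← Finset.sdiff_union_of_subset hs, hc]
      rfl

lemma AddCell.card (h : AddCell lam mu) : mu.card = lam.card + 1 := (addCell_iff.1 h).2

lemma AddCell.le (h : AddCell lam mu) : lam ≤ mu := (addCell_iff.1 h).1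

lemma eq_of_le_of_card_le (h : lam ≤ mu) (hc : mu.card ≤ lam.card) : lam = mu :=
  YoungDiagram.ext (Finset.eq_of_subset_of_card_le (YoungDiagram.cells_subset_iff.2 h) hc)

lemma card_sup_add_card_inf (lam mu : YoungDiagram) :
    (lam ⊔ mu).card + (lam ⊓ mu).card = lam.card + mu.card := by
  show (lam ⊔ mu).cells.card + (lam ⊓ mu).cells.card = _
  rw [YoungDiagram.cells_sup, YoungDiagram.cells_inf, Finset.card_union_add_card_inter]

/-- The diagrams obtained from `lam` by adding a cell. -/
abbrev Up (lam : YoungDiagram) : Type := {mu : YoungDiagram // AddCell lam mu}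

/-- The diagrams obtained from `lam` by removing a cell. -/
abbrev Down (lam : YoungDiagram) : Type := {mu : YoungDiagram // AddCell mu lam}

instance (lam : YoungDiagram) : Finite (Down lam) := by
  let f : Down lam → {s // s ∈ lam.cells.powerset} := fun mu =>
    ⟨mu.1.cells, Finset.mem_powerset.2 (YoungDiagram.cells_subset_iff.2 mu.2.le)⟩
  refine Finite.of_injective f fun a b h => Subtype.ext (YoungDiagram.ext ?_)
  exact congrArg Subtype.val h

/-- A cell can be added to row `i`. -/
def CanAdd (lam : YoungDiagram) (i : ℕ) : Prop := i = 0 ∨ lam.rowLen i < lam.rowLen (i - 1)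

/-- A cell can be removed from row `i`. -/
def CanRemove (lam : YoungDiagram) (i : ℕ) : Prop := lam.rowLen (i + 1) < lam.rowLen i

/-- The diagram `lam` with a cell added to row `i`. -/
def addRow (lam : YoungDiagram) (i : ℕ) (h : CanAdd lam i) : YoungDiagram where
  cells := insert (i, lam.rowLen i) lam.cells
  isLowerSet := by
    rintro ⟨a, b⟩ ⟨a', b'⟩ hle hab
    obtain ⟨h1, h2⟩ : a' ≤ a ∧ b' ≤ b := hle
    rw [Finset.mem_coe, Finset.mem_insert] at hab ⊢
    rcases hab with hab | hab
    · obtain ⟨rfl, rfl⟩ : a = i ∧ b = lam.rowLen i := by simpa using hab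
      by_cases e : a' = a
      · subst e
        rcases h2.eq_or_lt with e | e
        · left; rw [e]
        · right; exact YoungDiagram.mem_iff_lt_rowLen.2 e
      · right
        rw [YoungDiagram.mem_cells, YoungDiagram.mem_iff_lt_rowLen]
        rcases h with h | h
        · omega
        · exact (h2.trans_lt h).trans_le (lam.rowLen_anti _ _ (by omega))
    · exact Or.inr (lam.up_left_mem h1 h2 hab)

lemma addCell_addRow (i : ℕ) (h : CanAdd lam i) : AddCell lam (addRow lam i h) :=
  ⟨(i, lam.rowLen i), fun hm => lt_irrefl _ (YoungDiagram.mem_iff_lt_rowLen.1 hm), rfl⟩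

/-- The diagram `lam` with a cell removed from row `i`. -/
def removeRow (lam : YoungDiagram) (i : ℕ) (h : CanRemove lam i) : YoungDiagram where
  cells := lam.cells.erase (i, lam.rowLen i - 1)
  isLowerSet := by
    rintro ⟨a, b⟩ ⟨a', b'⟩ hle hab
    obtain ⟨h1, h2⟩ : a' ≤ a ∧ b' ≤ b := hle
    rw [Finset.mem_coe, Finset.mem_erase] at hab ⊢
    refine ⟨fun e => hab.1 ?_, lam.up_left_mem h1 h2 hab.2⟩
    obtain ⟨rfl, rfl⟩ : a' = i ∧ b' = lam.rowLen i - 1 := by simpa using e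
    have hb := YoungDiagram.mem_iff_lt_rowLen.1 hab.2
    have h3 := lam.rowLen_anti _ _ h1
    unfold CanRemove at h
    by_cases e : a = a'
    · subst e
      rw [Prod.mk.injEq]
      exact ⟨rfl, by omega⟩
    · have := lam.rowLen_anti (a' + 1) a (by omega)
      omega

lemma addCell_removeRow (i : ℕ) (h : CanRemove lam i) : AddCell (removeRow lam i h) lam := by
  refine ⟨(i, lam.rowLen i - 1), Finset.notMem_erase _ _, (Finset.insert_erase ?_).symm⟩
  rw [YoungDiagram.mem_cells, YoungDiagram.mem_iff_lt_rowLen]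
  unfold CanRemove at h
  omega

/-- Diagrams above `lam` correspond to the rows that admit a new cell. -/
def upEquiv (lam : YoungDiagram) : {i // CanAdd lam i} ≃ Up lam :=
  Equiv.ofBijective (fun i => ⟨addRow lam i.1 i.2, addCell_addRow i.1 i.2⟩) (by
    constructor
    · rintro ⟨i, hi⟩ ⟨j, hj⟩ h
      have h' : insert (i, lam.rowLen i) lam.cells = insert (j, lam.rowLen j) lam.cells :=
        congrArg (fun mu : Up lam => mu.1.cells) h
      have h1 : (i, lam.rowLen i) ∈ insert (j, lam.rowLen j) lam.cells :=
        h' ▸ Finset.mem_insert_self _ _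
      rcases Finset.mem_insert.1 h1 with h1 | h1
      · exact Subtype.ext (congrArg Prod.fst h1)
      · exact absurd (YoungDiagram.mem_iff_lt_rowLen.1 h1) (lt_irrefl _)
    · rintro ⟨mu, ⟨i, j⟩, hc, h⟩
      have hm : ∀ c, c ∈ mu ↔ c = (i, j) ∨ c ∈ lam := fun c => by
        rw [← YoungDiagram.mem_cells, h, Finset.mem_insert, YoungDiagram.mem_cells]
      have hij : (i, j) ∈ mu := (hm _).2 (Or.inl rfl)
      have hj : j = lam.rowLen i := by
        have h1 : lam.rowLen i ≤ j := by
          by_contra hlt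
          exact hc (YoungDiagram.mem_iff_lt_rowLen.2 (not_le.1 hlt))
        rcases (hm _).1 (mu.up_left_mem le_rfl h1 hij) with e | e
        · exact (congrArg Prod.snd e).symm
        · exact absurd (YoungDiagram.mem_iff_lt_rowLen.1 e) (lt_irrefl _)
      have hi : CanAdd lam i := by
        by_cases e : i = 0
        · exact Or.inl e
        · right
          rcases (hm _).1 (mu.up_left_mem (Nat.sub_le i 1) le_rfl hij) with e' | e'
          · have := congrArg Prod.fst e'
            simp only at this
            omega
          · rw [← hj]
            exact YoungDiagram.mem_iff_lt_rowLen.1 e'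
      refine ⟨⟨i, hi⟩, Subtype.ext (YoungDiagram.ext ?_)⟩
      show insert (i, lam.rowLen i) lam.cells = mu.cells
      rw [h, hj])

/-- Diagrams below `lam` correspond to the rows whose last cell can be removed. -/
def downEquiv (lam : YoungDiagram) : {i // CanRemove lam i} ≃ Down lam :=
  Equiv.ofBijective (fun i => ⟨removeRow lam i.1 i.2, addCell_removeRow i.1 i.2⟩) (by
    have key : ∀ i, CanRemove lam i → (i, lam.rowLen i - 1) ∈ lam.cells := by
      intro i hi
      rw [YoungDiagram.mem_cells, YoungDiagram.mem_iff_lt_rowLen]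
      unfold CanRemove at hi
      omega
    constructor
    · rintro ⟨i, hi⟩ ⟨j, hj⟩ h
      have h' : lam.cells.erase (i, lam.rowLen i - 1) = lam.cells.erase (j, lam.rowLen j - 1) :=
        congrArg (fun mu : Down lam => mu.1.cells) h
      have h1 : (i, lam.rowLen i - 1) ∉ lam.cells.erase (j, lam.rowLen j - 1) :=
        h' ▸ Finset.notMem_erase _ _
      rw [Finset.mem_erase, not_and_or, not_not] at h1
      rcases h1 with h1 | h1
      · exact Subtype.ext (congrArg Prod.fst h1)
      · exact absurd (key i hi) h1
    · rintro ⟨mu, ⟨i, j⟩, hc, h⟩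
      have hm : ∀ c, c ∈ lam ↔ c = (i, j) ∨ c ∈ mu := fun c => by
        rw [← YoungDiagram.mem_cells, h, Finset.mem_insert, YoungDiagram.mem_cells]
      have hij : (i, j) ∈ lam := (hm _).2 (Or.inl rfl)
      have hj := YoungDiagram.mem_iff_lt_rowLen.1 hij
      have h1 : lam.rowLen i ≤ j + 1 := by
        by_contra hlt
        rcases (hm _).1 (YoungDiagram.mem_iff_lt_rowLen.2 (not_le.1 hlt)) with e | e
        · have := congrArg Prod.snd e
          simp at this
        · exact hc (mu.up_left_mem le_rfl (Nat.le_succ j) e)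
      have h2 : lam.rowLen (i + 1) ≤ j := by
        by_contra hlt
        rcases (hm _).1 (YoungDiagram.mem_iff_lt_rowLen.2 (not_le.1 hlt)) with e | e
        · have := congrArg Prod.fst e
          simp at this
        · exact hc (mu.up_left_mem (Nat.le_succ i) le_rfl e)
      refine ⟨⟨i, h2.trans_lt hj⟩, Subtype.ext (YoungDiagram.ext ?_)⟩
      show lam.cells.erase (i, lam.rowLen i - 1) = mu.cells
      have : lam.rowLen i - 1 = j := by omega
      rw [this, h, Finset.erase_insert hc])

/-- A cell can be added to the first row, and to row `i + 1` if and only if one can be removed from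
row `i`. -/
def canAddEquiv (lam : YoungDiagram) : {i // CanAdd lam i} ≃ Option {i // CanRemove lam i} where
  toFun i := match i with
    | ⟨0, _⟩ => none
    | ⟨i + 1, h⟩ => some ⟨i, h.resolve_left (Nat.succ_ne_zero i)⟩
  invFun o := match o with
    | none => ⟨0, Or.inl rfl⟩
    | some ⟨i, h⟩ => ⟨i + 1, Or.inr h⟩
  left_inv := by rintro ⟨_ | i, h⟩ <;> rfl
  right_inv := by rintro (_ | ⟨i, h⟩) <;> rfl

/-- There is one more way of adding a cell than of removing one. -/
def upEquivOptionDown (lam : YoungDiagram) : Up lam ≃ Option (Down lam) :=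
  (upEquiv lam).symm.trans ((canAddEquiv lam).trans (Equiv.optionCongr (downEquiv lam)))

instance (lam : YoungDiagram) : Finite (Up lam) :=
  Finite.of_equiv _ (upEquivOptionDown lam).symm

instance (lam : YoungDiagram) : Fintype (Down lam) := Fintype.ofFinite _

instance (lam : YoungDiagram) : Fintype (Up lam) := Fintype.ofFinite _

lemma card_up (lam : YoungDiagram) : Fintype.card (Up lam) = Fintype.card (Down lam) + 1 := by
  rw [Fintype.card_congr (upEquivOptionDown lam), Fintype.card_option]

/-- A nonempty diagram has a removable cell. -/
lemma nonempty_down (h : lam.card ≠ 0) : Nonempty (Down lam) := by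
  have h0 : (0, 0) ∈ lam := by
    obtain ⟨⟨a, b⟩, hc⟩ := Finset.card_ne_zero.1 h
    exact lam.up_left_mem (Nat.zero_le a) (Nat.zero_le b) hc
  have h1 := YoungDiagram.mem_iff_lt_colLen.1 h0
  refine ⟨downEquiv lam ⟨lam.colLen 0 - 1, ?_⟩⟩
  have h2 : (lam.colLen 0 - 1, 0) ∈ lam := YoungDiagram.mem_iff_lt_colLen.2 (by omega)
  have h3 : (lam.colLen 0 - 1 + 1, 0) ∉ lam := fun h => by
    have := YoungDiagram.mem_iff_lt_colLen.1 h
    omega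
  rw [YoungDiagram.mem_iff_lt_rowLen] at h2 h3
  unfold CanRemove
  omega

/-- The diagrams of the same size as `lam` that differ from it in one cell. -/
abbrev Adjacent (lam : YoungDiagram) : Type :=
  {nu : YoungDiagram // nu ≠ lam ∧ nu.card = lam.card ∧ (lam ⊔ nu).card = lam.card + 1}

open Classical in
/-- Going up and then down leads back or to an adjacent diagram, in a unique way to the latter. -/
def upDownEquiv (lam : YoungDiagram) : (Σ mu : Up lam, Down mu.1) ≃ Up lam ⊕ Adjacent lam :=
  have key : ∀ t : (Σ mu : Up lam, Down mu.1), t.2.1 ≠ lam → t.2.1.card = lam.card ∧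
      lam ⊔ t.2.1 = t.1.1 := by
    rintro ⟨mu, nu⟩ hne
    have h1 : nu.1.card = lam.card := by
      have := mu.2.card
      have := nu.2.card
      omega
    refine ⟨h1, eq_of_le_of_card_le (sup_le mu.2.le nu.2.le) ?_⟩
    have h2 : lam.card < (lam ⊔ nu.1).card := by
      by_contra hlt
      have h3 := eq_of_le_of_card_le (le_sup_left : lam ≤ lam ⊔ nu.1) (not_lt.1 hlt)
      have h4 : nu.1 ≤ lam := le_sup_right.trans h3.ge
      exact hne (eq_of_le_of_card_le h4 h1.ge)
    have := mu.2.card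
    show mu.1.card ≤ (lam ⊔ nu.1).card
    omega
  { toFun := fun t => if h : t.2.1 = lam then Sum.inl t.1 else
      Sum.inr ⟨t.2.1, h, (key t h).1, by rw [(key t h).2]; exact t.1.2.card⟩
    invFun := Sum.elim (fun mu => ⟨mu, ⟨lam, mu.2⟩⟩) (fun nu =>
      ⟨⟨lam ⊔ nu.1, addCell_iff.2 ⟨le_sup_left, nu.2.2.2⟩⟩,
        ⟨nu.1, addCell_iff.2 ⟨le_sup_right, by rw [nu.2.2.2, nu.2.2.1]⟩⟩⟩)
    left_inv := by
      rintro ⟨⟨mu, hmu⟩, ⟨nu, hnu⟩⟩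
      by_cases h : nu = lam
      · subst h
        simp
      · have := (key ⟨⟨mu, hmu⟩, ⟨nu, hnu⟩⟩ h).2
        simp only at this
        subst this
        simp [h]
    right_inv := by
      rintro (mu | ⟨nu, hnu⟩)
      · simp
      · simp [hnu.1] }

open Classical in
/-- Going down and then up leads back or to an adjacent diagram, in a unique way to the latter. -/
def downUpEquiv (lam : YoungDiagram) : (Σ mu : Down lam, Up mu.1) ≃ Down lam ⊕ Adjacent lam :=
  have key : ∀ t : (Σ mu : Down lam, Up mu.1), t.2.1 ≠ lam → t.2.1.card = lam.card ∧
      lam ⊓ t.2.1 = t.1.1 := by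
    rintro ⟨mu, nu⟩ hne
    have h1 : nu.1.card = lam.card := by
      have := mu.2.card
      have := nu.2.card
      omega
    refine ⟨h1, (eq_of_le_of_card_le (le_inf mu.2.le nu.2.le) ?_).symm⟩
    have h2 : (lam ⊓ nu.1).card < lam.card := by
      by_contra hlt
      have h3 := eq_of_le_of_card_le (inf_le_left : lam ⊓ nu.1 ≤ lam) (not_lt.1 hlt)
      have h4 : lam ≤ nu.1 := h3.ge.trans inf_le_right
      exact hne (eq_of_le_of_card_le h4 h1.le).symm
    have := mu.2.card
    show (lam ⊓ nu.1).card ≤ mu.1.card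
    omega
  { toFun := fun t => if h : t.2.1 = lam then Sum.inl t.1 else
      Sum.inr ⟨t.2.1, h, (key t h).1, by
        have h1 := card_sup_add_card_inf lam t.2.1
        have h2 := key t h
        have h3 := t.1.2.card
        rw [h2.2] at h1
        omega⟩
    invFun := Sum.elim (fun mu => ⟨mu, ⟨lam, mu.2⟩⟩) (fun nu =>
      ⟨⟨lam ⊓ nu.1, addCell_iff.2 ⟨inf_le_left, by
          have := card_sup_add_card_inf lam nu.1
          have := nu.2
          omega⟩⟩,
        ⟨nu.1, addCell_iff.2 ⟨inf_le_right, by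
          show nu.1.card = (lam ⊓ nu.1).card + 1
          have := card_sup_add_card_inf lam nu.1
          have := nu.2
          omega⟩⟩⟩)
    left_inv := by
      rintro ⟨⟨mu, hmu⟩, ⟨nu, hnu⟩⟩
      by_cases h : nu = lam
      · subst h
        simp
      · have := (key ⟨⟨mu, hmu⟩, ⟨nu, hnu⟩⟩ h).2
        simp only at this
        subst this
        simp [h]
    right_inv := by
      rintro (mu | ⟨nu, hnu⟩)
      · simp
      · simp [hnu.1] }

/-- Young's lattice is a differential poset: the up and down operators satisfy `DU - UD = 1`. -/
lemma sum_up_down (lam : YoungDiagram) (d : YoungDiagram → ℕ) :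
    ∑ mu : Up lam, ∑ nu : Down mu.1, d nu.1 =
      (∑ mu : Down lam, ∑ nu : Up mu.1, d nu.1) + d lam := by
  classical
  have : Finite (Adjacent lam) :=
    Finite.of_injective (fun a => (upDownEquiv lam).symm (Sum.inr a))
      ((upDownEquiv lam).symm.injective.comp Sum.inr_injective)
  have := Fintype.ofFinite (Adjacent lam)
  have h1 : ∑ mu : Up lam, ∑ nu : Down mu.1, d nu.1 =
      ∑ t : Up lam ⊕ Adjacent lam, Sum.elim (fun _ => d lam) (fun nu => d nu.1) t := by
    rw [← Fintype.sum_sigma', ← (upDownEquiv lam).symm.sum_comp]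
    refine Finset.sum_congr rfl fun t _ => ?_
    rcases t with t | t <;> rfl
  have h2 : ∑ mu : Down lam, ∑ nu : Up mu.1, d nu.1 =
      ∑ t : Down lam ⊕ Adjacent lam, Sum.elim (fun _ => d lam) (fun nu => d nu.1) t := by
    rw [← Fintype.sum_sigma', ← (downUpEquiv lam).symm.sum_comp]
    refine Finset.sum_congr rfl fun t _ => ?_
    rcases t with t | t <;> rfl
  rw [h1, h2, Fintype.sum_sum_type, Fintype.sum_sum_type]
  simp only [Sum.elim_inl, Sum.elim_inr, Finset.sum_const, Finset.card_univ, card_up, smul_eq_mul]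
  ring

/-- Two families of inequalities between the values of a function at neighbouring diagrams force
equality, by `DU - UD = 1`. -/
lemma sum_up_eq_of_le {d : YoungDiagram → ℕ} {N : ℕ}
    (h1 : ∀ lam : YoungDiagram, lam.card ≤ N → ∑ mu : Down lam, d mu.1 ≤ d lam)
    (h2 : ∀ lam : YoungDiagram, lam.card < N → ∑ mu : Up lam, d mu.1 ≤ (lam.card + 1) * d lam) :
    ∀ n < N, ∀ lam : YoungDiagram, lam.card = n →
      ∑ mu : Up lam, d mu.1 = (n + 1) * d lam ∧
        ∀ mu : Up lam, ∑ nu : Down mu.1, d nu.1 = d mu.1 := by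
  intro n
  induction n with
  | zero =>
    intro hn lam hlam
    have hdown : IsEmpty (Down lam) := ⟨fun mu => by
      have := mu.2.card
      omega⟩
    have h3 := sum_up_down lam d
    have h0 : ∑ mu : Down lam, ∑ nu : Up mu.1, d nu.1 = 0 := Fintype.sum_empty _
    rw [h0, zero_add] at h3
    have h4 : ∀ mu : Up lam, ∑ nu : Down mu.1, d nu.1 ≤ d mu.1 := fun mu =>
      h1 mu.1 (by rw [mu.2.card]; omega)
    have h5 := h2 lam (by omega)
    rw [hlam] at h5
    have h6 := Finset.sum_le_sum (s := Finset.univ) fun mu _ => h4 mu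
    refine ⟨by omega, fun mu => ?_⟩
    exact (Finset.sum_eq_sum_iff_of_le fun mu _ => h4 mu).1 (by omega) mu (Finset.mem_univ _)
  | succ n ih =>
    intro hn lam hlam
    obtain ⟨kap⟩ := nonempty_down (lam := lam) (by omega)
    have hcard : ∀ mu : Down lam, mu.1.card = n := fun mu => by
      have := mu.2.card
      omega
    have h3 := sum_up_down lam d
    -- By induction, going down and then up multiplies `d` by `n + 1`, so by `DU - UD = 1` going up
    -- and then down multiplies it by `n + 2`, the largest factor that the hypotheses allow.
    have h7 : ∑ mu : Down lam, ∑ nu : Up mu.1, d nu.1 = (n + 1) * d lam := by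
      rw [← (ih (by omega) kap.1 (hcard kap)).2 ⟨lam, kap.2⟩, Finset.mul_sum]
      exact Finset.sum_congr rfl fun mu _ => (ih (by omega) mu.1 (hcard mu)).1
    have h4 : ∀ mu : Up lam, ∑ nu : Down mu.1, d nu.1 ≤ d mu.1 := fun mu =>
      h1 mu.1 (by rw [mu.2.card]; omega)
    have h5 := h2 lam (by omega)
    rw [hlam] at h5
    have h6 := Finset.sum_le_sum (s := Finset.univ) fun mu _ => h4 mu
    have e : (n + 1 + 1) * d lam = (n + 1) * d lam + d lam := by ring
    refine ⟨by omega, fun mu => ?_⟩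
    exact (Finset.sum_eq_sum_iff_of_le fun mu _ => h4 mu).1 (by omega) mu (Finset.mem_univ _)

lemma sum_down_eq_of_le {d : YoungDiagram → ℕ} {N : ℕ}
    (h1 : ∀ lam : YoungDiagram, lam.card ≤ N → ∑ mu : Down lam, d mu.1 ≤ d lam)
    (h2 : ∀ lam : YoungDiagram, lam.card < N → ∑ mu : Up lam, d mu.1 ≤ (lam.card + 1) * d lam)
    (lam : YoungDiagram) (h : lam.card ≤ N) (h0 : lam.card ≠ 0) :
    ∑ mu : Down lam, d mu.1 = d lam := by
  obtain ⟨kap⟩ := nonempty_down h0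
  have := kap.2.card
  exact (sum_up_eq_of_le h1 h2 kap.1.card (by omega) kap.1 rfl).2 ⟨lam, kap.2⟩

end YoungLattice

/-! ### Fillings of Young diagrams -/

section Fillings

variable {n : ℕ} {T T' : Fin n → ℕ × ℕ} {lam mu : YoungDiagram}

/-- The points of `Fin n` are placed bijectively in the cells of `lam`. -/
structure IsFilling (T : Fin n → ℕ × ℕ) (lam : YoungDiagram) : Prop where
  injective : Function.Injective T
  mem_iff : ∀ c, c ∈ lam ↔ ∃ i, T i = c

lemma IsFilling.mem (hT : IsFilling T lam) (i : Fin n) : T i ∈ lam := (hT.mem_iff _).2 ⟨i, rfl⟩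

lemma IsFilling.image_eq (hT : IsFilling T lam) : Finset.univ.image T = lam.cells := by
  ext c
  rw [YoungDiagram.mem_cells, hT.mem_iff]
  simp

lemma IsFilling.card_eq (hT : IsFilling T lam) : lam.card = n := by
  show lam.cells.card = n
  rw [← hT.image_eq, Finset.card_image_of_injective _ hT.injective, Finset.card_univ,
    Fintype.card_fin]

lemma isFilling_filling (lam : YoungDiagram) : IsFilling (fun i => (filling lam i).1) lam where
  injective := Subtype.val_injective.comp (filling lam).injective
  mem_iff c := ⟨fun h => ⟨(filling lam).symm ⟨c, h⟩, by simp⟩, by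
    rintro ⟨i, rfl⟩
    exact (filling lam i).2⟩

lemma exists_isFilling (h : lam.card = n) : ∃ T : Fin n → ℕ × ℕ, IsFilling T lam := by
  subst h
  exact ⟨_, isFilling_filling lam⟩

/-- The number of cells in the first `k` rows. -/
def rowSum (lam : YoungDiagram) (k : ℕ) : ℕ := (lam.cells.filter fun c => c.1 < k).card

lemma rowSum_succ (lam : YoungDiagram) (k : ℕ) :
    rowSum lam (k + 1) = rowSum lam k + lam.rowLen k := by
  rw [rowSum, rowSum, YoungDiagram.rowLen_eq_card, ← Finset.card_union_of_disjoint]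
  · congr 1
    ext c
    simp only [Finset.mem_filter, Finset.mem_union, YoungDiagram.mem_row_iff,
      YoungDiagram.mem_cells, Nat.lt_succ_iff_lt_or_eq]
    tauto
  · rw [Finset.disjoint_left]
    intro c h1 h2
    rw [Finset.mem_filter] at h1
    rw [YoungDiagram.mem_row_iff] at h2
    omega

lemma eq_of_rowSum_eq (h : ∀ k, rowSum lam k = rowSum mu k) : lam = mu := by
  have h' : ∀ k, lam.rowLen k = mu.rowLen k := fun k => by
    have h1 := h (k + 1)
    rw [rowSum_succ, rowSum_succ, h k] at h1
    omega
  apply YoungDiagram.ext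
  ext ⟨i, j⟩
  rw [YoungDiagram.mem_cells, YoungDiagram.mem_cells, YoungDiagram.mem_iff_lt_rowLen,
    YoungDiagram.mem_iff_lt_rowLen, h']

lemma rowSum_eq_sum (lam : YoungDiagram) (k : ℕ) :
    rowSum lam k = ∑ j ∈ lam.cells.image Prod.snd, min k (lam.colLen j) := by
  rw [rowSum, Finset.card_eq_sum_card_fiberwise (f := Prod.snd) (t := lam.cells.image Prod.snd)]
  · refine Finset.sum_congr rfl fun j _ => ?_
    have : ((lam.cells.filter fun c => c.1 < k).filter fun c => c.2 = j) =
        Finset.range (min k (lam.colLen j)) ×ˢ {j} := by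
      ext ⟨a, b⟩
      simp only [Finset.mem_filter, YoungDiagram.mem_cells, Finset.mem_product, Finset.mem_range,
        Finset.mem_singleton, lt_min_iff]
      constructor
      · rintro ⟨⟨h1, h2⟩, rfl⟩
        exact ⟨⟨h2, YoungDiagram.mem_iff_lt_colLen.1 h1⟩, rfl⟩
      · rintro ⟨⟨h1, h2⟩, rfl⟩
        exact ⟨⟨YoungDiagram.mem_iff_lt_colLen.2 h2, h1⟩, rfl⟩
    rw [this, Finset.card_product, Finset.card_range, Finset.card_singleton, mul_one]
  · intro c hc
    exact Finset.mem_coe.2 (Finset.mem_image_of_mem _ (Finset.mem_filter.1 hc).1)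

/-- The number of points in the first `k` rows of `T'` that `g` moves to column `j` of `T`. -/
def colCount (T T' : Fin n → ℕ × ℕ) (g : Perm (Fin n)) (k j : ℕ) : ℕ :=
  (Finset.univ.filter fun i => (T' i).1 < k ∧ (T (g i)).2 = j).card

/-- No two points in the same row of `T'` are moved to the same column of `T` by `g`. -/
def Separates (T T' : Fin n → ℕ × ℕ) (g : Perm (Fin n)) : Prop :=
  ∀ i j, i ≠ j → (T' i).1 = (T' j).1 → (T (g i)).2 ≠ (T (g j)).2

lemma colCount_le (hT : IsFilling T lam) {g : Perm (Fin n)} (h : Separates T T' g) (k j : ℕ) :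
    colCount T T' g k j ≤ min k (lam.colLen j) := by
  apply le_min
  · have : colCount T T' g k j ≤ (Finset.range k).card := by
      refine Finset.card_le_card_of_injOn (fun i => (T' i).1) ?_ ?_
      · intro i hi
        have := (Finset.mem_filter.1 hi).2.1
        simpa using this
      · intro a ha b hb hab
        by_contra hne
        exact h a b hne hab
          ((Finset.mem_filter.1 ha).2.2.trans (Finset.mem_filter.1 hb).2.2.symm)
    simpa using this
  · rw [YoungDiagram.colLen_eq_card]
    refine Finset.card_le_card_of_injOn (fun i => T (g i)) ?_ ?_
    · intro i hi
      exact Finset.mem_coe.2 (YoungDiagram.mem_col_iff.2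
        ⟨hT.mem _, (Finset.mem_filter.1 hi).2.2⟩)
    · exact (hT.injective.comp g.injective).injOn

lemma rowSum_eq_sum_colCount (hT : IsFilling T lam) (hT' : IsFilling T' mu) (g : Perm (Fin n))
    (k : ℕ) : rowSum mu k = ∑ j ∈ lam.cells.image Prod.snd, colCount T T' g k j := by
  have h1 : rowSum mu k = (Finset.univ.filter fun i => (T' i).1 < k).card := by
    rw [rowSum, ← hT'.image_eq, Finset.filter_image,
      Finset.card_image_of_injective _ hT'.injective]
  rw [h1, Finset.card_eq_sum_card_fiberwise (f := fun i => (T (g i)).2)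
    (t := lam.cells.image Prod.snd)]
  · refine Finset.sum_congr rfl fun j _ => ?_
    rw [colCount, Finset.filter_filter]
  · intro i _
    exact Finset.mem_coe.2 (Finset.mem_image_of_mem _ (hT.mem (g i)))

/-- If some permutation moves the points in each row of a filling of `mu` to different columns of a
filling of `lam`, then `lam` dominates `mu`. -/
lemma rowSum_le_of_separates (hT : IsFilling T lam) (hT' : IsFilling T' mu) {g : Perm (Fin n)}
    (h : Separates T T' g) (k : ℕ) : rowSum mu k ≤ rowSum lam k := by
  rw [rowSum_eq_sum_colCount hT hT' g, rowSum_eq_sum lam]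
  exact Finset.sum_le_sum fun j _ => colCount_le hT h k j

lemma row_lt_of_separates (hT : IsFilling T lam) {g : Perm (Fin n)}
    (h : Separates T T g) (i : Fin n) : (T i).1 < lam.colLen (T (g i)).2 := by
  -- With `k` the length of column `j`, equality holds in the estimate of `rowSum_le_of_separates`.
  set j := (T (g i)).2 with hj
  have hjm : j ∈ lam.cells.image Prod.snd := Finset.mem_image_of_mem _ (hT.mem (g i))
  have h1 := (rowSum_eq_sum_colCount hT hT g (lam.colLen j)).symm.trans
    (rowSum_eq_sum lam (lam.colLen j))
  have h2 := (Finset.sum_eq_sum_iff_of_le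
    fun j' _ => colCount_le hT h (lam.colLen j) j').1 h1 j hjm
  rw [min_self] at h2
  have h3 : (Finset.univ.filter fun i => (T (g i)).2 = j).card ≤ lam.colLen j := by
    rw [YoungDiagram.colLen_eq_card]
    refine Finset.card_le_card_of_injOn (fun i => T (g i)) ?_
      (hT.injective.comp g.injective).injOn
    intro i hi
    exact Finset.mem_coe.2 (YoungDiagram.mem_col_iff.2 ⟨hT.mem _, (Finset.mem_filter.1 hi).2⟩)
  have h4 : (Finset.univ.filter fun i => (T i).1 < lam.colLen j ∧ (T (g i)).2 = j) =
      Finset.univ.filter fun i => (T (g i)).2 = j := by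
    refine Finset.eq_of_subset_of_card_le (fun i hi => ?_) (h3.trans h2.ge)
    exact Finset.mem_filter.2 ⟨Finset.mem_univ _, (Finset.mem_filter.1 hi).2.2⟩
  have : i ∈ Finset.univ.filter fun i => (T (g i)).2 = j :=
    Finset.mem_filter.2 ⟨Finset.mem_univ _, hj.symm⟩
  rw [← h4] at this
  exact (Finset.mem_filter.1 this).2.1

/-- A permutation that moves the points in each row of a filling to different columns is a product
of a column permutation and a row permutation. -/
lemma exists_mul_of_separates (hT : IsFilling T lam) {g : Perm (Fin n)} (h : Separates T T g) :
    ∃ s : Perm (Fin n), (∀ i, (T (s i)).2 = (T i).2) ∧ ∀ i, (T ((s * g) i)).1 = (T i).1 := by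
  -- The column permutation `s` moves `x` within its column to the row from which `g` moved it.
  have hex : ∀ x, ∃ y, T y = ((T (g⁻¹ x)).1, (T x).2) := fun x => by
    rw [← hT.mem_iff, YoungDiagram.mem_iff_lt_colLen]
    have := row_lt_of_separates hT h (g⁻¹ x)
    rwa [← Equiv.Perm.mul_apply, mul_inv_cancel, Equiv.Perm.one_apply] at this
  choose s hs using hex
  have hinj : Function.Injective s := by
    intro a b hab
    have e : ((T (g⁻¹ a)).1, (T a).2) = ((T (g⁻¹ b)).1, (T b).2) := by rw [← hs, ← hs, hab]
    rw [Prod.mk.injEq] at e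
    by_contra hne
    refine h (g⁻¹ a) (g⁻¹ b) (fun e' => hne (g⁻¹.injective e')) e.1 ?_
    rw [← Equiv.Perm.mul_apply, ← Equiv.Perm.mul_apply, mul_inv_cancel]
    exact e.2
  refine ⟨Equiv.ofBijective s (Finite.injective_iff_bijective.1 hinj), fun i => ?_, fun i => ?_⟩
  · rw [Equiv.ofBijective_apply, hs]
  · rw [Equiv.Perm.mul_apply, Equiv.ofBijective_apply, hs, ← Equiv.Perm.mul_apply, inv_mul_cancel]
    rfl

end Fillings

/-! ### Young symmetrizers -/

section CharSum

variable {K : Type u} [Field K] {n : ℕ}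

open Classical in
/-- The sum of the elements of a subgroup, weighted by a character. -/
def charSum (χ : Perm (Fin n) →* K) (H : Subgroup (Perm (Fin n))) : SymAlgebra K n :=
  ∑ σ : Perm (Fin n) with σ ∈ H, MonoidAlgebra.single σ (χ σ)

variable {χ : Perm (Fin n) →* K} {H : Subgroup (Perm (Fin n))} {σ : Perm (Fin n)}

lemma apply_mul_apply_inv (χ : Perm (Fin n) →* K) (σ : Perm (Fin n)) : χ σ * χ σ⁻¹ = 1 := by
  rw [← map_mul, mul_inv_cancel, map_one]

lemma ofPerm_mul_charSum (h : σ ∈ H) : ofPerm K σ * charSum χ H = χ σ⁻¹ • charSum χ H := by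
  classical
  rw [charSum, Finset.mul_sum, Finset.smul_sum]
  refine Finset.sum_equiv (Equiv.mulLeft σ) (fun τ => ?_) fun τ _ => ?_
  · simp [H.mul_mem_cancel_left h]
  · rw [MonoidAlgebra.single_mul_single, MonoidAlgebra.smul_single, smul_eq_mul,
      Equiv.coe_mulLeft, map_mul, ← mul_assoc, mul_comm (χ σ⁻¹), apply_mul_apply_inv]

lemma charSum_mul_ofPerm (h : σ ∈ H) : charSum χ H * ofPerm K σ = χ σ⁻¹ • charSum χ H := by
  classical
  rw [charSum, Finset.sum_mul, Finset.smul_sum]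
  refine Finset.sum_equiv (Equiv.mulRight σ) (fun τ => ?_) fun τ _ => ?_
  · simp [H.mul_mem_cancel_right h]
  · rw [MonoidAlgebra.single_mul_single, MonoidAlgebra.smul_single, smul_eq_mul,
      Equiv.coe_mulRight, map_mul, mul_left_comm, mul_comm (χ σ⁻¹), apply_mul_apply_inv, mul_one]

open Classical in
lemma charSum_coeff (χ : Perm (Fin n) →* K) (H : Subgroup (Perm (Fin n))) (g : Perm (Fin n)) :
    (charSum χ H).coeff g = if g ∈ H then χ g else 0 := by
  rw [charSum, MonoidAlgebra.coeff_sum, Finsupp.finsetSum_apply]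
  simp only [MonoidAlgebra.coeff_single, Finsupp.single_apply, Finset.sum_ite_eq',
    Finset.mem_filter, Finset.mem_univ, true_and]

end CharSum

section Symmetrizers

variable {n : ℕ}

/-- The permutations that preserve the columns of a filling. -/
def colGroup (T : Fin n → ℕ × ℕ) : Subgroup (Perm (Fin n)) where
  carrier := {σ | ∀ i, (T (σ i)).2 = (T i).2}
  mul_mem' := fun {a b} ha hb i => (ha (b i)).trans (hb i)
  one_mem' _ := rfl
  inv_mem' := fun {a} ha i => by
    have := ha (a⁻¹ i)
    rw [← Equiv.Perm.mul_apply, mul_inv_cancel] at this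
    exact this.symm

/-- The permutations that preserve the rows of a filling. -/
def rowGroup (T : Fin n → ℕ × ℕ) : Subgroup (Perm (Fin n)) where
  carrier := {σ | ∀ i, (T (σ i)).1 = (T i).1}
  mul_mem' := fun {a b} ha hb i => (ha (b i)).trans (hb i)
  one_mem' _ := rfl
  inv_mem' := fun {a} ha i => by
    have := ha (a⁻¹ i)
    rw [← Equiv.Perm.mul_apply, mul_inv_cancel] at this
    exact this.symm

variable (K : Type u) [Field K]

/-- The sign character with values in `K`. -/
def signChar (n : ℕ) : Perm (Fin n) →* K :=
  (Int.castRingHom K : ℤ →* K).comp ((Units.coeHom ℤ).comp Equiv.Perm.sign)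

/-- The column antisymmetrizer of a filling. -/
def colSym (T : Fin n → ℕ × ℕ) : SymAlgebra K n := charSum (signChar K n) (colGroup T)

/-- The row symmetrizer of a filling. -/
def rowSym (T : Fin n → ℕ × ℕ) : SymAlgebra K n := charSum 1 (rowGroup T)

/-- The left ideal generated by the Young symmetrizer of a filling. -/
abbrev FillingSpecht (T : Fin n → ℕ × ℕ) : Submodule (SymAlgebra K n) (SymAlgebra K n) :=
  Submodule.span (SymAlgebra K n) {colSym K T * rowSym K T}

lemma specht_eq (lam : YoungDiagram) :
    Specht K lam = FillingSpecht K (fun i => (filling lam i).1) := by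
  have : youngSymmetrizer K lam =
      colSym K (fun i => (filling lam i).1) * rowSym K (fun i => (filling lam i).1) := by
    classical
    unfold youngSymmetrizer colSym rowSym charSum
    congr 1
    · refine Finset.sum_congr ?_ fun _ _ => rfl
      ext σ
      rw [Finset.mem_filter, Finset.mem_filter]
      exact Iff.rfl
    · refine Finset.sum_congr ?_ fun _ _ => rfl
      ext σ
      rw [Finset.mem_filter, Finset.mem_filter]
      exact Iff.rfl
  unfold Specht FillingSpecht
  rw [this]

variable {K} {T T' : Fin n → ℕ × ℕ} {lam mu : YoungDiagram}

open Classical in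
lemma symmetrizer_coeff (T : Fin n → ℕ × ℕ) (g : Perm (Fin n)) :
    (colSym K T * rowSym K T).coeff g =
      ∑ σ : Perm (Fin n) with σ ∈ colGroup T,
        if σ⁻¹ * g ∈ rowGroup T then signChar K n σ else 0 := by
  rw [colSym, charSum, Finset.sum_mul, MonoidAlgebra.coeff_sum, Finsupp.finsetSum_apply]
  refine Finset.sum_congr rfl fun σ _ => ?_
  rw [MonoidAlgebra.coeff_single_mul_apply, rowSym, charSum_coeff]
  simp

lemma eq_one_of_mem_of_mem (hT : Function.Injective T) {σ : Perm (Fin n)} (h1 : σ ∈ colGroup T)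
    (h2 : σ ∈ rowGroup T) : σ = 1 :=
  Equiv.ext fun i => hT (Prod.ext (h2 i) (h1 i))

lemma symmetrizer_coeff_one (hT : Function.Injective T) :
    (colSym K T * rowSym K T).coeff 1 = 1 := by
  classical
  rw [symmetrizer_coeff, Finset.sum_eq_single 1]
  · rw [if_pos (by simp), map_one]
  · intro σ h1 h2
    rw [if_neg]
    intro h
    rw [mul_one] at h
    exact h2 (eq_one_of_mem_of_mem hT (Finset.mem_filter.1 h1).2 (inv_mem_iff.1 h))
  · intro h
    exact absurd (Finset.mem_filter.2 ⟨Finset.mem_univ _, Subgroup.one_mem _⟩) h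

lemma symmetrizer_ne_zero (hT : Function.Injective T) : colSym K T * rowSym K T ≠ 0 := fun h => by
  have := symmetrizer_coeff_one (K := K) hT
  rw [h] at this
  exact zero_ne_one this

lemma colSym_mul_ofPerm {σ : Perm (Fin n)} (h : σ ∈ colGroup T) :
    colSym K T * ofPerm K σ = signChar K n σ⁻¹ • colSym K T := charSum_mul_ofPerm h

lemma ofPerm_mul_rowSym {σ : Perm (Fin n)} (h : σ ∈ rowGroup T) :
    ofPerm K σ * rowSym K T = rowSym K T :=
  (ofPerm_mul_charSum h).trans (by rw [MonoidHom.one_apply, one_smul]; rfl)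

lemma two_ne_zero_of_factorial (hn : (n.factorial : K) ≠ 0) {i j : Fin n} (h : i ≠ j) :
    (2 : K) ≠ 0 := fun h2 => hn (by
  have : 2 ≤ n := by
    have := i.isLt; have := j.isLt
    have : i.1 ≠ j.1 := fun e => h (Fin.ext e)
    omega
  obtain ⟨k, hk⟩ := Nat.dvd_factorial two_pos this
  rw [hk, Nat.cast_mul, Nat.cast_two, h2, zero_mul])

/-- The transposition of two points in the same row of `T'` that `g` moves to the same column of
`T` changes the sign. -/
lemma separates_of_ne_zero (hn : (n.factorial : K) ≠ 0) {g : Perm (Fin n)}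
    (h : colSym K T * ofPerm K g * rowSym K T' ≠ 0) : Separates T T' g := by
  intro i j hij h1 h2
  apply h
  have hrow : Equiv.swap i j ∈ rowGroup T' := fun k => by
    rw [Equiv.swap_apply_def]
    split_ifs with e1 e2
    · rw [e1, h1]
    · rw [e2, h1]
    · rfl
  have hcol : Equiv.swap (g i) (g j) ∈ colGroup T := fun k => by
    rw [Equiv.swap_apply_def]
    split_ifs with e1 e2
    · rw [e1, h2]
    · rw [e2, h2]
    · rfl
  have hcomm : Equiv.swap (g i) (g j) * g = g * Equiv.swap i j := by
    rw [Equiv.mul_swap_eq_swap_mul]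
  have e : colSym K T * ofPerm K g * rowSym K T' = -(colSym K T * ofPerm K g * rowSym K T') := by
    conv_lhs => rw [← ofPerm_mul_rowSym hrow, ← mul_assoc, mul_assoc (colSym K T), ofPerm_mul,
      ← hcomm, ← ofPerm_mul, ← mul_assoc, colSym_mul_ofPerm hcol]
    have : signChar K n (Equiv.swap (g i) (g j))⁻¹ = -1 := by
      simp [signChar, Equiv.Perm.sign_swap (fun e => hij (g.injective e))]
    rw [this, neg_smul, one_smul, neg_mul, neg_mul]
  have h3 : (2 : K) • (colSym K T * ofPerm K g * rowSym K T') = 0 := by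
    rw [two_smul]
    conv_lhs => lhs; rw [e]
    exact neg_add_cancel _
  exact (smul_eq_zero.1 h3).resolve_left (two_ne_zero_of_factorial hn hij)

/-- Von Neumann's lemma: the column antisymmetrizer and the row symmetrizer of a filling cut the
group algebra down to the multiples of the Young symmetrizer. -/
lemma exists_colSym_mul_mul_rowSym (hn : (n.factorial : K) ≠ 0) (hT : IsFilling T lam)
    (a : SymAlgebra K n) :
    ∃ c : K, colSym K T * a * rowSym K T = c • (colSym K T * rowSym K T) := by
  induction a using SymAlgebra.induction with
  | zero => exact ⟨0, by simp⟩
  | ofPerm g =>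
    by_cases h : colSym K T * ofPerm K g * rowSym K T = 0
    · exact ⟨0, by rw [h, zero_smul]⟩
    · obtain ⟨s, hs, hr⟩ := exists_mul_of_separates hT (separates_of_ne_zero hn h)
      have hs' : s⁻¹ ∈ colGroup T := (colGroup T).inv_mem hs
      refine ⟨signChar K n s⁻¹⁻¹, ?_⟩
      have e : ofPerm K g = ofPerm K s⁻¹ * ofPerm K (s * g) := by
        rw [ofPerm_mul, inv_mul_cancel_left]
      rw [e, ← mul_assoc, mul_assoc _ _ (rowSym K T), ofPerm_mul_rowSym hr, colSym_mul_ofPerm hs',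
        smul_mul_assoc]
  | add a b ha hb =>
    obtain ⟨c, hc⟩ := ha
    obtain ⟨d, hd⟩ := hb
    exact ⟨c + d, by rw [mul_add, add_mul, hc, hd, add_smul]⟩
  | smul c a ha =>
    obtain ⟨d, hd⟩ := ha
    exact ⟨c * d, by rw [mul_smul_comm, smul_mul_assoc, hd, smul_smul]⟩

end Symmetrizers

/-! ### Simplicity of Specht modules -/

section Simple

variable {K : Type u} [Field K] {n : ℕ} {T T' : Fin n → ℕ × ℕ} {lam mu : YoungDiagram}

/-- Maschke's theorem for symmetric groups. -/
lemma isSemisimpleModule_symAlgebra (hn : (n.factorial : K) ≠ 0) (M : Type v) [AddCommGroup M]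
    [Module (SymAlgebra K n) M] : IsSemisimpleModule (SymAlgebra K n) M := by
  have : NeZero (Nat.card (Perm (Fin n)) : K) := by
    rw [Nat.card_eq_fintype_card, Fintype.card_perm, Fintype.card_fin]
    exact ⟨hn⟩
  infer_instance

lemma exists_mul_of_mem {x : SymAlgebra K n} (hx : x ∈ FillingSpecht K T) :
    ∃ a, x = a * (colSym K T * rowSym K T) := by
  obtain ⟨a, ha⟩ := Submodule.mem_span_singleton.1 hx
  exact ⟨a, ha.symm⟩

lemma exists_colSym_mul_eq (hn : (n.factorial : K) ≠ 0) (hT : IsFilling T lam)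
    {x : SymAlgebra K n} (hx : x ∈ FillingSpecht K T) :
    ∃ c : K, colSym K T * x = c • (colSym K T * rowSym K T) := by
  obtain ⟨a, rfl⟩ := exists_mul_of_mem hx
  obtain ⟨c, hc⟩ := exists_colSym_mul_mul_rowSym hn hT (a * colSym K T)
  exact ⟨c, by rw [← hc, mul_assoc, mul_assoc]⟩

/-- A nonzero submodule of the Specht module is generated by an idempotent, which would vanish if
the column antisymmetrizer killed the submodule. -/
lemma exists_colSym_mul_ne_zero (hn : (n.factorial : K) ≠ 0)
    {U : Submodule (SymAlgebra K n) (SymAlgebra K n)} (hU : U ≤ FillingSpecht K T) (h0 : U ≠ ⊥) :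
    ∃ u ∈ U, colSym K T * u ≠ 0 := by
  by_contra! h
  have : IsSemisimpleRing (SymAlgebra K n) := isSemisimpleModule_symAlgebra hn _
  obtain ⟨e, he, hUe⟩ := IsSemisimpleRing.ideal_eq_span_idempotent U
  have heU : e ∈ U := hUe ▸ Ideal.mem_span_singleton_self e
  obtain ⟨a, ha⟩ := exists_mul_of_mem (hU heU)
  have : e = 0 := by
    rw [← he.eq]
    conv_lhs => lhs; rw [ha]
    have h1 := h _ (U.smul_mem (rowSym K T) heU)
    rw [smul_eq_mul] at h1
    rw [mul_assoc, mul_assoc, h1, mul_zero]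
  apply h0
  rw [hUe, this]
  simp

lemma fillingSpecht_ne_bot (hT : Function.Injective T) : FillingSpecht K T ≠ ⊥ := fun h =>
  symmetrizer_ne_zero hT ((Submodule.mem_bot (SymAlgebra K n)).1
    (h.le (Submodule.mem_span_singleton_self _)))

lemma isSimpleModule_fillingSpecht (hn : (n.factorial : K) ≠ 0) (hT : IsFilling T lam) :
    IsSimpleModule (SymAlgebra K n) (FillingSpecht K T) := by
  rw [isSimpleModule_iff_isAtom]
  refine ⟨fillingSpecht_ne_bot hT.injective, fun U hU => ?_⟩
  by_contra h0
  obtain ⟨u, hu, hne⟩ := exists_colSym_mul_ne_zero hn hU.le h0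
  obtain ⟨c, hc⟩ := exists_colSym_mul_eq hn hT (hU.le hu)
  have hc0 : c ≠ 0 := by
    rintro rfl
    exact hne (hc.trans (zero_smul _ _))
  refine hU.not_ge (Submodule.span_le.2 (Set.singleton_subset_iff.2 ?_))
  have h1 : c⁻¹ • (colSym K T * u) ∈ U :=
    U.smul_of_tower_mem c⁻¹ (U.smul_mem (colSym K T) hu)
  rwa [hc, smul_smul, inv_mul_cancel₀ hc0, one_smul] at h1

lemma exists_separates (hn : (n.factorial : K) ≠ 0) (hT : Function.Injective T)
    (e : FillingSpecht K T ≃ₗ[SymAlgebra K n] FillingSpecht K T') :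
    ∃ g, Separates T T' g := by
  obtain ⟨u, hu, hne⟩ := exists_colSym_mul_ne_zero hn le_rfl (fillingSpecht_ne_bot (K := K) hT)
  have h1 : colSym K T • e ⟨u, hu⟩ ≠ 0 := by
    rw [← map_smul]
    intro h
    have := (map_eq_zero_iff e e.injective).1 h
    exact hne (congrArg Subtype.val this)
  have h2 : colSym K T * (e ⟨u, hu⟩).1 ≠ 0 := fun h => h1 (Subtype.ext h)
  obtain ⟨a, ha⟩ := exists_mul_of_mem (e ⟨u, hu⟩).2
  by_contra! h
  apply h2
  have h3 : ∀ b : SymAlgebra K n, colSym K T * b * rowSym K T' = 0 := fun b => by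
    induction b using SymAlgebra.induction with
    | zero => rw [mul_zero, zero_mul]
    | ofPerm g => exact not_not.1 fun hg => h g (separates_of_ne_zero hn hg)
    | add a b ha hb => rw [mul_add, add_mul, ha, hb, add_zero]
    | smul c a ha => rw [mul_smul_comm, smul_mul_assoc, ha, smul_zero]
  rw [ha, ← mul_assoc a, ← mul_assoc, h3]

/-- Specht modules of different shapes are not isomorphic, as each shape would dominate the
other. -/
lemma eq_of_equiv (hn : (n.factorial : K) ≠ 0) (hT : IsFilling T lam) (hT' : IsFilling T' mu)
    (e : FillingSpecht K T ≃ₗ[SymAlgebra K n] FillingSpecht K T') : lam = mu := by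
  obtain ⟨g, hg⟩ := exists_separates hn hT.injective e
  obtain ⟨g', hg'⟩ := exists_separates hn hT'.injective e.symm
  exact eq_of_rowSum_eq fun k =>
    le_antisymm (rowSum_le_of_separates hT' hT hg' k) (rowSum_le_of_separates hT hT' hg k)

lemma IsFilling.exists_comp_eq (hT : IsFilling T lam) (hT' : IsFilling T' lam) :
    ∃ g : Perm (Fin n), T' = T ∘ g := by
  have h : ∀ i, ∃ j, T j = T' i := fun i => (hT.mem_iff _).1 (hT'.mem i)
  choose f hf using h
  have hinj : Function.Injective f := fun i j hij => hT'.injective (by rw [← hf, ← hf, hij])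
  exact ⟨Equiv.ofBijective f (Finite.injective_iff_bijective.1 hinj), funext fun i => (hf i).symm⟩

lemma charSum_conj {χ : Perm (Fin n) →* K} {H H' : Subgroup (Perm (Fin n))} (g : Perm (Fin n))
    (h : ∀ σ, σ ∈ H' ↔ g * σ * g⁻¹ ∈ H) :
    ofPerm K g * charSum χ H' = charSum χ H * ofPerm K g := by
  classical
  rw [charSum, charSum, Finset.mul_sum, Finset.sum_mul]
  refine Finset.sum_equiv (MulAut.conj g).toEquiv (fun σ => ?_) fun σ _ => ?_
  · simp [h]
  · have e : χ (g * σ * g⁻¹) = χ σ := by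
      rw [map_mul, map_mul, mul_right_comm, apply_mul_apply_inv, one_mul]
    simp [MonoidAlgebra.single_mul_single, e]

lemma ofPerm_mul_symmetrizer_comp (T : Fin n → ℕ × ℕ) (g : Perm (Fin n)) :
    ofPerm K g * (colSym K (T ∘ g) * rowSym K (T ∘ g)) =
      colSym K T * rowSym K T * ofPerm K g := by
  rw [← mul_assoc, colSym, rowSym, charSum_conj (H := colGroup T), mul_assoc,
    charSum_conj (H := rowGroup T), ← mul_assoc]
  · rfl
  · intro σ
    constructor
    · intro h i
      simpa using h (g⁻¹ i)
    · intro h i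
      simpa using h (g i)
  · intro σ
    constructor
    · intro h i
      simpa using h (g⁻¹ i)
    · intro h i
      simpa using h (g i)

lemma mul_ofPerm_injective (g : Perm (Fin n)) :
    Function.Injective fun x : SymAlgebra K n => x * ofPerm K g := fun x y h => by
  have := congrArg (· * ofPerm K g⁻¹) h
  simpa only [mul_assoc, ofPerm_mul, mul_inv_cancel, ofPerm_one, mul_one] using this

/-- The Specht module depends on the filling only up to isomorphism. -/
lemma nonempty_fillingSpecht_equiv (hT : IsFilling T lam) (hT' : IsFilling T' lam) :
    Nonempty (FillingSpecht K T ≃ₗ[SymAlgebra K n] FillingSpecht K T') := by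
  obtain ⟨g, rfl⟩ := hT.exists_comp_eq hT'
  let f : SymAlgebra K n →ₗ[SymAlgebra K n] SymAlgebra K n :=
    LinearMap.toSpanSingleton _ _ (ofPerm K g)
  have hf : ∀ x, f x = x * ofPerm K g := fun x => rfl
  have hinj : Function.Injective f := mul_ofPerm_injective g
  have hmap : (FillingSpecht K T).map f = FillingSpecht K (T ∘ g) := by
    rw [FillingSpecht, Submodule.map_span, Set.image_singleton, hf,
      ← ofPerm_mul_symmetrizer_comp]
    refine le_antisymm (Submodule.span_le.2 (Set.singleton_subset_iff.2 ?_))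
      (Submodule.span_le.2 (Set.singleton_subset_iff.2 ?_))
    · exact Submodule.smul_mem _ (ofPerm K g) (Submodule.mem_span_singleton_self _)
    · have := Submodule.smul_mem _ (ofPerm K g⁻¹) (Submodule.mem_span_singleton_self
        (R := SymAlgebra K n) (ofPerm K g * (colSym K (T ∘ g) * rowSym K (T ∘ g))))
      rwa [smul_eq_mul, ← mul_assoc (ofPerm K g⁻¹), ofPerm_mul, inv_mul_cancel, ofPerm_one,
        one_mul] at this
  exact ⟨(Submodule.equivMapOfInjective f hinj _).trans (LinearEquiv.ofEq _ _ hmap)⟩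

end Simple

section Pi

/-- A family of surjections onto pairwise non-isomorphic simple modules is jointly surjective. -/
lemma surjective_pi_of_simple {R : Type u} [Ring R] {M : Type v} [AddCommGroup M] [Module R M]
    {ι : Type w} [Finite ι] {S : ι → Type v'} [∀ i, AddCommGroup (S i)] [∀ i, Module R (S i)]
    [∀ i, IsSimpleModule R (S i)] (hS : ∀ i j, (S i ≃ₗ[R] S j) → i = j)
    (f : ∀ i, M →ₗ[R] S i) (hf : ∀ i, Function.Surjective (f i)) :
    Function.Surjective (LinearMap.pi f) := by
  classical
  have := Fintype.ofFinite ι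
  rw [← LinearMap.range_eq_top]
  by_contra hne
  obtain ⟨C, hC, hle⟩ :=
    (eq_top_or_exists_le_coatom (LinearMap.range (LinearMap.pi f))).resolve_left hne
  have : IsSimpleModule R ((∀ i, S i) ⧸ C) := isSimpleModule_iff_isCoatom.2 hC
  let h : ∀ i, S i →ₗ[R] (∀ i, S i) ⧸ C := fun i => C.mkQ.comp (LinearMap.single R S i)
  have hsum : ∀ x : ∀ i, S i, C.mkQ x = ∑ i, h i (x i) := fun x => by
    conv_lhs => rw [← Finset.univ_sum_single x]
    rw [map_sum]
    rfl
  have hex : ∃ i, h i ≠ 0 := by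
    by_contra! h0
    apply hC.1
    rw [eq_top_iff]
    intro x _
    rw [← Submodule.Quotient.mk_eq_zero, ← Submodule.mkQ_apply, hsum]
    exact Finset.sum_eq_zero fun i _ => by rw [h0 i, LinearMap.zero_apply]
  obtain ⟨i, hi⟩ := hex
  have hother : ∀ j, j ≠ i → h j = 0 := fun j hj => by
    by_contra hj0
    exact hj (hS j i ((LinearEquiv.ofBijective _ (LinearMap.bijective_of_ne_zero hj0)).trans
      (LinearEquiv.ofBijective _ (LinearMap.bijective_of_ne_zero hi)).symm))
  apply hi
  refine LinearMap.ext fun x => ?_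
  obtain ⟨m, rfl⟩ := hf i x
  have h1 : C.mkQ (LinearMap.pi f m) = 0 :=
    (Submodule.Quotient.mk_eq_zero C).2 (hle ⟨m, rfl⟩)
  rw [hsum, Finset.sum_eq_single i] at h1
  · exact h1
  · intro j _ hj
    rw [hother j hj, LinearMap.zero_apply]
  · exact fun h => absurd (Finset.mem_univ _) h

end Pi

/-! ### Branching of Specht modules -/

section Contract

variable {K : Type u} [Field K] {n : ℕ}

/-- A `K`-linear map that commutes with all permutations is linear over the group algebra. -/
def symLinear {M : Type v} [AddCommGroup M] [Module K M] [Module (SymAlgebra K n) M]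
    [IsScalarTower K (SymAlgebra K n) M] {N : Type w} [AddCommGroup N] [Module K N]
    [Module (SymAlgebra K n) N] [IsScalarTower K (SymAlgebra K n) N] (f : M →ₗ[K] N)
    (hf : ∀ (g : Perm (Fin n)) m, f (ofPerm K g • m) = ofPerm K g • f m) :
    M →ₗ[SymAlgebra K n] N :=
  { f with
    map_smul' := by
      intro y m
      induction y using SymAlgebra.induction with
      | zero => simp
      | ofPerm y => exact hf y m
      | add x y hx hy => simpa [add_smul] using congrArg₂ (· + ·) hx hy
      | smul c x hx => simpa [smul_assoc] using congrArg (c • ·) hx }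

open Classical in
/-- The projection of `K 𝔖_{n+1}` onto `K 𝔖_n` that kills all permutations moving the last
point. -/
def contract (K : Type u) [Field K] (n : ℕ) : SymAlgebra K (n + 1) →ₗ[K] SymAlgebra K n :=
  SymAlgebra.lift fun g => if h : ∃ π, permIncl n π = g then ofPerm K h.choose else 0

lemma contract_ofPerm_permIncl (π : Perm (Fin n)) :
    contract K n (ofPerm K (permIncl n π)) = ofPerm K π := by
  have h : ∃ σ, permIncl n σ = permIncl n π := ⟨π, rfl⟩
  rw [contract, SymAlgebra.lift_ofPerm, dif_pos h, permIncl_injective h.choose_spec]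

lemma contract_ofPerm {g : Perm (Fin (n + 1))} (hg : ∀ π, permIncl n π ≠ g) :
    contract K n (ofPerm K g) = 0 := by
  rw [contract, SymAlgebra.lift_ofPerm, dif_neg fun ⟨π, h⟩ => hg π h]

lemma contract_ofPerm_mul (π : Perm (Fin n)) (x : SymAlgebra K (n + 1)) :
    contract K n (ofPerm K (permIncl n π) * x) = ofPerm K π * contract K n x := by
  induction x using SymAlgebra.induction with
  | zero => rw [mul_zero, map_zero, mul_zero]
  | ofPerm g =>
    rw [ofPerm_mul]
    by_cases h : ∃ σ, permIncl n σ = g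
    · obtain ⟨σ, rfl⟩ := h
      rw [← map_mul, contract_ofPerm_permIncl, contract_ofPerm_permIncl, ofPerm_mul]
    · push Not at h
      rw [contract_ofPerm h, contract_ofPerm, mul_zero]
      intro σ hσ
      apply h (π⁻¹ * σ)
      rw [map_mul, hσ, map_inv, inv_mul_cancel_left]
  | add x y hx hy => rw [mul_add, map_add, map_add, mul_add, hx, hy]
  | smul c x hx => rw [mul_smul_comm, map_smul, map_smul, mul_smul_comm, hx]

lemma contract_coeff (x : SymAlgebra K (n + 1)) (h : Perm (Fin n)) :
    (contract K n x).coeff h = x.coeff (permIncl n h) := by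
  induction x using SymAlgebra.induction with
  | zero => rw [map_zero]; rfl
  | ofPerm g =>
    by_cases hg : ∃ σ, permIncl n σ = g
    · obtain ⟨σ, rfl⟩ := hg
      rw [contract_ofPerm_permIncl]
      simp [MonoidAlgebra.coeff_single, Finsupp.single_apply, permIncl_injective.eq_iff]
    · push Not at hg
      rw [contract_ofPerm hg]
      simp [MonoidAlgebra.coeff_single, (hg h).symm]
  | add x y hx hy => rw [map_add, MonoidAlgebra.coeff_add, MonoidAlgebra.coeff_add,
      Finsupp.add_apply, Finsupp.add_apply, hx, hy]
  | smul c x hx => rw [map_smul, MonoidAlgebra.coeff_smul, MonoidAlgebra.coeff_smul,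
      Finsupp.smul_apply, Finsupp.smul_apply, hx]

lemma mem_colGroup_comp_castSucc {T : Fin (n + 1) → ℕ × ℕ} {σ : Perm (Fin n)} :
    σ ∈ colGroup (T ∘ Fin.castSucc) ↔ permIncl n σ ∈ colGroup T := by
  constructor
  · intro h i
    induction i using Fin.lastCases with
    | last => rw [permIncl_last]
    | cast i => rw [permIncl_castSucc]; exact h i
  · intro h i
    have := h i.castSucc
    rwa [permIncl_castSucc] at this

lemma mem_rowGroup_comp_castSucc {T : Fin (n + 1) → ℕ × ℕ} {σ : Perm (Fin n)} :
    σ ∈ rowGroup (T ∘ Fin.castSucc) ↔ permIncl n σ ∈ rowGroup T := by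
  constructor
  · intro h i
    induction i using Fin.lastCases with
    | last => rw [permIncl_last]
    | cast i => rw [permIncl_castSucc]; exact h i
  · intro h i
    have := h i.castSucc
    rwa [permIncl_castSucc] at this

lemma signChar_permIncl (σ : Perm (Fin n)) :
    signChar K (n + 1) (permIncl n σ) = signChar K n σ := by
  have : Equiv.Perm.sign (permIncl n σ) = Equiv.Perm.sign σ := by
    classical
    show Equiv.Perm.sign (Equiv.Perm.viaEmbedding σ _) = _
    unfold Equiv.Perm.viaEmbedding
    convert Equiv.Perm.sign_extendDomain σ _
  simp [signChar, this]

/-- If the product of a column permutation and a row permutation fixes the last point, then both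
do; so contraction turns the Young symmetrizer of a filling into that of its restriction. -/
lemma contract_symmetrizer {T : Fin (n + 1) → ℕ × ℕ} (hT : Function.Injective T) :
    contract K n (colSym K T * rowSym K T) =
      colSym K (T ∘ Fin.castSucc) * rowSym K (T ∘ Fin.castSucc) := by
  classical
  refine MonoidAlgebra.ext (Finsupp.ext fun h => ?_)
  rw [contract_coeff, symmetrizer_coeff, symmetrizer_coeff, Finset.sum_ite, Finset.sum_const_zero,
    add_zero, Finset.sum_ite, Finset.sum_const_zero, add_zero]
  symm
  refine Finset.sum_bij (fun σ _ => permIncl n σ) ?_ ?_ ?_ ?_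
  · intro σ hσ
    simp only [Finset.mem_filter, Finset.mem_univ, true_and] at hσ ⊢
    rw [mem_colGroup_comp_castSucc, mem_rowGroup_comp_castSucc, map_mul, map_inv] at hσ
    exact hσ
  · intro σ _ τ _ e
    exact permIncl_injective e
  · intro σ hσ
    simp only [Finset.mem_filter, Finset.mem_univ, true_and] at hσ
    set x := (σ⁻¹ * permIncl n h) (Fin.last n) with hx
    have hσx : σ x = Fin.last n := by
      rw [hx, ← Equiv.Perm.mul_apply, mul_inv_cancel_left, permIncl_last]
    have hxl : x = Fin.last n := by
      apply hT
      refine Prod.ext (hσ.2 _) ?_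
      rw [← hσ.1 x, hσx]
    rw [hxl] at hσx
    obtain ⟨τ, rfl⟩ := exists_permIncl_eq σ hσx
    refine ⟨τ, ?_, rfl⟩
    simp only [Finset.mem_filter, Finset.mem_univ, true_and]
    rw [mem_colGroup_comp_castSucc, mem_rowGroup_comp_castSucc, map_mul, map_inv]
    exact hσ
  · intro σ _
    exact (signChar_permIncl σ).symm

end Contract

section Branching

variable {K : Type u} [Field K] {n : ℕ} {lam mu : YoungDiagram}

/-- Restriction of scalars is functorial. -/
def Restrict.map {A : Type u} [Ring A] [Algebra K A] {B : Type w} [Ring B] [Algebra K B]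
    (φ : A →ₐ[K] B) {V : Type v} [AddCommGroup V] [Module B V] {W : Type v'} [AddCommGroup W]
    [Module B W] (f : V →ₗ[B] W) : Restrict φ V →ₗ[A] Restrict φ W where
  toFun := f
  map_add' := f.map_add
  map_smul' a v := f.map_smul (φ a) v

lemma exists_surjective_restrict_comp (hn : (n.factorial : K) ≠ 0) {T : Fin (n + 1) → ℕ × ℕ}
    (hT : Function.Injective T) :
    ∃ f : Restrict (symIncl K n) (FillingSpecht K T) →ₗ[SymAlgebra K n]
      FillingSpecht K (T ∘ Fin.castSucc), Function.Surjective f := by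
  have := isSemisimpleModule_symAlgebra hn (SymAlgebra K n)
  obtain ⟨h, hh⟩ := IsSemisimpleModule.extension_property
    (FillingSpecht K (T ∘ Fin.castSucc)).subtype Subtype.val_injective LinearMap.id
  let c : Restrict (symIncl K n) (FillingSpecht K T) →ₗ[SymAlgebra K n] SymAlgebra K n :=
    symLinear (((contract K n).comp ((FillingSpecht K T).subtype.restrictScalars K)).comp
      (restrictEquiv (symIncl K n) (FillingSpecht K T)).toLinearMap) (by
        intro g m
        have e : restrictEquiv (symIncl K n) (FillingSpecht K T) (ofPerm K g • m) =
            ofPerm K (permIncl n g) • restrictEquiv (symIncl K n) (FillingSpecht K T) m := by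
          rw [restrictEquiv_smul, symIncl_ofPerm]
        show contract K n (restrictEquiv (symIncl K n) (FillingSpecht K T) (ofPerm K g • m)).1 = _
        rw [e]
        exact contract_ofPerm_mul g _)
  refine ⟨h.comp c, ?_⟩
  rw [← LinearMap.range_eq_top, eq_top_iff]
  rintro ⟨x, hx⟩ -
  obtain ⟨a, ha⟩ := Submodule.mem_span_singleton.1 hx
  let y : FillingSpecht K T := ⟨colSym K T * rowSym K T, Submodule.mem_span_singleton_self _⟩
  refine ⟨a • (restrictEquiv (symIncl K n) (FillingSpecht K T)).symm y, ?_⟩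
  have h1 : c ((restrictEquiv (symIncl K n) (FillingSpecht K T)).symm y) =
      colSym K (T ∘ Fin.castSucc) * rowSym K (T ∘ Fin.castSucc) := contract_symmetrizer hT
  rw [map_smul, LinearMap.comp_apply, h1]
  have h2 := LinearMap.congr_fun hh ⟨colSym K (T ∘ Fin.castSucc) * rowSym K (T ∘ Fin.castSucc),
    Submodule.mem_span_singleton_self _⟩
  refine (congrArg (a • ·) h2).trans (Subtype.ext ha)

lemma AddCell.exists_isFilling_snoc {S : Fin n → ℕ × ℕ} (h : AddCell mu lam)
    (hS : IsFilling S mu) :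
    ∃ T : Fin (n + 1) → ℕ × ℕ, IsFilling T lam ∧ T ∘ Fin.castSucc = S := by
  obtain ⟨c, hc, hlam⟩ := h
  refine ⟨Fin.snoc S c, ⟨?_, fun d => ?_⟩, ?_⟩
  · rw [Fin.snoc_injective_iff]
    refine ⟨hS.injective, ?_⟩
    rintro ⟨i, rfl⟩
    exact hc (hS.mem i)
  · rw [← YoungDiagram.mem_cells, hlam, Finset.mem_insert, YoungDiagram.mem_cells, hS.mem_iff]
    constructor
    · rintro (rfl | ⟨i, rfl⟩)
      · exact ⟨Fin.last n, Fin.snoc_last _ _⟩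
      · exact ⟨i.castSucc, Fin.snoc_castSucc _ _ _⟩
    · rintro ⟨i, rfl⟩
      induction i using Fin.lastCases with
      | last => exact Or.inl (Fin.snoc_last _ _)
      | cast i => exact Or.inr ⟨i, (Fin.snoc_castSucc (α := fun _ => ℕ × ℕ) c S i).symm⟩
  · funext i
    exact Fin.snoc_castSucc _ _ _

lemma AddCell.exists_surjective_restrict (hn : (n.factorial : K) ≠ 0)
    {T : Fin (n + 1) → ℕ × ℕ} {S : Fin n → ℕ × ℕ} (h : AddCell mu lam) (hT : IsFilling T lam)
    (hS : IsFilling S mu) :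
    ∃ f : Restrict (symIncl K n) (FillingSpecht K T) →ₗ[SymAlgebra K n] FillingSpecht K S,
      Function.Surjective f := by
  obtain ⟨T', hT', rfl⟩ := h.exists_isFilling_snoc hS
  obtain ⟨e⟩ := nonempty_fillingSpecht_equiv (K := K) hT hT'
  obtain ⟨f, hf⟩ := exists_surjective_restrict_comp hn hT'.injective
  exact ⟨f.comp (Restrict.map (symIncl K n) e.toLinearMap), hf.comp e.surjective⟩

/-- The restriction of a Specht module maps onto the sum of the Specht modules for the diagrams
with one cell less. -/
lemma exists_surjective_restrict_pi (hn : (n.factorial : K) ≠ 0) {T : Fin (n + 1) → ℕ × ℕ}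
    (hT : IsFilling T lam) {S : Down lam → Fin n → ℕ × ℕ} (hS : ∀ mu, IsFilling (S mu) mu.1) :
    ∃ f : Restrict (symIncl K n) (FillingSpecht K T) →ₗ[SymAlgebra K n]
      (∀ mu, FillingSpecht K (S mu)), Function.Surjective f := by
  have := fun mu => isSimpleModule_fillingSpecht hn (hS mu)
  choose f hf using fun mu : Down lam => mu.2.exists_surjective_restrict hn hT (hS mu)
  exact ⟨LinearMap.pi f, surjective_pi_of_simple
    (fun i j e => Subtype.ext (eq_of_equiv hn (hS i) (hS j) e)) f hf⟩

/-- By Frobenius reciprocity, a splitting of the map from the restriction gives a nonzero map from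
the induced module. -/
lemma AddCell.exists_surjective_induced (hn : ((n + 1).factorial : K) ≠ 0)
    {T : Fin n → ℕ × ℕ} {S : Fin (n + 1) → ℕ × ℕ} (h : AddCell lam mu) (hT : IsFilling T lam)
    (hS : IsFilling S mu) :
    ∃ f : Induced K n (FillingSpecht K T) →ₗ[SymAlgebra K (n + 1)] FillingSpecht K S,
      Function.Surjective f := by
  have hn' : (n.factorial : K) ≠ 0 := fun h => hn (by
    rw [Nat.factorial_succ, Nat.cast_mul, h, mul_zero])
  obtain ⟨q, hq⟩ := h.exists_surjective_restrict hn' hS hT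
  have := isSemisimpleModule_symAlgebra hn' (Restrict (symIncl K n) (FillingSpecht K S))
  obtain ⟨s, hs⟩ := IsSemisimpleModule.lifting_property q hq LinearMap.id
  let s' : FillingSpecht K T →ₗ[K] FillingSpecht K S :=
    (restrictEquiv (symIncl K n) (FillingSpecht K S)).toLinearMap.comp (s.restrictScalars K)
  have hs' : ∀ π v, s' (ofPerm K π • v) = ofPerm K (permIncl n π) • s' v := fun π v => by
    show restrictEquiv (symIncl K n) (FillingSpecht K S) (s (ofPerm K π • v)) = _
    rw [s.map_smul, restrictEquiv_smul, symIncl_ofPerm]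
    rfl
  let F : Induced K n (FillingSpecht K T) →ₗ[K] FillingSpecht K S :=
    Induced.lift (fun g => (Algebra.lsmul K K _ (ofPerm K g)).comp s') (by
      intro g π v
      show ofPerm K (g * permIncl n π) • s' v = ofPerm K g • s' (ofPerm K π • v)
      rw [hs', ← ofPerm_mul, mul_smul])
  have hF : ∀ g v, F (Induced.mk g v) = ofPerm K g • s' v := fun g v => Induced.lift_mk _ _ g v
  let F' : Induced K n (FillingSpecht K T) →ₗ[SymAlgebra K (n + 1)] FillingSpecht K S :=
    symLinear F (by
      intro g z
      refine map_eq_of_generators Induced.closure_range_mk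
        (F.toAddMonoidHom.comp (DistribSMul.toAddMonoidHom _ (ofPerm K g)))
        ((DistribSMul.toAddMonoidHom _ (ofPerm K g)).comp F.toAddMonoidHom) ?_ z
      rintro ⟨h, v⟩
      show F (ofPerm K g • Induced.mk h v) = ofPerm K g • F (Induced.mk h v)
      rw [Induced.ofPerm_smul_mk, hF, hF, smul_smul, ofPerm_mul])
  have := isSimpleModule_fillingSpecht hn hS
  refine ⟨F', LinearMap.surjective_of_ne_zero fun h0 => ?_⟩
  let y : FillingSpecht K T := ⟨colSym K T * rowSym K T, Submodule.mem_span_singleton_self _⟩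
  have h1 : F (Induced.mk 1 y) = 0 := LinearMap.congr_fun h0 (Induced.mk 1 y)
  rw [hF, ofPerm_one, one_smul] at h1
  have h2 : s y = 0 := h1
  have h3 : q (s y) = y := LinearMap.congr_fun hs y
  rw [h2, map_zero] at h3
  exact symmetrizer_ne_zero (K := K) hT.injective (congrArg Subtype.val h3).symm

lemma exists_surjective_induced_pi (hn : ((n + 1).factorial : K) ≠ 0) {T : Fin n → ℕ × ℕ}
    (hT : IsFilling T lam) {S : Up lam → Fin (n + 1) → ℕ × ℕ} (hS : ∀ mu, IsFilling (S mu) mu.1) :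
    ∃ f : Induced K n (FillingSpecht K T) →ₗ[SymAlgebra K (n + 1)]
      (∀ mu, FillingSpecht K (S mu)), Function.Surjective f := by
  have := fun mu => isSimpleModule_fillingSpecht hn (hS mu)
  choose f hf using fun mu : Up lam => mu.2.exists_surjective_induced hn hT (hS mu)
  exact ⟨LinearMap.pi f, surjective_pi_of_simple
    (fun i j e => Subtype.ext (eq_of_equiv hn (hS i) (hS j) e)) f hf⟩

end Branching

/-! ### Dimensions of Specht modules and the branching rules -/

section Rank

/-- Reducing a family of integral vectors modulo the characteristic of a field does not increase
its rank, as a relation over `ℚ` can be scaled to a relation with coprime integral coefficients. -/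
lemma finrank_span_intCast_le (K : Type u) [Field K] {ι : Type v} {κ : Type w} [Finite ι]
    (b : ι → κ → ℤ) :
    Module.finrank K (Submodule.span K (Set.range fun i k => (b i k : K))) ≤
      Module.finrank ℚ (Submodule.span ℚ (Set.range fun i k => (b i k : ℚ))) := by
  obtain ⟨J, a, ha, hspan, hli⟩ := exists_linearIndependent' K fun i k => (b i k : K)
  have := Finite.of_injective a ha
  have := Fintype.ofFinite J
  have hliQ : LinearIndependent ℚ ((fun i k => (b i k : ℚ)) ∘ a) := by
    rw [← LinearIndependent.iff_fractionRing ℤ ℚ, linearIndependent_iff']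
    intro s g hg i hi
    by_contra hgi
    obtain ⟨g', hg', hgcd⟩ := Finset.extract_gcd g ⟨i, hi⟩
    have hd : s.gcd g ≠ 0 := fun h => hgi (Finset.gcd_eq_zero_iff.1 h i hi)
    have h1 : ∀ k, ∑ j ∈ s, g' j * b (a j) k = 0 := fun k => by
      have h2 : ((∑ j ∈ s, g j * b (a j) k : ℤ) : ℚ) = 0 := by
        have := congrFun hg k
        simpa [Finset.sum_apply] using this
      have h3 : ∑ j ∈ s, g j * b (a j) k = s.gcd g * ∑ j ∈ s, g' j * b (a j) k := by
        rw [Finset.mul_sum]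
        exact Finset.sum_congr rfl fun j hj => by rw [hg' j hj, mul_assoc]
      rw [h3] at h2
      exact (mul_eq_zero.1 (Int.cast_eq_zero.1 h2)).resolve_left hd
    have h4 : ∀ j ∈ s, (g' j : K) = 0 := by
      refine linearIndependent_iff'.1 hli s (fun j => (g' j : K)) ?_
      funext k
      have := congrArg (Int.cast : ℤ → K) (h1 k)
      simpa [Finset.sum_apply] using this
    obtain ⟨p, hp⟩ := CharP.exists K
    -- The characteristic divides all coefficients, which are coprime.
    have h5 : (p : ℤ) ∣ 1 := by
      rw [← hgcd]
      exact Finset.dvd_gcd fun j hj => (CharP.intCast_eq_zero_iff K p _).1 (h4 j hj)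
    have h6 := (CharP.intCast_eq_zero_iff K p 1).2 h5
    rw [Int.cast_one] at h6
    exact one_ne_zero h6
  have : Module.Finite ℚ (Submodule.span ℚ (Set.range fun i k => (b i k : ℚ))) :=
    Module.Finite.span_of_finite ℚ (Set.finite_range _)
  rw [← hspan, finrank_span_eq_card hli, ← finrank_span_eq_card hliQ]
  exact Submodule.finrank_mono (Submodule.span_mono (Set.range_comp_subset_range _ _))

end Rank

section Dimension

variable (K : Type u) [Field K] {n : ℕ} {lam mu : YoungDiagram}

/-- The dimension of a Specht module. -/
def spechtDim (lam : YoungDiagram) : ℕ := Module.finrank K (Specht K lam)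

instance (T : Fin n → ℕ × ℕ) : Module.Finite K (FillingSpecht K T) :=
  FiniteDimensional.of_injective ((FillingSpecht K T).subtype.restrictScalars K)
    Subtype.val_injective

variable {T : Fin n → ℕ × ℕ}

lemma finrank_fillingSpecht (hT : IsFilling T lam) :
    Module.finrank K (FillingSpecht K T) = spechtDim K lam := by
  obtain rfl := hT.card_eq
  obtain ⟨e⟩ := nonempty_fillingSpecht_equiv (K := K) hT (isFilling_filling lam)
  rw [spechtDim, specht_eq]
  exact (e.restrictScalars K).finrank_eq

open Classical in
/-- The coefficients of the permutation `g` times the Young symmetrizer. -/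
def integralVector (T : Fin n → ℕ × ℕ) (g h : Perm (Fin n)) : ℤ :=
  ∑ σ : Perm (Fin n) with σ ∈ colGroup T,
    if σ⁻¹ * (g⁻¹ * h) ∈ rowGroup T then (Equiv.Perm.sign σ : ℤ) else 0

lemma integralVector_cast (g h : Perm (Fin n)) : ((integralVector T g h : ℤ) : K) =
    (ofPerm K g * (colSym K T * rowSym K T)).coeff h := by
  classical
  rw [MonoidAlgebra.coeff_single_mul_apply, one_mul, symmetrizer_coeff, integralVector,
    Int.cast_sum]
  refine Finset.sum_congr rfl fun σ _ => ?_
  rw [Int.cast_ite, Int.cast_zero]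
  rfl

lemma finrank_fillingSpecht_eq (T : Fin n → ℕ × ℕ) : Module.finrank K (FillingSpecht K T) =
    Module.finrank K (Submodule.span K (Set.range fun g h => (integralVector T g h : K))) := by
  let Φ : SymAlgebra K n →ₗ[K] Perm (Fin n) → K :=
    (Finsupp.lcoeFun).comp (MonoidAlgebra.coeffLinearEquiv K).toLinearMap
  have hΦ : Function.Injective Φ :=
    DFunLike.coe_injective.comp (MonoidAlgebra.coeffLinearEquiv K).injective
  have h1 : (FillingSpecht K T).restrictScalars K =
      Submodule.span K (Set.range fun g => ofPerm K g * (colSym K T * rowSym K T)) := by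
    apply le_antisymm
    · intro x hx
      obtain ⟨a, rfl⟩ := exists_mul_of_mem hx
      clear hx
      induction a using SymAlgebra.induction with
      | zero => rw [zero_mul]; exact Submodule.zero_mem _
      | ofPerm g => exact Submodule.subset_span ⟨g, rfl⟩
      | add x y hx hy => rw [add_mul]; exact Submodule.add_mem _ hx hy
      | smul c x hx => rw [smul_mul_assoc]; exact Submodule.smul_mem _ _ hx
    · rw [Submodule.span_le]
      rintro _ ⟨g, rfl⟩
      exact (FillingSpecht K T).smul_mem (ofPerm K g) (Submodule.mem_span_singleton_self _)
  have h2 : ((FillingSpecht K T).restrictScalars K).map Φ =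
      Submodule.span K (Set.range fun g h => (integralVector T g h : K)) := by
    rw [h1, Submodule.map_span, ← Set.range_comp]
    congr 2
    funext g h
    exact (integralVector_cast K g h).symm
  rw [← h2]
  exact (Submodule.equivMapOfInjective Φ hΦ ((FillingSpecht K T).restrictScalars K)).finrank_eq

lemma spechtDim_le_rat (lam : YoungDiagram) : spechtDim K lam ≤ spechtDim ℚ lam := by
  have hT := isFilling_filling lam
  rw [← finrank_fillingSpecht K hT, ← finrank_fillingSpecht ℚ hT, finrank_fillingSpecht_eq,
    finrank_fillingSpecht_eq]
  exact finrank_span_intCast_le K _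

lemma spechtDim_pos (lam : YoungDiagram) : 0 < spechtDim K lam := by
  have hT := isFilling_filling lam
  rw [← finrank_fillingSpecht K hT, Module.finrank_pos_iff, Submodule.nontrivial_iff_ne_bot]
  exact fillingSpecht_ne_bot hT.injective

lemma spechtDim_of_card_eq_zero (h : lam.card = 0) : spechtDim K lam = 1 := by
  refine le_antisymm ?_ (spechtDim_pos K lam)
  obtain ⟨T, hT⟩ := exists_isFilling h
  rw [← finrank_fillingSpecht K hT]
  refine (LinearMap.finrank_le_finrank_of_injective
    (f := (FillingSpecht K T).subtype.restrictScalars K) Subtype.val_injective).trans ?_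
  rw [(MonoidAlgebra.coeffLinearEquiv K).finrank_eq, Module.finrank_finsupp_self,
    Fintype.card_perm, Fintype.card_fin, Nat.factorial_zero]

/-- The induced module is spanned by the translates of `V` under the coset representatives
`(i, n+1)`. -/
lemma finrank_induced_le (V : Type v) [AddCommGroup V] [Module K V] [Module (SymAlgebra K n) V]
    [Module.Finite K V] :
    Module.Finite K (Induced K n V) ∧
      Module.finrank K (Induced K n V) ≤ (n + 1) * Module.finrank K V := by
  let f : (Fin (n + 1) → V) →ₗ[K] Induced K n V :=
    ∑ i, (Induced.mk (Equiv.swap i (Fin.last n))).comp (LinearMap.proj i)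
  have hf : ∀ i v, f (Pi.single i v) = Induced.mk (Equiv.swap i (Fin.last n)) v := fun i v => by
    rw [LinearMap.sum_apply, Finset.sum_eq_single i]
    · rw [LinearMap.comp_apply, LinearMap.proj_apply, Pi.single_eq_same]
    · intro j _ hj
      rw [LinearMap.comp_apply, LinearMap.proj_apply, Pi.single_eq_of_ne hj, map_zero]
    · exact fun h => absurd (Finset.mem_univ _) h
  have hsurj : Function.Surjective f := by
    refine surjective_of_generators Induced.closure_range_mk f.toAddMonoidHom ?_
    rintro ⟨g, v⟩
    set s := Equiv.swap (g (Fin.last n)) (Fin.last n) with hs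
    obtain ⟨π, hπ⟩ := exists_permIncl_eq (s⁻¹ * g) (by
      rw [Equiv.Perm.mul_apply, hs, Equiv.swap_inv, Equiv.swap_apply_left])
    refine ⟨Pi.single (g (Fin.last n)) (ofPerm K π • v), (hf _ _).trans ?_⟩
    rw [← Induced.mk_mul_permIncl, hπ, mul_inv_cancel_left]
  refine ⟨Module.Finite.of_surjective f hsurj, ?_⟩
  refine (LinearMap.finrank_le_finrank_of_surjective hsurj).trans ?_
  rw [Module.finrank_pi_fintype, Finset.sum_const, Finset.card_univ, Fintype.card_fin, smul_eq_mul]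

lemma Down.card {lam : YoungDiagram} (h : lam.card = n + 1) (mu : Down lam) : mu.1.card = n := by
  have := mu.2.card
  omega

variable {K}

lemma factorial_ne_zero_of_le {m N : ℕ} (hN : (N.factorial : K) ≠ 0) (h : m ≤ N) :
    (m.factorial : K) ≠ 0 := fun h0 => hN (by
  obtain ⟨k, hk⟩ := Nat.factorial_dvd_factorial h
  rw [hk, Nat.cast_mul, h0, zero_mul])

lemma sum_down_le (hn : (n.factorial : K) ≠ 0) (h : lam.card = n + 1) :
    ∑ mu : Down lam, spechtDim K mu.1 ≤ spechtDim K lam := by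
  obtain ⟨T, hT⟩ := exists_isFilling h
  choose S hS using fun mu : Down lam => exists_isFilling (Down.card h mu)
  obtain ⟨f, hf⟩ := exists_surjective_restrict_pi hn hT hS
  have := Module.Finite.equiv (restrictEquiv (symIncl K n) (FillingSpecht K T)).symm
  have h1 := LinearMap.finrank_le_finrank_of_surjective (f := f.restrictScalars K) hf
  rw [Module.finrank_pi_fintype, (restrictEquiv (symIncl K n) (FillingSpecht K T)).finrank_eq,
    finrank_fillingSpecht K hT] at h1
  exact (Finset.sum_congr rfl fun mu _ => (finrank_fillingSpecht K (hS mu)).symm).trans_le h1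

lemma sum_up_le (hn : ((n + 1).factorial : K) ≠ 0) (h : lam.card = n) :
    ∑ mu : Up lam, spechtDim K mu.1 ≤ (n + 1) * spechtDim K lam := by
  obtain ⟨T, hT⟩ := exists_isFilling h
  choose S hS using fun mu : Up lam => exists_isFilling (mu.2.card.trans (congrArg (· + 1) h))
  obtain ⟨f, hf⟩ := exists_surjective_induced_pi hn hT hS
  obtain ⟨hfin, hle⟩ := finrank_induced_le K (n := n) (FillingSpecht K T)
  have h1 := LinearMap.finrank_le_finrank_of_surjective (f := f.restrictScalars K) hf
  rw [Module.finrank_pi_fintype] at h1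
  rw [finrank_fillingSpecht K hT] at hle
  exact (Finset.sum_congr rfl fun mu _ => (finrank_fillingSpecht K (hS mu)).symm).trans_le
    (h1.trans hle)

lemma sum_down_le_of_card_le {N : ℕ} (hN : (N.factorial : K) ≠ 0) (lam : YoungDiagram)
    (h : lam.card ≤ N) : ∑ mu : Down lam, spechtDim K mu.1 ≤ spechtDim K lam := by
  cases hc : lam.card with
  | zero =>
    have : IsEmpty (Down lam) := ⟨fun mu => by
      have := mu.2.card
      omega⟩
    rw [Fintype.sum_empty]
    exact Nat.zero_le _
  | succ n => exact sum_down_le (factorial_ne_zero_of_le hN (by omega)) hc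

lemma sum_up_le_of_card_lt {N : ℕ} (hN : (N.factorial : K) ≠ 0) (lam : YoungDiagram)
    (h : lam.card < N) : ∑ mu : Up lam, spechtDim K mu.1 ≤ (lam.card + 1) * spechtDim K lam :=
  sum_up_le (factorial_ne_zero_of_le hN h) rfl

lemma sum_down_eq {N : ℕ} (hN : (N.factorial : K) ≠ 0) (h : lam.card ≤ N) (h0 : lam.card ≠ 0) :
    ∑ mu : Down lam, spechtDim K mu.1 = spechtDim K lam :=
  sum_down_eq_of_le (sum_down_le_of_card_le hN) (sum_up_le_of_card_lt hN) lam h h0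

lemma sum_up_eq (hn : ((n + 1).factorial : K) ≠ 0) (h : lam.card = n) :
    ∑ mu : Up lam, spechtDim K mu.1 = (n + 1) * spechtDim K lam :=
  (sum_up_eq_of_le (sum_down_le_of_card_le hn) (sum_up_le_of_card_lt hn) n n.lt_succ_self lam h).1

lemma sum_down_rat (h0 : lam.card ≠ 0) :
    ∑ mu : Down lam, spechtDim ℚ mu.1 = spechtDim ℚ lam :=
  sum_down_eq (N := lam.card) (Nat.cast_ne_zero.2 (Nat.factorial_ne_zero _)) le_rfl h0

lemma spechtDim_eq_rat (hn : (n.factorial : K) ≠ 0) (h : lam.card = n) :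
    spechtDim K lam = spechtDim ℚ lam := by
  induction n generalizing lam with
  | zero => rw [spechtDim_of_card_eq_zero K h, spechtDim_of_card_eq_zero ℚ h]
  | succ n ih =>
    rw [← sum_down_rat (by omega), ← sum_down_eq hn h.le (by omega)]
    exact Finset.sum_congr rfl fun mu _ =>
      ih (factorial_ne_zero_of_le hn n.le_succ) (Down.card h mu)

/-- The branching rule for restriction. It only needs that `n!` is invertible, where `n + 1` is the
size of the diagram: the dimension of a Specht module is at most the dimension in characteristic
zero. -/
lemma nonempty_restrict_equiv_pi (hn : (n.factorial : K) ≠ 0) {T : Fin (n + 1) → ℕ × ℕ}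
    (hT : IsFilling T lam) {S : Down lam → Fin n → ℕ × ℕ} (hS : ∀ mu, IsFilling (S mu) mu.1) :
    Nonempty (Restrict (symIncl K n) (FillingSpecht K T) ≃ₗ[SymAlgebra K n]
      ∀ mu, FillingSpecht K (S mu)) := by
  obtain ⟨f, hf⟩ := exists_surjective_restrict_pi hn hT hS
  have := Module.Finite.equiv (restrictEquiv (symIncl K n) (FillingSpecht K T)).symm
  have hle : Module.finrank K (Restrict (symIncl K n) (FillingSpecht K T)) ≤
      Module.finrank K (∀ mu, FillingSpecht K (S mu)) := by
    rw [Module.finrank_pi_fintype, (restrictEquiv (symIncl K n) (FillingSpecht K T)).finrank_eq,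
      finrank_fillingSpecht K hT]
    refine (spechtDim_le_rat K lam).trans ?_
    rw [← sum_down_rat (by rw [hT.card_eq]; omega)]
    exact (Finset.sum_congr rfl fun mu _ => (spechtDim_eq_rat hn (hS mu).card_eq).symm.trans
      (finrank_fillingSpecht K (hS mu)).symm).le
  exact ⟨LinearEquiv.ofBijective f
    (OrzechProperty.bijective_of_surjective_of_finrank_le (f := f.restrictScalars K) hf hle)⟩

/-- The branching rule for induction. -/
lemma nonempty_induced_equiv_pi (hn : ((n + 1).factorial : K) ≠ 0) {T : Fin n → ℕ × ℕ}
    (hT : IsFilling T lam) {S : Up lam → Fin (n + 1) → ℕ × ℕ} (hS : ∀ mu, IsFilling (S mu) mu.1) :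
    Nonempty (Induced K n (FillingSpecht K T) ≃ₗ[SymAlgebra K (n + 1)]
      ∀ mu, FillingSpecht K (S mu)) := by
  obtain ⟨f, hf⟩ := exists_surjective_induced_pi hn hT hS
  obtain ⟨hfin, hle⟩ := finrank_induced_le K (n := n) (FillingSpecht K T)
  have hle' : Module.finrank K (Induced K n (FillingSpecht K T)) ≤
      Module.finrank K (∀ mu, FillingSpecht K (S mu)) := by
    refine hle.trans ?_
    rw [finrank_fillingSpecht K hT, Module.finrank_pi_fintype, ← sum_up_eq hn hT.card_eq]
    exact (Finset.sum_congr rfl fun mu _ => (finrank_fillingSpecht K (hS mu)).symm).le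
  exact ⟨LinearEquiv.ofBijective f
    (OrzechProperty.bijective_of_surjective_of_finrank_le (f := f.restrictScalars K) hf hle')⟩

end Dimension

/-! ### Semisimplicity of the Brauer algebra forces `r!` to be invertible -/

section Trivial

variable {K : Type u} [Field K] {δ : K} {r : ℕ}

open Classical in
/-- The trivial character of `D_r`: permutations act as one, all other diagrams as zero. -/
def trivialLinear (δ : K) (r : ℕ) : BrauerAlgebra δ r →ₗ[K] K :=
  DiagHom.lift δ fun x : Diagram r r => if x.TopArc then 0 else 1

open Classical in
lemma trivialLinear_ofDiag (x : Diagram r r) :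
    trivialLinear δ r (ofDiag δ x) = if x.TopArc then 0 else 1 := DiagHom.lift_of _ x

lemma trivialLinear_permDiagram (π : Perm (Fin r)) :
    trivialLinear δ r (ofDiag δ (permDiagram π)) = 1 := by
  rw [trivialLinear_ofDiag, if_neg (Diagram.not_topArc_permDiagram π)]

lemma trivialLinear_ofDiag_mul_ofDiag (y x : Diagram r r) :
    trivialLinear δ r (ofDiag δ y * ofDiag δ x) =
      trivialLinear δ r (ofDiag δ y) * trivialLinear δ r (ofDiag δ x) := by
  rw [ofDiag_mul_ofDiag, (trivialLinear δ r).map_smul, smul_eq_mul]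
  by_cases hx : x.TopArc
  · rw [trivialLinear_ofDiag (x.comp y), trivialLinear_ofDiag x, if_pos hx, if_pos (hx.comp y),
      mul_zero, mul_zero]
  · obtain ⟨π, rfl⟩ := Diagram.exists_eq_permDiagram hx
    rw [permDiagram_loops, pow_zero, one_mul, trivialLinear_permDiagram, mul_one,
      trivialLinear_ofDiag, trivialLinear_ofDiag, Diagram.topArc_permDiagram_comp]

lemma trivialLinear_mul (y x : BrauerAlgebra δ r) :
    trivialLinear δ r (y * x) = trivialLinear δ r y * trivialLinear δ r x := by
  induction y using BrauerAlgebra.induction with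
  | zero => rw [zero_mul, (trivialLinear δ r).map_zero, zero_mul]
  | of y =>
    change trivialLinear δ r (ofDiag δ y * x) =
      trivialLinear δ r (ofDiag δ y) * trivialLinear δ r x
    induction x using BrauerAlgebra.induction with
    | zero => rw [mul_zero, (trivialLinear δ r).map_zero, mul_zero]
    | of x => exact trivialLinear_ofDiag_mul_ofDiag y x
    | add a b ha hb =>
      rw [mul_add, (trivialLinear δ r).map_add, (trivialLinear δ r).map_add, ha, hb, mul_add]
    | smul c a ha =>
      rw [mul_smul_comm, (trivialLinear δ r).map_smul, (trivialLinear δ r).map_smul, ha,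
        smul_eq_mul, smul_eq_mul, mul_left_comm]
  | add a b ha hb =>
    rw [add_mul, (trivialLinear δ r).map_add, (trivialLinear δ r).map_add, ha, hb, add_mul]
  | smul c a ha =>
    rw [smul_mul_assoc, (trivialLinear δ r).map_smul, (trivialLinear δ r).map_smul, ha,
      smul_eq_mul, smul_eq_mul, mul_assoc]

open Classical in
/-- The coefficient of the identity diagram. -/
def idCoeff (δ : K) (r : ℕ) : BrauerAlgebra δ r →ₗ[K] K :=
  DiagHom.lift δ fun x : Diagram r r => if x = permDiagram 1 then 1 else 0

open Classical in
lemma idCoeff_ofDiag (x : Diagram r r) :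
    idCoeff δ r (ofDiag δ x) = if x = permDiagram 1 then 1 else 0 := DiagHom.lift_of _ x

lemma permDiagram_injective : Function.Injective (permDiagram (r := r)) := fun π σ h => by
  refine Equiv.ext fun i => ?_
  have h1 : (permDiagram π).rel (Sum.inl i) (Sum.inr (π i)) := rfl
  rw [h] at h1
  exact h1.symm

lemma sum_idCoeff (y : BrauerAlgebra δ r) :
    ∑ g : Perm (Fin r), idCoeff δ r (ofDiag δ (permDiagram g) * y) = trivialLinear δ r y := by
  induction y using BrauerAlgebra.induction with
  | zero => simp only [mul_zero, (idCoeff δ r).map_zero, (trivialLinear δ r).map_zero,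
      Finset.sum_const_zero]
  | of x =>
    change ∑ g : Perm (Fin r), idCoeff δ r (ofDiag δ (permDiagram g) * ofDiag δ x) =
      trivialLinear δ r (ofDiag δ x)
    have h : ∀ g : Perm (Fin r), ofDiag δ (permDiagram g) * ofDiag δ x =
        ofDiag δ (x.comp (permDiagram g)) := fun g => by
      rw [ofDiag_mul_ofDiag, loops_permDiagram, pow_zero, one_smul]
    simp only [h, idCoeff_ofDiag]
    by_cases hx : x.TopArc
    · rw [trivialLinear_ofDiag, if_pos hx]
      refine Finset.sum_eq_zero fun g _ => if_neg fun e => ?_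
      exact Diagram.not_topArc_permDiagram 1 (e ▸ hx.comp (permDiagram g))
    · obtain ⟨π, rfl⟩ := Diagram.exists_eq_permDiagram hx
      simp only [permDiagram_comp, trivialLinear_permDiagram, permDiagram_injective.eq_iff,
        mul_eq_one_iff_eq_inv, Finset.sum_ite_eq', Finset.mem_univ, if_true]
  | add a b ha hb =>
    simp only [mul_add, (idCoeff δ r).map_add, (trivialLinear δ r).map_add, Finset.sum_add_distrib,
      ha, hb]
  | smul c a ha =>
    simp only [mul_smul_comm, (idCoeff δ r).map_smul, (trivialLinear δ r).map_smul,
      ← Finset.smul_sum, ha]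

/-- If `D_r` is semisimple, the kernel of the trivial character has a complement, which contains an
element on which `D_r` acts by the trivial character and whose character value is one. The
coefficients of this element at the permutations all agree, so `r!` times their common value is
one. -/
theorem factorial_ne_zero_of_isSemisimpleRing (h : IsSemisimpleRing (BrauerAlgebra δ r)) :
    (r.factorial : K) ≠ 0 := by
  let I : Ideal (BrauerAlgebra δ r) :=
    { carrier := {y | trivialLinear δ r y = 0}
      add_mem' := fun {a b} ha hb => by
        show trivialLinear δ r (a + b) = 0
        rw [(trivialLinear δ r).map_add, ha, hb, add_zero]
      zero_mem' := (trivialLinear δ r).map_zero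
      smul_mem' := fun c x hx => by
        show trivialLinear δ r (c * x) = 0
        rw [trivialLinear_mul, hx, mul_zero] }
  obtain ⟨J, hIJ⟩ := exists_isCompl I
  have h1 : (1 : BrauerAlgebra δ r) ∈ I ⊔ J := hIJ.sup_eq_top ▸ Submodule.mem_top
  obtain ⟨i, hi, j, hj, hij⟩ := Submodule.mem_sup.1 h1
  have hone : trivialLinear δ r 1 = 1 := trivialLinear_permDiagram (δ := δ) 1
  have hεj : trivialLinear δ r j = 1 := by
    rw [← hone, ← hij, (trivialLinear δ r).map_add, show trivialLinear δ r i = 0 from hi, zero_add]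
  have hfix : ∀ g : Perm (Fin r), ofDiag δ (permDiagram g) * j = j := fun g => by
    have hI : ofDiag δ (permDiagram g) * j - j ∈ I := by
      show trivialLinear δ r _ = 0
      rw [(trivialLinear δ r).map_sub, trivialLinear_mul, trivialLinear_permDiagram, one_mul,
        sub_self]
    have hJ : ofDiag δ (permDiagram g) * j - j ∈ J := J.sub_mem (J.smul_mem _ hj) hj
    exact sub_eq_zero.1 (Submodule.disjoint_def.1 hIJ.disjoint _ hI hJ)
  have hsum := sum_idCoeff j
  simp only [hfix, hεj, Finset.sum_const, Finset.card_univ, Fintype.card_perm, Fintype.card_fin,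
    nsmul_eq_mul] at hsum
  intro h0
  rw [h0, zero_mul] at hsum
  exact zero_ne_one hsum

end Trivial

/-! ### Functoriality of inflation -/

namespace Inflation

section Functor

variable {K : Type u} [Field K] {δ : K} {p r : ℕ} {V : Type v} [AddCommGroup V] [Module K V]
  [Module (SymAlgebra K p) V] [IsScalarTower K (SymAlgebra K p) V]
  {W : Type v} [AddCommGroup W] [Module K W] [Module (SymAlgebra K p) W]
  [IsScalarTower K (SymAlgebra K p) W]

/-- Inflation of a homomorphism, as a linear map over the field. -/
def mapLinear (δ : K) (r : ℕ) (f : V →ₗ[SymAlgebra K p] W) :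
    Inflation δ p r V →ₗ[K] Inflation δ p r W :=
  lift (fun x => (mk δ x).comp (f.restrictScalars K))
    (fun x hx => LinearMap.ext fun v => mk_topArc hx _)
    (by
      intro π x v
      show mk δ ((permDiagram π).comp x) (f v) = mk δ x (f (ofPerm K π • v))
      rw [mk_permDiagram_comp, f.map_smul])

lemma mapLinear_mk (f : V →ₗ[SymAlgebra K p] W) (x : Diagram p r) (v : V) :
    mapLinear δ r f (mk δ x v) = mk δ x (f v) := lift_mk _ _ _ x v

/-- Inflation of a homomorphism. -/
def map (δ : K) (r : ℕ) (f : V →ₗ[SymAlgebra K p] W) :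
    Inflation δ p r V →ₗ[BrauerAlgebra δ r] Inflation δ p r W :=
  brauerLinear (mapLinear δ r f)
    (commutes_of_generators (closure_range_mk (δ := δ) (p := p) (r := r) (V := V))
      (fun y t => δ ^ t.1.loops y) (fun y t => (t.1.comp y, t.2))
      (fun y t => ofDiag_smul_mk y t.1 t.2)
      (n := fun t => mk δ t.1 (f t.2))
      (fun y t => ofDiag_smul_mk y t.1 (f t.2))
      (mapLinear δ r f) (fun t => mapLinear_mk f t.1 t.2))

lemma map_mk (f : V →ₗ[SymAlgebra K p] W) (x : Diagram p r) (v : V) :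
    map δ r f (mk δ x v) = mk δ x (f v) := mapLinear_mk f x v

lemma map_map {X : Type v} [AddCommGroup X] [Module K X] [Module (SymAlgebra K p) X]
    [IsScalarTower K (SymAlgebra K p) X] (f : V →ₗ[SymAlgebra K p] W)
    (g : W →ₗ[SymAlgebra K p] X) (z : Inflation δ p r V) :
    map δ r g (map δ r f z) = map δ r (g.comp f) z := by
  refine map_eq_of_generators (closure_range_mk (δ := δ) (p := p) (r := r) (V := V))
    ((map δ r g).toAddMonoidHom.comp (map δ r f).toAddMonoidHom)
    (map δ r (g.comp f)).toAddMonoidHom ?_ z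
  rintro ⟨x, v⟩
  show map δ r g (map δ r f (mk δ x v)) = map δ r (g.comp f) (mk δ x v)
  rw [map_mk, map_mk, map_mk, LinearMap.comp_apply]

lemma map_eq_self (f : V →ₗ[SymAlgebra K p] V) (hf : ∀ v, f v = v) (z : Inflation δ p r V) :
    map δ r f z = z := by
  refine map_eq_of_generators (closure_range_mk (δ := δ) (p := p) (r := r) (V := V))
    (map δ r f).toAddMonoidHom (AddMonoidHom.id _) ?_ z
  rintro ⟨x, v⟩
  show map δ r f (mk δ x v) = mk δ x v
  rw [map_mk, hf]

lemma map_eq_zero (f : V →ₗ[SymAlgebra K p] W) (hf : ∀ v, f v = 0) (z : Inflation δ p r V) :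
    map δ r f z = 0 := by
  refine map_eq_of_generators (closure_range_mk (δ := δ) (p := p) (r := r) (V := V))
    (map δ r f).toAddMonoidHom 0 ?_ z
  rintro ⟨x, v⟩
  show map δ r f (mk δ x v) = 0
  rw [map_mk, hf, (mk δ x).map_zero]

/-- Isomorphic modules have isomorphic inflations. -/
def mapEquiv (δ : K) (r : ℕ) (e : V ≃ₗ[SymAlgebra K p] W) :
    Inflation δ p r V ≃ₗ[BrauerAlgebra δ r] Inflation δ p r W :=
  { map δ r e.toLinearMap with
    invFun := map δ r e.symm.toLinearMap
    left_inv := fun z => (map_map _ _ z).trans (map_eq_self _ (fun v => e.symm_apply_apply v) z)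
    right_inv := fun z => (map_map _ _ z).trans (map_eq_self _ (fun v => e.apply_symm_apply v) z) }

end Functor

section Pi

variable {K : Type u} [Field K] {δ : K} {p r : ℕ} {ι : Type} [Fintype ι] {V : ι → Type v}
  [∀ i, AddCommGroup (V i)] [∀ i, Module K (V i)] [∀ i, Module (SymAlgebra K p) (V i)]
  [∀ i, IsScalarTower K (SymAlgebra K p) (V i)]

lemma sum_map_single_proj [DecidableEq ι] (z : Inflation δ p r (∀ i, V i)) :
    ∑ i, map δ r (LinearMap.single (SymAlgebra K p) V i)
      (map δ r (LinearMap.proj (R := SymAlgebra K p) (φ := V) i) z) = z := by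
  let F : Inflation δ p r (∀ i, V i) →+ Inflation δ p r (∀ i, V i) :=
    ∑ i, (map δ r (LinearMap.single (SymAlgebra K p) V i)).toAddMonoidHom.comp
      (map δ r (LinearMap.proj (R := SymAlgebra K p) (φ := V) i)).toAddMonoidHom
  have hF : ∀ z, F z = ∑ i, map δ r (LinearMap.single (SymAlgebra K p) V i)
      (map δ r (LinearMap.proj (R := SymAlgebra K p) (φ := V) i) z) := fun z => by
    rw [AddMonoidHom.finsetSum_apply]
    rfl
  rw [← hF]
  refine map_eq_of_generators (closure_range_mk (δ := δ) (p := p) (r := r) (V := ∀ i, V i))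
    F (AddMonoidHom.id _) ?_ z
  rintro ⟨x, v⟩
  rw [hF]
  show ∑ i, map δ r (LinearMap.single (SymAlgebra K p) V i)
      (map δ r (LinearMap.proj (R := SymAlgebra K p) (φ := V) i) (mk δ x v)) = mk δ x v
  have h : ∀ i, map δ r (LinearMap.single (SymAlgebra K p) V i)
      (map δ r (LinearMap.proj (R := SymAlgebra K p) (φ := V) i) (mk δ x v)) =
      mk δ x (Pi.single i (v i)) := fun i => by
    rw [map_mk, map_mk]
    rfl
  rw [Finset.sum_congr rfl fun i _ => h i, ← _root_.map_sum (mk δ x), Finset.univ_sum_single]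

/-- Inflation commutes with finite direct sums. -/
def piEquiv (δ : K) (r : ℕ) (V : ι → Type v) [∀ i, AddCommGroup (V i)] [∀ i, Module K (V i)]
    [∀ i, Module (SymAlgebra K p) (V i)] [∀ i, IsScalarTower K (SymAlgebra K p) (V i)] :
    Inflation δ p r (∀ i, V i) ≃ₗ[BrauerAlgebra δ r] ∀ i, Inflation δ p r (V i) :=
  LinearEquiv.ofBijective
    (LinearMap.pi fun i => map δ r (LinearMap.proj (R := SymAlgebra K p) (φ := V) i)) (by
      classical
      constructor
      · intro z z' h
        rw [← sum_map_single_proj z, ← sum_map_single_proj z']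
        exact Finset.sum_congr rfl fun i _ => congrArg _ (congrFun h i)
      · intro y
        refine ⟨∑ i, map δ r (LinearMap.single (SymAlgebra K p) V i) (y i), ?_⟩
        funext j
        rw [LinearMap.pi_apply, _root_.map_sum, Finset.sum_eq_single j]
        · rw [map_map]
          refine map_eq_self _ (fun v => ?_) _
          exact Pi.single_eq_same j v
        · intro i _ hi
          rw [map_map]
          refine map_eq_zero _ (fun v => ?_) _
          exact Pi.single_eq_of_ne hi.symm v
        · exact fun h => absurd (Finset.mem_univ _) h)

end Pi

/-- There is no room for more than `r` through strands. -/
lemma subsingleton_of_lt {K : Type u} [Field K] {δ : K} {p r : ℕ} (V : Type v) [AddCommGroup V]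
    [Module K V] [Module (SymAlgebra K p) V] (h : r < p) : Subsingleton (Inflation δ p r V) := by
  refine subsingleton_of_forall_eq 0 fun z => ?_
  refine map_eq_of_generators (closure_range_mk (δ := δ) (p := p) (r := r) (V := V))
    (AddMonoidHom.id _) 0 ?_ z
  rintro ⟨x, v⟩
  exact mk_topArc (Diagram.topArc_of_pr_lt (x.pr_le_bot.trans_lt h)) v

end Inflation

/-! ### The branching rule for the modules `U(r, lam)` -/

section Branching

variable {K : Type u} [Field K] {δ : K} {n r : ℕ} {lam mu : YoungDiagram} {T : Fin n → ℕ × ℕ}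

lemma IsFilling.nonempty_uMod_equiv (δ : K) (r : ℕ) (hT : IsFilling T lam) :
    Nonempty (Inflation δ n r (FillingSpecht K T) ≃ₗ[BrauerAlgebra δ r] UMod δ r lam) := by
  obtain rfl := hT.card_eq
  obtain ⟨e⟩ := nonempty_fillingSpecht_equiv (K := K) hT (isFilling_filling lam)
  exact ⟨Inflation.mapEquiv δ r (e.trans (LinearEquiv.ofEq _ _ (specht_eq K lam).symm))⟩

lemma nonempty_inflation_induced_equiv (hr : (r.factorial : K) ≠ 0) (hT : IsFilling T lam) :
    Nonempty (Inflation δ (n + 1) r (Induced K n (FillingSpecht K T)) ≃ₗ[BrauerAlgebra δ r]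
      ∀ mu : Up lam, UMod δ r mu.1) := by
  have hcard : ∀ mu : Up lam, mu.1.card = n + 1 := fun mu => by rw [mu.2.card, hT.card_eq]
  by_cases h : n + 1 ≤ r
  · choose S hS using fun mu : Up lam => exists_isFilling (hcard mu)
    obtain ⟨e⟩ := nonempty_induced_equiv_pi (factorial_ne_zero_of_le hr h) hT hS
    exact ⟨((Inflation.mapEquiv δ r e).trans
      (Inflation.piEquiv δ r fun mu => FillingSpecht K (S mu))).trans
      (LinearEquiv.piCongrRight fun mu => ((hS mu).nonempty_uMod_equiv δ r).some)⟩
  · have := Inflation.subsingleton_of_lt (δ := δ) (Induced K n (FillingSpecht K T)) (not_le.1 h)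
    have : ∀ mu : Up lam, Subsingleton (UMod δ r mu.1) := fun mu =>
      Inflation.subsingleton_of_lt _ ((not_le.1 h).trans_eq (hcard mu).symm)
    exact ⟨0⟩

lemma nonempty_inflation_restrict_equiv (hr : (r.factorial : K) ≠ 0) {T : Fin (n + 1) → ℕ × ℕ}
    (hT : IsFilling T lam) :
    Nonempty (Inflation δ n r (Restrict (symIncl K n) (FillingSpecht K T)) ≃ₗ[BrauerAlgebra δ r]
      ∀ mu : Down lam, UMod δ r mu.1) := by
  by_cases h : n ≤ r
  · choose S hS using fun mu : Down lam => exists_isFilling (Down.card hT.card_eq mu)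
    obtain ⟨e⟩ := nonempty_restrict_equiv_pi (factorial_ne_zero_of_le hr h) hT hS
    exact ⟨((Inflation.mapEquiv δ r e).trans
      (Inflation.piEquiv δ r fun mu => FillingSpecht K (S mu))).trans
      (LinearEquiv.piCongrRight fun mu => ((hS mu).nonempty_uMod_equiv δ r).some)⟩
  · have := Inflation.subsingleton_of_lt (δ := δ)
      (Restrict (symIncl K n) (FillingSpecht K T)) (not_le.1 h)
    have : ∀ mu : Down lam, Subsingleton (UMod δ r mu.1) := fun mu =>
      Inflation.subsingleton_of_lt _ ((not_le.1 h).trans_eq (Down.card hT.card_eq mu).symm)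
    exact ⟨0⟩

lemma nonempty_restrict_inflation_equiv (hss : IsSemisimpleRing (BrauerAlgebra δ r))
    (hT : IsFilling T lam) :
    Nonempty (Restrict (addStrandHom δ r) (Inflation δ n (r + 1) (FillingSpecht K T))
      ≃ₗ[BrauerAlgebra δ r] (∀ mu : Up lam, UMod δ r mu.1) × ∀ mu : Down lam, UMod δ r mu.1) := by
  have hr := factorial_ne_zero_of_isSemisimpleRing hss
  obtain ⟨e⟩ := nonempty_inflation_induced_equiv (δ := δ) hr hT
  cases n with
  | zero =>
    have : IsEmpty (Down lam) := ⟨fun mu => by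
      have := mu.2.card
      have := hT.card_eq
      omega⟩
    obtain ⟨f⟩ := Inflation.restrict_zero (δ := δ) (r := r) (FillingSpecht K T)
    exact ⟨(f.trans e).trans LinearEquiv.prodUnique.symm⟩
  | succ n =>
    obtain ⟨e'⟩ := nonempty_inflation_restrict_equiv (δ := δ) hr hT
    obtain ⟨f⟩ := Inflation.restrict_succ (δ := δ) (r := r) n (FillingSpecht K T)
    exact ⟨f.trans (e.prodCongr e')⟩

/-- A product indexed by a disjoint union of two subtypes. -/
def piOrEquivProd {R : Type u} [Ring R] {α : Type w} (M : α → Type v) [∀ a, AddCommGroup (M a)]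
    [∀ a, Module R (M a)] {P Q : α → Prop} (h : ∀ a, P a → ¬ Q a) :
    (∀ a : {a // P a ∨ Q a}, M a.1) ≃ₗ[R] (∀ a : {a // P a}, M a.1) × ∀ a : {a // Q a}, M a.1 :=
  LinearEquiv.ofBijective
    { toFun := fun f => (fun a => f ⟨a.1, Or.inl a.2⟩, fun a => f ⟨a.1, Or.inr a.2⟩)
      map_add' := fun _ _ => rfl
      map_smul' := fun _ _ => rfl } (by
    classical
    constructor
    · intro f g hfg
      rw [LinearMap.coe_mk, AddHom.coe_mk, Prod.mk.injEq] at hfg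
      funext ⟨a, ha⟩
      rcases ha with ha | ha
      · exact congrFun hfg.1 ⟨a, ha⟩
      · exact congrFun hfg.2 ⟨a, ha⟩
    · rintro ⟨f, g⟩
      refine ⟨fun a => if ha : P a.1 then f ⟨a.1, ha⟩ else g ⟨a.1, a.2.resolve_left ha⟩,
        Prod.ext (funext fun a => ?_) (funext fun a => ?_)⟩
      · exact dif_pos a.2
      · exact dif_neg fun ha => h _ ha a.2)

theorem nonempty_restrict_uMod_equiv (hss : IsSemisimpleRing (BrauerAlgebra δ r))
    (lam : YoungDiagram) :
    Nonempty (Restrict (addStrandHom δ r) (UMod δ (r + 1) lam) ≃ₗ[BrauerAlgebra δ r]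
      DirectSum {mu : YoungDiagram // AddCell lam mu ∨ AddCell mu lam}
        (fun mu => UMod δ r mu.1)) := by
  classical
  obtain ⟨e⟩ := nonempty_restrict_inflation_equiv hss (isFilling_filling lam)
  have hdisj : ∀ mu, AddCell lam mu → ¬ AddCell mu lam := fun mu h1 h2 => by
    have := h1.card
    have := h2.card
    omega
  have : Finite {mu : YoungDiagram // AddCell lam mu ∨ AddCell mu lam} :=
    Set.Finite.to_subtype
      ((Set.finite_coe_iff.1 (inferInstanceAs (Finite (Up lam)))).union
        (Set.finite_coe_iff.1 (inferInstanceAs (Finite (Down lam)))))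
  have := Fintype.ofFinite {mu : YoungDiagram // AddCell lam mu ∨ AddCell mu lam}
  rw [← specht_eq] at e
  exact ⟨(e.trans (piOrEquivProd (fun mu => UMod δ r mu) hdisj).symm).trans
    (DirectSum.linearEquivFunOnFintype (BrauerAlgebra δ r) _ _).symm⟩

end Branching

end Brauer

end

theorem mainTheorem7 {K : Type*} [Field K] (δ : K) (r : ℕ)
    (hss : IsSemisimpleRing (Brauer.BrauerAlgebra δ r)) :
    (∀ (V : Type*) [AddCommGroup V] [Module K V] [Module (Brauer.SymAlgebra K 0) V]
        [IsScalarTower K (Brauer.SymAlgebra K 0) V],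
      Nonempty (Brauer.Restrict (Brauer.addStrandHom δ r) (Brauer.Inflation δ 0 (r + 1) V)
        ≃ₗ[Brauer.BrauerAlgebra δ r] Brauer.Inflation δ 1 r (Brauer.Induced K 0 V))) ∧
    (∀ (p : ℕ) (V : Type*) [AddCommGroup V] [Module K V] [Module (Brauer.SymAlgebra K (p + 1)) V]
        [IsScalarTower K (Brauer.SymAlgebra K (p + 1)) V],
      Nonempty (Brauer.Restrict (Brauer.addStrandHom δ r) (Brauer.Inflation δ (p + 1) (r + 1) V)
        ≃ₗ[Brauer.BrauerAlgebra δ r]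
          (Brauer.Inflation δ (p + 2) r (Brauer.Induced K (p + 1) V) ×
            Brauer.Inflation δ p r (Brauer.Restrict (Brauer.symIncl K p) V)))) ∧
    (∀ lam : YoungDiagram,
      Nonempty (Brauer.Restrict (Brauer.addStrandHom δ r) (Brauer.UMod δ (r + 1) lam)
        ≃ₗ[Brauer.BrauerAlgebra δ r]
          DirectSum {mu : YoungDiagram // Brauer.AddCell lam mu ∨ Brauer.AddCell mu lam}
            (fun mu => Brauer.UMod δ r mu.1))) := by
  exact ⟨fun V _ _ _ _ => Brauer.Inflation.restrict_zero V,
    fun p V _ _ _ _ => Brauer.Inflation.restrict_succ p V,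
    Brauer.nonempty_restrict_uMod_equiv hss⟩
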